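/- Let $X_1$ and $X_2$ be closed (compact, without boundary, not necessarily connected) oriented real smooth manifolds, and let $f\colon X_1\to X_2$ be a continuous (for instance smooth) map. Let $U_2\subseteq X_2$ be an open subset, put $U_1=f^{-1}(U_2)$, and suppose that $f$ restricts to a homeomorphism (for instance a diffeomorphism) $f|_{U_1}\colon U_1\to U_2$. Let $A$ be a module over a ring $R$ (for instance $R=\mathbb{Z}$ and $A$ any abelian group, or $A=R=\mathbb{Q}$), and let $H^*$ and $H^*_c$ denote cohomology and cohomology with compact supports with coefficients in $A$, taken as Alexander–Spanier cohomology (which on manifolds agrees with singular and with sheaf cohomology). For $i=1,2$ let $$IB_i^*=\ker\bigl(H^{*+1}_c(U_i)\to H^{*+1}(X_i)\bigr)$$ be the kernel of the natural map, extension by zero. Then the map $f^*\colon H^{*+1}_c(U_2)\to H^{*+1}_c(U_1)$, defined since $f|_{U_1}$ is proper, carries $IB_2^*$ into $IB_1^*$ and induces an isomorphism $$f^*\colon IB_2^*\to IB_1^*$$ of $R$-modules in every degree. -/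

import Mathlib

open Topology TopologicalSpace
open scoped Manifold ContDiff

/-- An orientation of a smooth `n`-manifold without boundary, given by an oriented atlas: a family
of smooth charts which covers `M` and whose transition maps have positive Jacobian determinant. -/
structure OrientedAtlas (n : ℕ) (M : Type*) [TopologicalSpace M]
    [ChartedSpace (EuclideanSpace ℝ (Fin n)) M] where
  charts : Set (OpenPartialHomeomorph M (EuclideanSpace ℝ (Fin n)))
  subset_maximalAtlas : charts ⊆ IsManifold.maximalAtlas (𝓡 n) ∞ M
  exists_mem_source : ∀ x : M, ∃ e ∈ charts, x ∈ e.source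
  det_pos : ∀ e ∈ charts, ∀ e' ∈ charts, ∀ y ∈ (e.symm.trans e').source,
    0 < (fderiv ℝ (e.symm.trans e') y).det

/-! ### Alexander-Spanier cohomology -/

namespace AlexanderSpanier

section Subquotient

variable {R M N : Type*} [Ring R] [AddCommGroup M] [Module R M] [AddCommGroup N] [Module R N]

/-- The map `Z / (B ∩ Z) → Z' / (B' ∩ Z')` induced by a linear map. -/
def subquotientMap {Z B : Submodule R M} {Z' B' : Submodule R N} (g : M →ₗ[R] N)
    (hZ : ∀ x ∈ Z, g x ∈ Z') (hB : ∀ x ∈ B, x ∈ Z → g x ∈ B') :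
    (Z ⧸ B.submoduleOf Z) →ₗ[R] (Z' ⧸ B'.submoduleOf Z') :=
  Submodule.mapQ _ _ (g.restrict hZ) (fun x hx => hB x.1 hx x.2)

end Subquotient

/-- `A`-valued functions of `k + 1` points of `X`. -/
abbrev Cochain (X A : Type*) (k : ℕ) : Type _ := (Fin (k + 1) → X) → A

section Basic

variable (R : Type*) [Ring R] (X : Type*) (A : Type*) [AddCommGroup A] [Module R A]

/-- The coboundary `(δφ)(x₀, …, x_{k+1}) = ∑ (-1)^i φ(x₀, …, x̂ᵢ, …, x_{k+1})`. -/
def coboundary (k : ℕ) : Cochain X A k →ₗ[R] Cochain X A (k + 1) where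
  toFun φ s := ∑ i : Fin (k + 2), ((-1 : ℤ) ^ (i : ℕ)) • φ (fun j => s (i.succAbove j))
  map_add' φ ψ := by
    funext s
    simp [smul_add, Finset.sum_add_distrib]
  map_smul' r φ := by
    funext s
    simp only [Pi.smul_apply, RingHom.id_apply, Finset.smul_sum]
    exact Finset.sum_congr rfl fun i _ => smul_comm _ _ _

variable [TopologicalSpace X]

variable {X A} in
/-- `φ` vanishes on all tuples of points close to `x`. -/
def VanishesNear {k : ℕ} (φ : Cochain X A k) (x : X) : Prop :=
  ∃ V ∈ 𝓝 x, ∀ s : Fin (k + 1) → X, (∀ i, s i ∈ V) → φ s = 0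

/-- Locally zero functions: those that vanish on a neighbourhood of the diagonal. -/
def locallyZero (k : ℕ) : Submodule R (Cochain X A k) where
  carrier := {φ | ∀ x, VanishesNear φ x}
  zero_mem' := fun _ => ⟨Set.univ, Filter.univ_mem, fun _ _ => rfl⟩
  add_mem' := by
    intro φ ψ hφ hψ x
    obtain ⟨V, hV, h⟩ := hφ x
    obtain ⟨W, hW, h'⟩ := hψ x
    refine ⟨V ∩ W, Filter.inter_mem hV hW, fun s hs => ?_⟩
    simp [h s fun i => (hs i).1, h' s fun i => (hs i).2]
  smul_mem' := by
    intro r φ hφ x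
    obtain ⟨V, hV, h⟩ := hφ x
    exact ⟨V, hV, fun s hs => by simp [h s hs]⟩

/-- Functions that vanish on all tuples of points outside some compact set. If `X` is locally
compact and Hausdorff, a function is of this form up to a locally zero function if and only if its
germ along the diagonal has compact support. -/
def compactlySupported (k : ℕ) : Submodule R (Cochain X A k) where
  carrier := {φ | ∃ K : Set X, IsCompact K ∧
    ∀ s : Fin (k + 1) → X, (∀ i, s i ∉ K) → φ s = 0}
  zero_mem' := ⟨∅, isCompact_empty, fun _ _ => rfl⟩
  add_mem' := by
    rintro φ ψ ⟨K, hK, h⟩ ⟨L, hL, h'⟩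
    refine ⟨K ∪ L, hK.union hL, fun s hs => ?_⟩
    simp [h s fun i hi => hs i (Or.inl hi), h' s fun i hi => hs i (Or.inr hi)]
  smul_mem' := by
    rintro r φ ⟨K, hK, h⟩
    exact ⟨K, hK, fun s hs => by simp [h s hs]⟩

/-- Representatives of the Alexander-Spanier cocycles. -/
def cocycles (k : ℕ) : Submodule R (Cochain X A k) :=
  (locallyZero R X A (k + 1)).comap (coboundary R X A k)

/-- Representatives of the Alexander-Spanier coboundaries. -/
def coboundaries : (k : ℕ) → Submodule R (Cochain X A k)
  | 0 => locallyZero R X A 0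
  | k + 1 => LinearMap.range (coboundary R X A k) ⊔ locallyZero R X A (k + 1)

/-- Alexander-Spanier cohomology `H^k(X; A)`: the cohomology of the complex of all functions of
`k + 1` points modulo the locally zero ones. -/
abbrev Cohomology (k : ℕ) : Type _ :=
  cocycles R X A k ⧸ (coboundaries R X A k).submoduleOf (cocycles R X A k)

/-- Representatives of the compactly supported cocycles. -/
def compactCocycles (k : ℕ) : Submodule R (Cochain X A k) :=
  compactlySupported R X A k ⊓ cocycles R X A k

/-- Representatives of the coboundaries of compactly supported cochains. -/
def compactCoboundaries : (k : ℕ) → Submodule R (Cochain X A k)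
  | 0 => locallyZero R X A 0
  | k + 1 => (compactlySupported R X A k).map (coboundary R X A k) ⊔ locallyZero R X A (k + 1)

/-- Alexander-Spanier cohomology with compact supports `H_c^k(X; A)`, for `X` locally compact and
Hausdorff: the cohomology of the complex of compactly supported functions modulo the locally zero
ones among them. -/
abbrev CompactCohomology (k : ℕ) : Type _ :=
  compactCocycles R X A k ⧸
    (compactCoboundaries R X A k).submoduleOf (compactCocycles R X A k)

end Basic

section Pullback

variable (R : Type*) [Ring R] {X Y : Type*} (A : Type*) [AddCommGroup A] [Module R A]

/-- Pullback of cochains. -/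
def cochainPullback (f : X → Y) (k : ℕ) : Cochain Y A k →ₗ[R] Cochain X A k where
  toFun φ s := φ (fun i => f (s i))
  map_add' _ _ := rfl
  map_smul' _ _ := rfl

theorem coboundary_cochainPullback (f : X → Y) (k : ℕ) (φ : Cochain Y A k) :
    coboundary R X A k (cochainPullback R A f k φ) =
      cochainPullback R A f (k + 1) (coboundary R Y A k φ) := rfl

variable [TopologicalSpace X] [TopologicalSpace Y]

theorem cochainPullback_mem_locallyZero {f : X → Y} (hf : Continuous f) {k : ℕ}
    {φ : Cochain Y A k} (hφ : φ ∈ locallyZero R Y A k) :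
    cochainPullback R A f k φ ∈ locallyZero R X A k := by
  intro x
  obtain ⟨V, hV, h⟩ := hφ (f x)
  exact ⟨f ⁻¹' V, hf.continuousAt hV, fun s hs => h _ hs⟩

theorem cochainPullback_mem_compactlySupported {f : X → Y} (hf : IsProperMap f) {k : ℕ}
    {φ : Cochain Y A k} (hφ : φ ∈ compactlySupported R Y A k) :
    cochainPullback R A f k φ ∈ compactlySupported R X A k := by
  obtain ⟨K, hK, h⟩ := hφ
  exact ⟨f ⁻¹' K, hf.isCompact_preimage hK, fun s hs => h _ hs⟩

theorem cochainPullback_mem_cocycles {f : X → Y} (hf : Continuous f) {k : ℕ}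
    {φ : Cochain Y A k} (hφ : φ ∈ cocycles R Y A k) :
    cochainPullback R A f k φ ∈ cocycles R X A k :=
  cochainPullback_mem_locallyZero R A hf hφ

theorem cochainPullback_mem_coboundaries {f : X → Y} (hf : Continuous f) {k : ℕ}
    {φ : Cochain Y A k} (hφ : φ ∈ coboundaries R Y A k) :
    cochainPullback R A f k φ ∈ coboundaries R X A k := by
  cases k with
  | zero => exact cochainPullback_mem_locallyZero R A hf hφ
  | succ k =>
    obtain ⟨_, ⟨ψ, rfl⟩, l, hl, rfl⟩ := Submodule.mem_sup.1 hφ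
    rw [map_add]
    exact Submodule.add_mem_sup ⟨cochainPullback R A f k ψ, rfl⟩
      (cochainPullback_mem_locallyZero R A hf hl)

theorem cochainPullback_mem_compactCoboundaries {f : X → Y} (hf : IsProperMap f) {k : ℕ}
    {φ : Cochain Y A k} (hφ : φ ∈ compactCoboundaries R Y A k) :
    cochainPullback R A f k φ ∈ compactCoboundaries R X A k := by
  cases k with
  | zero => exact cochainPullback_mem_locallyZero R A hf.continuous hφ
  | succ k =>
    obtain ⟨_, ⟨ψ, hψ, rfl⟩, l, hl, rfl⟩ := Submodule.mem_sup.1 hφ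
    rw [map_add]
    exact Submodule.add_mem_sup
      ⟨cochainPullback R A f k ψ, cochainPullback_mem_compactlySupported R A hf hψ, rfl⟩
      (cochainPullback_mem_locallyZero R A hf.continuous hl)

/-- `f^* : H^k(Y; A) → H^k(X; A)` for a continuous map `f`. -/
def pullback (f : X → Y) (hf : Continuous f) (k : ℕ) :
    Cohomology R Y A k →ₗ[R] Cohomology R X A k :=
  subquotientMap (cochainPullback R A f k)
    (fun _ h => cochainPullback_mem_cocycles R A hf h)
    (fun _ h _ => cochainPullback_mem_coboundaries R A hf h)

/-- `f^* : H_c^k(Y; A) → H_c^k(X; A)` for a proper map `f`. -/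
def compactPullback (f : X → Y) (hf : IsProperMap f) (k : ℕ) :
    CompactCohomology R Y A k →ₗ[R] CompactCohomology R X A k :=
  subquotientMap (cochainPullback R A f k)
    (fun _ h => ⟨cochainPullback_mem_compactlySupported R A hf h.1,
      cochainPullback_mem_cocycles R A hf.continuous h.2⟩)
    (fun _ h _ => cochainPullback_mem_compactCoboundaries R A hf h)

end Pullback

section Extension

variable (R : Type*) [Ring R] {X : Type*} [TopologicalSpace X]
  (A : Type*) [AddCommGroup A] [Module R A] (U : Opens X)

open Classical in
/-- Extension of a function of points of `U` by zero. -/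
noncomputable def cochainExtend (k : ℕ) : Cochain U A k →ₗ[R] Cochain X A k where
  toFun φ s := if h : ∀ i, s i ∈ U then φ (fun i => ⟨s i, h i⟩) else 0
  map_add' φ ψ := by
    funext s
    by_cases h : ∀ i, s i ∈ U <;> simp [h]
  map_smul' r φ := by
    funext s
    by_cases h : ∀ i, s i ∈ U <;> simp [h]

variable {U}

theorem cochainExtend_of_mem {k : ℕ} (φ : Cochain U A k) {s : Fin (k + 1) → X}
    (h : ∀ i, s i ∈ U) : cochainExtend R A U k φ s = φ (fun i => ⟨s i, h i⟩) :=
  dif_pos h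

theorem cochainExtend_eq_zero {k : ℕ} {φ : Cochain U A k} {K : Set U}
    (hK : ∀ s : Fin (k + 1) → U, (∀ i, s i ∉ K) → φ s = 0) {s : Fin (k + 1) → X}
    (hs : ∀ i, s i ∉ Subtype.val '' K) : cochainExtend R A U k φ s = 0 := by
  by_cases h : ∀ i, s i ∈ U
  · rw [cochainExtend_of_mem R A φ h]
    exact hK _ fun i hi => hs i ⟨_, hi, rfl⟩
  · exact dif_neg h

theorem coboundary_cochainExtend_of_mem {k : ℕ} (φ : Cochain U A k) {s : Fin (k + 2) → X}
    (h : ∀ i, s i ∈ U) : coboundary R X A k (cochainExtend R A U k φ) s =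
      coboundary R U A k φ (fun i => ⟨s i, h i⟩) := by
  simp only [coboundary, LinearMap.coe_mk, AddHom.coe_mk]
  refine Finset.sum_congr rfl fun i _ => ?_
  rw [cochainExtend_of_mem R A φ fun j => h (i.succAbove j)]

theorem coboundary_eq_zero {Y : Type*} {k : ℕ} {φ : Cochain Y A k} {K : Set Y}
    (hK : ∀ s : Fin (k + 1) → Y, (∀ i, s i ∉ K) → φ s = 0) (s : Fin (k + 2) → Y)
    (hs : ∀ i, s i ∉ K) : coboundary R Y A k φ s = 0 := by
  simp only [coboundary, LinearMap.coe_mk, AddHom.coe_mk]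
  refine Finset.sum_eq_zero fun i _ => ?_
  rw [hK _ fun j => hs (i.succAbove j), smul_zero]

variable [T2Space X]

/-- A criterion for a function on `X` to be locally zero. -/
theorem mem_locallyZero_of_extend {k : ℕ} {φ : Cochain U A k} (hφ : φ ∈ locallyZero R U A k)
    {Φ : Cochain X A k} {K : Set U} (hK : IsCompact K)
    (h1 : ∀ (s : Fin (k + 1) → X) (h : ∀ i, s i ∈ U), Φ s = φ (fun i => ⟨s i, h i⟩))
    (h2 : ∀ s : Fin (k + 1) → X, (∀ i, s i ∉ Subtype.val '' K) → Φ s = 0) :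
    Φ ∈ locallyZero R X A k := by
  intro x
  by_cases hx : x ∈ U
  · obtain ⟨V, hV, h⟩ := hφ ⟨x, hx⟩
    refine ⟨Subtype.val '' V, U.2.isOpenEmbedding_subtypeVal.image_mem_nhds.2 hV, fun s hs => ?_⟩
    have hU : ∀ i, s i ∈ U := fun i => by
      obtain ⟨y, -, hy⟩ := hs i
      exact hy ▸ y.2
    rw [h1 s hU]
    refine h _ fun i => ?_
    obtain ⟨y, hyV, hy⟩ := hs i
    have : y = ⟨s i, hU i⟩ := Subtype.ext hy
    exact this ▸ hyV
  · refine ⟨(Subtype.val '' K)ᶜ,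
      (hK.image continuous_subtype_val).isClosed.isOpen_compl.mem_nhds ?_, h2⟩
    rintro ⟨y, -, rfl⟩
    exact hx y.2

theorem cochainExtend_mem_cocycles {k : ℕ} {φ : Cochain U A k}
    (hφ : φ ∈ compactCocycles R U A k) : cochainExtend R A U k φ ∈ cocycles R X A k := by
  obtain ⟨⟨K, hK, h⟩, hc⟩ := hφ
  exact mem_locallyZero_of_extend R A hc hK
    (fun s hs => coboundary_cochainExtend_of_mem R A φ hs)
    (coboundary_eq_zero R A fun s hs => cochainExtend_eq_zero R A h hs)

theorem cochainExtend_mem_locallyZero {k : ℕ} {φ : Cochain U A k}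
    (hφ : φ ∈ compactlySupported R U A k) (h0 : φ ∈ locallyZero R U A k) :
    cochainExtend R A U k φ ∈ locallyZero R X A k := by
  obtain ⟨K, hK, h⟩ := hφ
  exact mem_locallyZero_of_extend R A h0 hK (fun s hs => cochainExtend_of_mem R A φ hs)
    (fun s hs => cochainExtend_eq_zero R A h hs)

theorem cochainExtend_mem_coboundaries {k : ℕ} {φ : Cochain U A k}
    (hb : φ ∈ compactCoboundaries R U A k) (hφ : φ ∈ compactlySupported R U A k) :
    cochainExtend R A U k φ ∈ coboundaries R X A k := by
  cases k with
  | zero => exact cochainExtend_mem_locallyZero R A hφ hb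
  | succ k =>
    obtain ⟨_, ⟨ψ, ⟨K, hK, hψ⟩, rfl⟩, l, hl, rfl⟩ := Submodule.mem_sup.1 hb
    obtain ⟨L, hL, h⟩ := hφ
    refine Submodule.mem_sup.2 ⟨_, ⟨cochainExtend R A U k ψ, rfl⟩,
      cochainExtend R A U (k + 1) (coboundary R U A k ψ + l) -
        coboundary R X A k (cochainExtend R A U k ψ), ?_, by abel⟩
    refine mem_locallyZero_of_extend R A hl (hK.union hL) (fun s hs => ?_) (fun s hs => ?_)
    · rw [Pi.sub_apply, cochainExtend_of_mem R A _ hs, coboundary_cochainExtend_of_mem R A _ hs,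
        Pi.add_apply, add_sub_cancel_left]
    · rw [Set.image_union] at hs
      rw [Pi.sub_apply, cochainExtend_eq_zero R A h fun i hi => hs i (Or.inr hi),
        coboundary_eq_zero R A (fun t ht => cochainExtend_eq_zero R A hψ ht) s
          fun i hi => hs i (Or.inl hi), sub_zero]

variable (U)

/-- The natural map `H_c^k(U; A) → H^k(X; A)`, extension by zero, for `U` open in `X`. -/
noncomputable def extendByZero (k : ℕ) : CompactCohomology R U A k →ₗ[R] Cohomology R X A k :=
  subquotientMap (cochainExtend R A U k)
    (fun _ h => cochainExtend_mem_cocycles R A h)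
    (fun _ hb h => cochainExtend_mem_coboundaries R A hb h.1)

/-- The kernel of `H_c^k(U; A) → H^k(X; A)`. In terms of boundary cycles this is `IB^{k-1}`. -/
noncomputable def kerExtend (k : ℕ) : Submodule R (CompactCohomology R U A k) :=
  LinearMap.ker (extendByZero R A U k)

end Extension

section Restriction

variable {X Y : Type*} [TopologicalSpace X] [TopologicalSpace Y]

/-- The restriction `f⁻¹(U) → U` of `f`. -/
def restrictOpen (f : C(X, Y)) (U : Opens Y) : Opens.comap f U → U :=
  fun x => ⟨f x.1, x.2⟩

theorem isProperMap_restrictOpen [CompactSpace X] [T2Space Y] (f : C(X, Y)) (U : Opens Y) :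
    IsProperMap (restrictOpen f U) :=
  f.continuous.isProperMap.restrictPreimage (U : Set Y)

variable (R : Type*) [Ring R] (A : Type*) [AddCommGroup A] [Module R A]
  [CompactSpace X] [T2Space X] [T2Space Y]

theorem extendByZero_compactPullback (f : C(X, Y)) (U : Opens Y) (k : ℕ)
    (a : CompactCohomology R U A k) :
    extendByZero R A (Opens.comap f U) k
        (compactPullback R A (restrictOpen f U) (isProperMap_restrictOpen f U) k a) =
      pullback R A f f.continuous k (extendByZero R A U k a) := by
  obtain ⟨φ, rfl⟩ := Submodule.Quotient.mk_surjective _ a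
  rfl

/-- The map `f^*` from `ker (H_c^k(U) → H^k(Y))` to `ker (H_c^k(f⁻¹(U)) → H^k(X))`. -/
noncomputable def kerPullback (f : C(X, Y)) (U : Opens Y) (k : ℕ) :
    kerExtend R A U k →ₗ[R] kerExtend R A (Opens.comap f U) k :=
  (compactPullback R A (restrictOpen f U) (isProperMap_restrictOpen f U) k).restrict
    (fun a ha => by
      have h : extendByZero R A U k a = 0 := ha
      change extendByZero R A (Opens.comap f U) k _ = 0
      rw [extendByZero_compactPullback, h, map_zero])

end Restriction

end AlexanderSpanier

/-! Injectivity on the kernels is formal: over `U₂` the map `f` is a homeomorphism, so it induces an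
isomorphism of compactly supported cohomology. For surjectivity one needs: if β is a class of `X₂`
extended by zero from `U₂` and `f^*β = 0`, then `β = 0`. Duality gives an umkehr map with `f_! f^*β
= f_!(1) ∪ β`, and `f_!(1)` is the degree, a locally constant function which is ±1 on every
component meeting `U₂`. Hence β is, up to locally constant signs, `f_! f^*β = 0`. The dimensions
agree as soon as `U₂` is nonempty (`dimension_eq`).

The umkehr map is built by hand. A topological embedding `F` of `X₁` into `ℝ ^ D`
(`exists_embedding`) turns `f` into the graph of `x ↦ (f x, F x)` in `X₂ × ℝ ^ D`, which is locally
flat of codimension `D` (`Adapted.flat_defining`). Integral local cohomology with supports in a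
locally flat subset is `ℤ` in the degree of the codimension and zero otherwise
(`local_cohomology_model`). The orientations select generators consistently, and these glue to a
Thom class τ of the graph (`Adapted.exists_graph_class`). Then `f_!` is the cup product with τ
followed by desuspension along `ℝ ^ D`, of which only the injectivity of suspension is used
(`mem_exactOn_of_iter`).

If `f^*β = 0`, the pullback of β to the product is exact near the graph
(`pb_fst_mem_exactOn_range`), so its product with τ is exact with compact supports. Over `U₂` the
graph is that of a section `s`, so there τ is ± the Thom class of the section. The sign is locally
constant because it is the degree of τ on fibres (`Adapted.exists_sign`). Translating the section to
zero identifies the product with ± the suspension of β, so `β = 0`; this is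
`Adapted.mem_exactOn_of_pb`.

Alexander–Spanier cochains are arbitrary functions, so they may be multiplied by indicator functions
and pulled back along maps that are continuous only where needed. In particular, for the Heaviside
function `H`, the cocycle `δH(θ)` represents the Thom class of a hypersurface `θ = 0`. -/

namespace AlexanderSpanier

set_option linter.unusedSectionVars false

/-! ### Cochain algebra without topology: contraction, cut-offs, prisms and cup products. -/

section Algebra

variable {X Y Z G : Type*} [AddCommGroup G]

/-- The coboundary as a map of abelian groups. -/
def cob {k : ℕ} : Cochain X G k →+ Cochain X G (k + 1) :=
  (coboundary ℤ X G k).toAddMonoidHom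

theorem cob_apply {k : ℕ} (φ : Cochain X G k) (s : Fin (k + 2) → X) :
    cob φ s = ∑ i : Fin (k + 2), ((-1 : ℤ) ^ (i : ℕ)) • φ (fun j => s (i.succAbove j)) := rfl

theorem coboundary_eq_cob {R A : Type*} [Ring R] [AddCommGroup A] [Module R A] {k : ℕ}
    (φ : Cochain X A k) : coboundary R X A k φ = cob φ := rfl

/-- Prepend the vertex `x`. -/
def cone {k : ℕ} (x : X) (φ : Cochain X G (k + 1)) : Cochain X G k :=
  fun s => φ (Matrix.vecCons x s)

/-- Pullback of cochains along an arbitrary function. -/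
def pb {k : ℕ} (f : X → Y) (φ : Cochain Y G k) : Cochain X G k :=
  fun s => φ (fun i => f (s i))

theorem cob_pb {k : ℕ} (f : X → Y) (φ : Cochain Y G k) : cob (pb f φ) = pb f (cob φ) := rfl

theorem cone_sub {k : ℕ} (x : X) (φ ψ : Cochain X G (k + 1)) :
    cone x (φ - ψ) = cone x φ - cone x ψ := rfl

theorem cone_add {k : ℕ} (x : X) (φ ψ : Cochain X G (k + 1)) :
    cone x (φ + ψ) = cone x φ + cone x ψ := rfl

/-- This extensionality principle drives the inductions below: contracting the first vertex lowers
the degree, so identities between signed sums reduce to `cone_cob`. -/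
theorem cochain_ext_cons {k : ℕ} {φ ψ : Cochain X G (k + 1)}
    (h : ∀ x, cone x φ = cone x ψ) : φ = ψ := by
  funext s
  have := congrFun (h (s 0)) (fun i => s i.succ)
  have e : Matrix.vecCons (s 0) (fun i : Fin (k + 1) => s i.succ) = s := by
    funext i; cases i using Fin.cases <;> rfl
  simpa [cone, e] using this

theorem vecCons_comp_succAbove {k : ℕ} (x : X) (s : Fin (k + 2) → X) (i : Fin (k + 2)) :
    (fun j => Matrix.vecCons x s (i.succ.succAbove j)) =
      Matrix.vecCons x (fun j => s (i.succAbove j)) := by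
  funext j
  cases j using Fin.cases <;> simp

/-- In the alternating sum the face omitting the new vertex is `φ`, and the remaining faces are
those of the cone with reversed sign. Hence the complex of all functions is contractible in positive
degrees. -/
theorem cone_cob {k : ℕ} (x : X) (φ : Cochain X G (k + 1)) :
    cone x (cob φ) = φ - cob (cone x φ) := by
  funext s
  simp only [cone, cob_apply, Pi.sub_apply]
  rw [Fin.sum_univ_succ]
  simp only [vecCons_comp_succAbove]
  simp [pow_succ, sub_eq_add_neg]

theorem cone_cob_zero (x : X) (φ : Cochain X G 0) :
    cone x (cob φ) = φ - fun _ => φ (fun _ => x) := by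
  funext s
  simp only [cone, cob_apply, Pi.sub_apply]
  rw [Fin.sum_univ_two]
  simp only [Fin.val_zero, pow_zero, one_smul, Fin.val_one, pow_one, neg_smul]
  rw [← sub_eq_add_neg]
  have h0 : (fun j : Fin 1 => Matrix.vecCons x s (Fin.succAbove 0 j)) = s := by
    funext j; simp
  have h1 : (fun j : Fin 1 => Matrix.vecCons x s (Fin.succAbove 1 j)) = fun _ => x := by
    funext j; fin_cases j; rfl
  rw [h0, h1]

theorem cob_const_zero (a : G) : cob (fun _ : Fin 1 → X => a) = (0 : Cochain X G 1) := by
  funext s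
  simp [cob_apply, Fin.sum_univ_two]

theorem cob_cob {k : ℕ} (φ : Cochain X G k) : cob (cob φ) = 0 := by
  induction k with
  | zero =>
    refine cochain_ext_cons fun x => ?_
    rw [cone_cob, cone_cob_zero, map_sub, cob_const_zero]
    simp [show cone x (0 : Cochain X G 2) = 0 from rfl]
  | succ k ih =>
    refine cochain_ext_cons fun x => ?_
    rw [cone_cob, cone_cob, map_sub, ih]
    simp [show cone x (0 : Cochain X G (k + 1 + 2)) = 0 from rfl]

/-! ### Cutting off by a function of the first vertex -/

/-- Multiplication by a function of the first vertex. -/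
def cut {k : ℕ} (χ : X → ℤ) (φ : Cochain X G k) : Cochain X G k :=
  fun s => χ (s 0) • φ s

theorem cut_sub {k : ℕ} (χ : X → ℤ) (φ ψ : Cochain X G k) :
    cut χ (φ - ψ) = cut χ φ - cut χ ψ := by
  funext s; simp [cut, smul_sub]

/-- The product `δχ ∪ φ`. -/
def step {k : ℕ} (χ : X → ℤ) (φ : Cochain X G k) : Cochain X G (k + 1) :=
  fun s => (χ (s 1) - χ (s 0)) • φ (fun i => s i.succ)

/-- Leibniz rule for the product with the 0-cochain χ. It exhibits `step` as the commutator of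
coboundary and cut-off. -/
theorem cob_cut {k : ℕ} (χ : X → ℤ) (φ : Cochain X G k) :
    cob (cut χ φ) = step χ φ + cut χ (cob φ) := by
  refine cochain_ext_cons fun x => ?_
  cases k with
  | zero =>
    rw [cone_cob_zero]
    funext s
    have h := congrFun (cone_cob_zero x φ) s
    simp only [cone, Pi.sub_apply] at h
    simp [cut, cone, step, h, sub_smul, smul_sub]
  | succ k =>
    rw [cone_cob]
    funext s
    have h := congrFun (cone_cob x φ) s
    simp only [cone, Pi.sub_apply] at h
    have h2 : cone x (cut χ φ) = χ x • cone x φ := by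
      funext t; simp [cone, cut]
    rw [h2, map_zsmul]
    simp [cut, cone, step, h, sub_smul, smul_sub]

theorem step_eq {k : ℕ} (χ : X → ℤ) (φ : Cochain X G k) :
    step χ φ = cob (cut χ φ) - cut χ (cob φ) := by
  rw [cob_cut]; abel

theorem cob_step {k : ℕ} (χ : X → ℤ) (φ : Cochain X G k) :
    cob (step χ φ) = - step χ (cob φ) := by
  rw [step_eq, step_eq, map_sub, cob_cob, cob_cob]
  have : cut χ (0 : Cochain X G (k + 2)) = 0 := by funext s; simp [cut]
  rw [this]; abel

theorem step_sub {k : ℕ} (χ : X → ℤ) (φ ψ : Cochain X G k) :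
    step χ (φ - ψ) = step χ φ - step χ ψ := by
  funext s; simp [step, smul_sub]

theorem step_zsmul {k : ℕ} (χ : X → ℤ) (m : ℤ) (φ : Cochain X G k) :
    step χ (m • φ) = m • step χ φ := by
  funext s; simp only [step, Pi.smul_apply]; rw [smul_comm]

theorem pb_step {k : ℕ} (f : X → Y) (χ : Y → ℤ) (φ : Cochain Y G k) :
    pb f (step χ φ) = step (fun x => χ (f x)) (pb f φ) := rfl

/-! ### The prism operator -/

/-- The prism between two functions. -/
def prism (g h : Z → X) : {k : ℕ} → Cochain X G (k + 1) → Cochain Z G k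
  | 0, φ => fun s => φ (Matrix.vecCons (g (s 0)) fun i => h (s i))
  | _ + 1, φ => fun s => φ (Matrix.vecCons (g (s 0)) fun i => h (s i)) -
      prism g h (cone (g (s 0)) φ) (fun i => s i.succ)

theorem prism_sub (g h : Z → X) {k : ℕ} (φ ψ : Cochain X G (k + 1)) :
    prism g h (φ - ψ) = prism g h φ - prism g h ψ := by
  induction k with
  | zero => rfl
  | succ k ih =>
    funext s
    simp only [prism, cone_sub, ih, Pi.sub_apply]
    abel

theorem cone_prism (g h : Z → X) {k : ℕ} (z : Z) (φ : Cochain X G (k + 2)) :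
    cone z (prism g h φ) = pb h (cone (h z) (cone (g z) φ)) - prism g h (cone (g z) φ) := by
  funext s
  simp only [cone, prism, pb, Pi.sub_apply, Matrix.cons_val_zero, Matrix.cons_val_succ]
  congr 3
  funext i
  cases i using Fin.cases with
  | zero => rfl
  | succ i => cases i using Fin.cases <;> rfl

theorem prism_cob_zero (g h : Z → X) (φ : Cochain X G 0) :
    prism g h (cob φ) = pb h φ - pb g φ := by
  funext s
  have := congrFun (cone_cob_zero (g (s 0)) φ) (fun i => h (s i))
  simp only [cone, Pi.sub_apply] at this
  simp only [prism, this, pb, Pi.sub_apply]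
  congr 2
  funext i; rw [show i = 0 from Fin.fin_one_eq_zero i]

/-- The chain homotopy identity. Contracting at `z` turns it, through `cone_prism` and `cone_cob`,
into the same identity for `cone (g z) φ` in one degree less. -/
theorem cob_prism (g h : Z → X) {k : ℕ} (φ : Cochain X G (k + 1)) :
    cob (prism g h φ) + prism g h (cob φ) = pb h φ - pb g φ := by
  induction k with
  | zero =>
    refine cochain_ext_cons fun z => ?_
    have e1 : cone z (pb h φ - pb g φ) = pb h (cone (h z) φ) - pb g (cone (g z) φ) := by
      funext s
      simp only [cone, pb, Pi.sub_apply]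
      congr 2 <;> funext i <;> cases i using Fin.cases <;> rfl
    rw [cone_add, cone_cob_zero, cone_prism, cone_cob, cone_sub, cone_cob_zero, prism_sub,
      prism_cob_zero, e1]
    funext s
    simp only [Pi.add_apply, Pi.sub_apply, prism, pb, cone]
    abel
  | succ k ih =>
    refine cochain_ext_cons fun z => ?_
    have e1 : cone z (pb h φ - pb g φ) = pb h (cone (h z) φ) - pb g (cone (g z) φ) := by
      funext s
      simp only [cone, pb, Pi.sub_apply]
      congr 2 <;> funext i <;> cases i using Fin.cases <;> rfl
    rw [cone_add, cone_cob, cone_prism, cone_prism, cone_cob, cone_sub, cone_cob, prism_sub,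
      map_sub, e1]
    have := ih (cone (g z) φ)
    have h2 : pb h (cone (h z) φ - (cone (g z) φ - cob (cone (h z) (cone (g z) φ)))) =
      pb h (cone (h z) φ) - pb h (cone (g z) φ) + cob (pb h (cone (h z) (cone (g z) φ))) := by
      rw [cob_pb]; funext s; simp only [pb, Pi.sub_apply, Pi.add_apply]; abel
    rw [h2, ← sub_eq_zero]
    rw [← sub_eq_zero] at this
    rw [← this]
    abel

/-- Support control: the prism evaluates `φ` only on tuples of values of `g` and `h` at the given
points. Both smallness and compactness of supports in the homotopy arguments come from this. -/
theorem prism_eq_zero (g h : Z → X) {k : ℕ} (φ : Cochain X G (k + 1)) (s : Fin (k + 1) → Z)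
    (hφ : ∀ t : Fin (k + 2) → X, (∀ i, ∃ j, t i = g (s j) ∨ t i = h (s j)) → φ t = 0) :
    prism g h φ s = 0 := by
  induction k with
  | zero =>
    refine hφ _ fun i => ?_
    cases i using Fin.cases with
    | zero => exact ⟨0, Or.inl rfl⟩
    | succ i => exact ⟨i, Or.inr rfl⟩
  | succ k ih =>
    simp only [prism]
    rw [hφ, ih, sub_zero]
    · intro t ht
      refine hφ _ fun i => ?_
      cases i using Fin.cases with
      | zero => exact ⟨0, Or.inl rfl⟩
      | succ i => obtain ⟨j, hj⟩ := ht i; exact ⟨j.succ, hj⟩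
    · intro i
      cases i using Fin.cases with
      | zero => exact ⟨0, Or.inl rfl⟩
      | succ i => exact ⟨i, Or.inr rfl⟩

/-! ### Cup products -/

/-- The cup product of a cochain of degree `n` and one of degree `k`, in degree `m = k + n`. -/
def cup {n k m : ℕ} (h : k + n = m) (τ : Cochain X ℤ n) (b : Cochain X G k) : Cochain X G m :=
  fun s => τ (fun i => s ⟨i, by omega⟩) • b (fun i => s ⟨n + i, by omega⟩)

theorem cone_cup {n k m : ℕ} (h : k + (n + 1) = m + 1) (x : X) (τ : Cochain X ℤ (n + 1))
    (b : Cochain X G k) :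
    cone x (cup h τ b) = cup (by omega : k + n = m) (cone x τ) b := by
  funext s
  simp only [cone, cup]
  congr 2
  · funext i; cases i using Fin.cases <;> rfl
  · funext i
    have : (⟨n + 1 + (i : ℕ), by omega⟩ : Fin (m + 1 + 1)) = Fin.succ ⟨n + i, by omega⟩ := by
      ext; simp; omega
    rw [this]; rfl

/-- Leibniz rule by induction on the degree of τ. Contraction at the first vertex affects only the
factor τ, and the base case is `cob_cut`. -/
theorem cob_cup {n k m : ℕ} (h : k + n = m) (τ : Cochain X ℤ n) (b : Cochain X G k) :
    cob (cup h τ b) = cup (by omega : k + (n + 1) = m + 1) (cob τ) b +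
      ((-1 : ℤ) ^ n) • cup (by omega : k + 1 + n = m + 1) τ (cob b) := by
  induction n generalizing m with
  | zero =>
    subst h
    have e : cup (Eq.refl (k + 0)) τ b = cut (fun x => τ (fun _ => x)) b := by
      funext s
      simp only [cup, cut]
      congr 2
      · funext i; congr 1; ext; simp
      · funext i; congr 1; ext; simp
    rw [e, cob_cut]
    have h1 : step (fun x => τ (fun _ => x)) b = cup (rfl : k + 1 = k + 0 + 1) (cob τ) b := by
      funext s
      simp only [cup, step]
      congr 1
      · have := congrFun (cone_cob_zero (s 0) τ) (fun _ => s 1)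
        simp only [cone, Pi.sub_apply] at this
        rw [← this]
        refine congrArg (cob τ) ?_
        funext i; fin_cases i <;> rfl
      · congr 1; funext i; congr 1; ext; simp; omega
    have h2 : cut (fun x => τ (fun _ => x)) (cob b) =
        cup (rfl : k + 1 + 0 = k + 0 + 1) τ (cob b) := by
      funext s
      simp only [cup, cut]
      congr 1
      · congr 1; funext i; congr 1; ext; simp
      · refine congrArg (cob b) ?_
        funext i; congr 1; ext; simp
    rw [h1, h2]; simp
  | succ n ih =>
    obtain ⟨m, rfl⟩ : ∃ m', m = m' + 1 := ⟨m - 1, by omega⟩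
    refine cochain_ext_cons fun x => ?_
    rw [cone_cob, cone_cup, ih, cone_add, cone_cup, cone_cob]
    have e2 : cone x (((-1 : ℤ) ^ (n + 1)) •
        cup (by omega : k + 1 + (n + 1) = m + 1 + 1) τ (cob b)) =
        ((-1 : ℤ) ^ (n + 1)) • cup (by omega : k + 1 + n = m + 1) (cone x τ) (cob b) := by
      rw [← cone_cup (by omega : k + 1 + (n + 1) = m + 1 + 1)]; rfl
    rw [e2]
    funext s
    simp only [Pi.sub_apply, Pi.add_apply, Pi.smul_apply, cup, pow_succ, sub_smul]
    simp only [mul_neg, mul_one, neg_smul]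
    abel

theorem cup_step {n k m : ℕ} (h : k + n = m) (χ : X → ℤ) (τ : Cochain X ℤ n)
    (b : Cochain X G k) :
    cup (by omega : k + (n + 1) = m + 1) (step χ τ) b = step χ (cup h τ b) := by
  funext s
  simp only [cup, step, smul_smul, smul_eq_mul]
  congr 2
  funext i; congr 1; ext; simp; omega

end Algebra

/-! ### Germs of cochains along a set, and exactness of germs. -/

section Vanishing

variable {X Y Z G : Type*} [AddCommGroup G] [TopologicalSpace X] [TopologicalSpace Y]
  [TopologicalSpace Z] {k : ℕ}

/-- The cochains that vanish near each point of `K`. -/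
def vanishing (K : Set X) (k : ℕ) : AddSubgroup (Cochain X G k) where
  carrier := {φ | ∀ x ∈ K, VanishesNear φ x}
  zero_mem' := fun _ _ => ⟨Set.univ, Filter.univ_mem, fun _ _ => rfl⟩
  add_mem' := by
    intro φ ψ hφ hψ x hx
    obtain ⟨V, hV, h⟩ := hφ x hx
    obtain ⟨W, hW, h'⟩ := hψ x hx
    refine ⟨V ∩ W, Filter.inter_mem hV hW, fun s hs => ?_⟩
    simp [h s fun i => (hs i).1, h' s fun i => (hs i).2]
  neg_mem' := by
    intro φ hφ x hx
    obtain ⟨V, hV, h⟩ := hφ x hx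
    exact ⟨V, hV, fun s hs => by simp [h s hs]⟩

theorem mem_vanishing {K : Set X} {φ : Cochain X G k} :
    φ ∈ vanishing K k ↔ ∀ x ∈ K, VanishesNear φ x := Iff.rfl

theorem vanishesNear_iff_mem {φ : Cochain X G k} {x : X} :
    VanishesNear φ x ↔ φ ∈ vanishing {x} k := by
  simp [mem_vanishing]

theorem VanishesNear.zero (x : X) : VanishesNear (0 : Cochain X G k) x :=
  ⟨Set.univ, Filter.univ_mem, fun _ _ => rfl⟩

theorem VanishesNear.add {φ ψ : Cochain X G k} {x : X} (h : VanishesNear φ x)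
    (h' : VanishesNear ψ x) : VanishesNear (φ + ψ) x := by
  rw [vanishesNear_iff_mem] at *; exact add_mem h h'

theorem VanishesNear.sub {φ ψ : Cochain X G k} {x : X} (h : VanishesNear φ x)
    (h' : VanishesNear ψ x) : VanishesNear (φ - ψ) x := by
  rw [vanishesNear_iff_mem] at *; exact sub_mem h h'

theorem VanishesNear.neg {φ : Cochain X G k} {x : X} (h : VanishesNear φ x) :
    VanishesNear (-φ) x := by
  rw [vanishesNear_iff_mem] at *; exact neg_mem h

theorem VanishesNear.zsmul {φ : Cochain X G k} {x : X} (h : VanishesNear φ x) (m : ℤ) :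
    VanishesNear (m • φ) x := by
  rw [vanishesNear_iff_mem] at *; exact zsmul_mem h m

theorem VanishesNear.congr {φ ψ : Cochain X G k} {x : X} (h : VanishesNear φ x) {V : Set X}
    (hV : V ∈ 𝓝 x) (e : ∀ s : Fin (k + 1) → X, (∀ i, s i ∈ V) → ψ s = φ s) :
    VanishesNear ψ x := by
  obtain ⟨W, hW, hz⟩ := h
  exact ⟨V ∩ W, Filter.inter_mem hV hW, fun s hs =>
    (e s fun i => (hs i).1).trans (hz s fun i => (hs i).2)⟩

theorem VanishesNear.eventually {φ : Cochain X G k} {x : X} (h : VanishesNear φ x) :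
    ∀ᶠ z in 𝓝 x, VanishesNear φ z := by
  obtain ⟨V, hV, hz⟩ := h
  filter_upwards [eventually_mem_nhds_iff.2 hV] with z hz'
  exact ⟨V, hz', hz⟩

theorem VanishesNear.cob {φ : Cochain X G k} {x : X} (h : VanishesNear φ x) :
    VanishesNear (cob φ) x := by
  obtain ⟨V, hV, hz⟩ := h
  refine ⟨V, hV, fun s hs => ?_⟩
  rw [cob_apply]
  exact Finset.sum_eq_zero fun i _ => by rw [hz _ fun j => hs _, smul_zero]

theorem VanishesNear.pb {f : X → Y} {φ : Cochain Y G k} {x : X} (h : VanishesNear φ (f x))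
    (hf : ContinuousAt f x) : VanishesNear (pb f φ) x := by
  obtain ⟨V, hV, hz⟩ := h
  exact ⟨f ⁻¹' V, hf hV, fun s hs => hz _ hs⟩

theorem VanishesNear.cut {φ : Cochain X G k} {x : X} (h : VanishesNear φ x) (χ : X → ℤ) :
    VanishesNear (cut χ φ) x := by
  obtain ⟨V, hV, hz⟩ := h
  exact ⟨V, hV, fun s hs => by simp [AlexanderSpanier.cut, hz s hs]⟩

theorem VanishesNear.step {φ : Cochain X G k} {x : X} (h : VanishesNear φ x) (χ : X → ℤ) :
    VanishesNear (step χ φ) x := by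
  obtain ⟨V, hV, hz⟩ := h
  exact ⟨V, hV, fun s hs => by simp [AlexanderSpanier.step, hz _ fun i => hs _]⟩

theorem vanishesNear_step {χ : X → ℤ} {x : X} (h : ∀ᶠ z in 𝓝 x, χ z = χ x)
    (φ : Cochain X G k) : VanishesNear (step χ φ) x :=
  ⟨_, h, fun s hs => by
    have hs : ∀ i, χ (s i) = χ x := hs
    simp [AlexanderSpanier.step, hs]⟩

theorem vanishesNear_cut {χ : X → ℤ} {x : X} (h : ∀ᶠ z in 𝓝 x, χ z = 0)
    (φ : Cochain X G k) : VanishesNear (cut χ φ) x :=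
  ⟨_, h, fun s hs => by
    have hs : ∀ i, χ (s i) = 0 := hs
    simp [AlexanderSpanier.cut, hs]⟩

theorem vanishesNear_cut_sub {χ : X → ℤ} {x : X} (h : ∀ᶠ z in 𝓝 x, χ z = 1)
    (φ : Cochain X G k) : VanishesNear (cut χ φ - φ) x :=
  ⟨_, h, fun s hs => by
    have hs : ∀ i, χ (s i) = 1 := hs
    simp [AlexanderSpanier.cut, hs]⟩

theorem VanishesNear.cup_left {n m : ℕ} (h : k + n = m) {τ : Cochain X ℤ n} {x : X}
    (hτ : VanishesNear τ x) (b : Cochain X G k) : VanishesNear (cup h τ b) x := by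
  obtain ⟨V, hV, hz⟩ := hτ
  exact ⟨V, hV, fun s hs => by simp [cup, hz _ fun i => hs _]⟩

theorem VanishesNear.cup_right {n m : ℕ} (h : k + n = m) (τ : Cochain X ℤ n) {x : X}
    {b : Cochain X G k} (hb : VanishesNear b x) : VanishesNear (cup h τ b) x := by
  obtain ⟨V, hV, hz⟩ := hb
  exact ⟨V, hV, fun s hs => by simp [cup, hz _ fun i => hs _]⟩

theorem vanishesNear_prism {g h : Z → X} {φ : Cochain X G (k + 1)} {z : Z} {U : Set Z}
    (hU : U ∈ 𝓝 z) {V : Set X} (hV : ∀ s : Fin (k + 2) → X, (∀ i, s i ∈ V) → φ s = 0)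
    (hg : ∀ u ∈ U, g u ∈ V) (hh : ∀ u ∈ U, h u ∈ V) : VanishesNear (prism g h φ) z := by
  refine ⟨U, hU, fun s hs => prism_eq_zero _ _ _ _ fun t ht => hV t fun i => ?_⟩
  obtain ⟨j, hj | hj⟩ := ht i <;> rw [hj]
  exacts [hg _ (hs j), hh _ (hs j)]

/-- The cochains that are coboundaries of elements of `P` near each point of `K`. -/
def exactOn (P : ∀ j, AddSubgroup (Cochain X G j)) (K : Set X) :
    ∀ k, AddSubgroup (Cochain X G k)
  | 0 => vanishing K 0
  | k + 1 => (P k).map cob ⊔ vanishing K (k + 1)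

variable {P : ∀ j, AddSubgroup (Cochain X G j)} {K : Set X}

theorem mem_exactOn_zero {φ : Cochain X G 0} :
    φ ∈ exactOn P K 0 ↔ ∀ x ∈ K, VanishesNear φ x := Iff.rfl

theorem mem_exactOn_succ {φ : Cochain X G (k + 1)} :
    φ ∈ exactOn P K (k + 1) ↔ ∃ ψ ∈ P k, ∀ x ∈ K, VanishesNear (φ - cob ψ) x := by
  constructor
  · intro h
    obtain ⟨_, ⟨ψ, hψ, rfl⟩, v, hv, rfl⟩ := AddSubgroup.mem_sup.1 h
    exact ⟨ψ, hψ, fun x hx => by simpa using hv x hx⟩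
  · rintro ⟨ψ, hψ, h⟩
    exact AddSubgroup.mem_sup.2 ⟨_, ⟨ψ, hψ, rfl⟩, φ - cob ψ, h, by abel⟩

theorem mem_exactOn_of_vanishing {φ : Cochain X G k} (h : ∀ x ∈ K, VanishesNear φ x) :
    φ ∈ exactOn P K k := by
  cases k with
  | zero => exact h
  | succ k => exact AddSubgroup.mem_sup_right h

theorem exactOn_mono {P' : ∀ j, AddSubgroup (Cochain X G j)} {K' : Set X} (hP : ∀ j, P j ≤ P' j)
    (hK : K' ⊆ K) {φ : Cochain X G k} (h : φ ∈ exactOn P K k) : φ ∈ exactOn P' K' k := by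
  cases k with
  | zero => exact fun x hx => h x (hK hx)
  | succ k =>
    rw [mem_exactOn_succ] at *
    obtain ⟨ψ, hψ, h⟩ := h
    exact ⟨ψ, hP _ hψ, fun x hx => h x (hK hx)⟩

theorem mem_exactOn_congr {φ φ' : Cochain X G k} (h : φ ∈ exactOn P K k)
    (hv : ∀ x ∈ K, VanishesNear (φ' - φ) x) : φ' ∈ exactOn P K k := by
  have := add_mem h (mem_exactOn_of_vanishing (P := P) hv)
  simpa using this

theorem exactOn_pb {f : X → Y} {Q : ∀ j, AddSubgroup (Cochain Y G j)} {L : Set Y}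
    (hP : ∀ j, ∀ ψ ∈ Q j, pb f ψ ∈ P j) (hK : ∀ x ∈ K, f x ∈ L)
    (hf : ∀ x ∈ K, ContinuousAt f x) {φ : Cochain Y G k} (h : φ ∈ exactOn Q L k) :
    pb f φ ∈ exactOn P K k := by
  cases k with
  | zero => exact fun x hx => (h _ (hK x hx)).pb (hf x hx)
  | succ k =>
    rw [mem_exactOn_succ] at *
    obtain ⟨ψ, hψ, h⟩ := h
    exact ⟨pb f ψ, hP _ _ hψ, fun x hx => (h _ (hK x hx)).pb (hf x hx)⟩

end Vanishing

/-! ### Homotopy invariance near compact sets and with compact supports. -/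

section Homotopy

variable {X Z G : Type*} [AddCommGroup G] [TopologicalSpace X] [TopologicalSpace Z] {k : ℕ}

theorem pb_sub_pb_mem_exactOn {P : ∀ j, AddSubgroup (Cochain Z G j)} {K : Set Z} {g h : Z → X}
    {φ : Cochain X G k} (hφ : ∀ z ∈ K, VanishesNear (prism g h (cob φ)) z)
    -- The prism exists only on positive degrees. In degree zero there is no primitive to control,
    -- and the condition is empty.
    (hP : ∀ j (e : k = j + 1), prism g h (e ▸ φ) ∈ P j) :
    pb h φ - pb g φ ∈ exactOn P K k := by
  cases k with
  | zero => rw [← prism_cob_zero]; exact hφ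
  | succ k =>
    rw [mem_exactOn_succ]
    refine ⟨_, hP k rfl, fun z hz => ?_⟩
    rw [← cob_prism]
    simpa using hφ z hz

/-- A cocycle condition holds only near the diagonal, so the prism of `cob φ` vanishes only for maps
that are close to each other. The hypotheses compare nearby times, and connectedness of `ℝ` joins
arbitrary times. -/
theorem homotopy_mem_exactOn {P : ∀ j, AddSubgroup (Cochain Z G j)} {K : Set Z} {h : ℝ → Z → X}
    {φ : Cochain X G k}
    (hφ : ∀ t, ∀ᶠ t' in 𝓝 t, ∀ z ∈ K, VanishesNear (prism (h t) (h t') (cob φ)) z)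
    (hP : ∀ t, ∀ᶠ t' in 𝓝 t, ∀ j (e : k = j + 1), prism (h t) (h t') (e ▸ φ) ∈ P j) (s t : ℝ) :
    pb (h s) φ - pb (h t) φ ∈ exactOn P K k := by
  refine PreconnectedSpace.induction₂' (fun a b => pb (h a) φ - pb (h b) φ ∈ exactOn P K k)
    (fun a => ?_) ⟨fun a b c hab hbc => by simpa using add_mem hab hbc⟩ s t
  filter_upwards [hφ a, hP a] with b hb hb'
  have := pb_sub_pb_mem_exactOn hb hb'
  refine ⟨?_, this⟩
  simpa using neg_mem this

/-- A tube-lemma argument: near `(t, z)` both `h t` and `h t'` send a neighbourhood of `z` into a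
set where `φ` vanishes, and compactness of `K` makes the range of `t'` uniform. -/
theorem eventually_vanishesNear_prism {K : Set Z} (hK : IsCompact K) {h : ℝ → Z → X}
    (hh : Continuous fun p : ℝ × Z => h p.1 p.2) {φ : Cochain X G (k + 1)} {t : ℝ}
    (hφ : ∀ z ∈ K, VanishesNear φ (h t z)) :
    ∀ᶠ t' in 𝓝 t, ∀ z ∈ K, VanishesNear (prism (h t) (h t') φ) z := by
  refine hK.eventually_forall_of_forall_eventually fun z hz => ?_
  obtain ⟨V, hV, hv⟩ := hφ z hz
  have := hh.continuousAt.preimage_mem_nhds (x := (t, z)) hV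
  rw [nhds_prod_eq, Filter.mem_prod_iff] at this
  obtain ⟨J, hJ, U, hU, hJU⟩ := this
  rw [nhds_prod_eq]
  filter_upwards [Filter.prod_mem_prod hJ (eventually_mem_nhds_iff.2 hU)] with p hp
  exact vanishesNear_prism hp.2 hv
    (fun u hu => hJU (Set.mk_mem_prod (mem_of_mem_nhds hJ) hu))
    (fun u hu => hJU (Set.mk_mem_prod hp.1 hu))

/-- Homotopy invariance near a compact set. -/
theorem homotopy_exactOn_compact {K : Set Z} (hK : IsCompact K) {h : ℝ → Z → X}
    (hh : Continuous fun p : ℝ × Z => h p.1 p.2) {φ : Cochain X G k}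
    (hφ : ∀ t, ∀ z ∈ K, VanishesNear (cob φ) (h t z)) (s t : ℝ) :
    pb (h s) φ - pb (h t) φ ∈ exactOn (fun _ => ⊤) K k :=
  homotopy_mem_exactOn (fun t => eventually_vanishesNear_prism hK hh (hφ t))
    (fun _ => Filter.Eventually.of_forall fun _ _ _ => AddSubgroup.mem_top _) s t

/-- The cochains that vanish on all tuples of points outside some compact set. -/
def compactSupp (X G : Type*) [AddCommGroup G] [TopologicalSpace X] (k : ℕ) :
    AddSubgroup (Cochain X G k) :=
  (compactlySupported ℤ X G k).toAddSubgroup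

theorem cob_eq_zero_of_notMem {φ : Cochain X G k} {C : Set X}
    (hC : ∀ s : Fin (k + 1) → X, (∀ i, s i ∉ C) → φ s = 0) (s : Fin (k + 2) → X)
    (hs : ∀ i, s i ∉ C) : cob φ s = 0 := by
  rw [cob_apply]
  exact Finset.sum_eq_zero fun i _ => by rw [hC _ fun j => hs _, smul_zero]

/-- Homotopy invariance with compact supports. -/
theorem homotopy_exactOn_compactSupp [T2Space Z] {h : ℝ → Z → X}
    (hh : Continuous fun p : ℝ × Z => h p.1 p.2) {φ : Cochain X G k}
    (hφ : ∀ x, VanishesNear (cob φ) x) {C : Set X}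
    (hC : ∀ s : Fin (k + 1) → X, (∀ i, s i ∉ C) → φ s = 0)
    (hK : ∀ t, ∃ K : Set Z, IsCompact K ∧ ∀ᶠ t' in 𝓝 t, ∀ z, h t' z ∈ C → z ∈ K) (s t : ℝ) :
    pb (h s) φ - pb (h t) φ ∈ exactOn (compactSupp Z G) Set.univ k := by
  refine homotopy_mem_exactOn (fun t => ?_) (fun t => ?_) s t
  · obtain ⟨K, hKc, hK⟩ := hK t
    filter_upwards [hK, eventually_vanishesNear_prism hKc hh fun z _ => hφ _] with t' ht' ht''
    intro z _
    by_cases hz : z ∈ K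
    -- Outside `K` both maps avoid `C`, so the prism sees only tuples on which `cob φ` is zero.
    · exact ht'' z hz
    · exact vanishesNear_prism (hKc.isClosed.isOpen_compl.mem_nhds hz)
        (V := Cᶜ) (cob_eq_zero_of_notMem hC) (fun u hu hu' => hu (hK.self_of_nhds u hu'))
        (fun u hu hu' => hu (ht' u hu'))
  · obtain ⟨K, hKc, hK⟩ := hK t
    filter_upwards [hK] with t' ht' j e
    subst e
    refine ⟨K, hKc, fun s hs => prism_eq_zero _ _ _ _ fun r hr => hC _ fun i => ?_⟩
    obtain ⟨l, hl | hl⟩ := hr i <;> rw [hl]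
    exacts [fun h' => hs l (hK.self_of_nhds _ h'), fun h' => hs l (ht' _ h')]

end Homotopy

/-! ### Acyclicity of star-shaped sets. -/

section Acyclic

variable {X G : Type*} [AddCommGroup G] [TopologicalSpace X]

/-- Every cocycle near `K` is near `K` equal to an exact cocycle of the complex of all functions,
so the cohomology of germs near `K` is that of a point. -/
def Acyclic (G : Type*) [AddCommGroup G] (K : Set X) : Prop :=
  ∀ (k : ℕ) (φ : Cochain X G k), (∀ x ∈ K, VanishesNear (cob φ) x) →
    ∃ t : Cochain X G k, cob t = 0 ∧ ∀ x ∈ K, VanishesNear (φ - t) x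

theorem eq_cob_cone {k : ℕ} {t : Cochain X G (k + 1)} (h : cob t = 0) (x : X) :
    t = cob (cone x t) := by
  have := cone_cob x t
  rw [h] at this
  exact (sub_eq_zero.1 this.symm)

theorem eq_const_of_cob_eq_zero {t : Cochain X G 0} (h : cob t = 0) (x : X) :
    t = fun _ => t fun _ => x := by
  have := cone_cob_zero x t
  rw [h] at this
  exact (sub_eq_zero.1 this.symm)

/-- Passage to the limit over an exhaustion. There is no `lim¹` obstruction, because acyclicity
replaces a cocycle near `K i` by a cocycle on the whole space; successive primitives can therefore
be corrected to agree near the smaller set. -/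
theorem Acyclic.iUnion {K : ℕ → Set X} (hc : ∀ i, IsClosed (K i))
    (hK : ∀ i, K i ⊆ interior (K (i + 1))) (ha : ∀ i, Acyclic G (K i))
    (hne : ∃ i x, x ∈ K i) : Acyclic G (⋃ i, K i) := by
  have hmono : Monotone K := monotone_nat_of_le_succ fun i => (hK i).trans interior_subset
  obtain ⟨i₀, x₀, hx₀⟩ := hne
  intro k φ hφ
  have hφi : ∀ i, ∀ x ∈ K i, VanishesNear (cob φ) x :=
    fun i x hx => hφ x (Set.mem_iUnion_of_mem i hx)
  cases k with
  | zero =>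
    choose t ht htv using fun i => ha i 0 φ (hφi i)
    refine ⟨t i₀, ht i₀, fun x hx => ?_⟩
    obtain ⟨i, hi⟩ := Set.mem_iUnion.1 hx
    have h1 := htv (max i i₀) x (hmono (le_max_left _ _) hi)
    have h2 := (htv (max i i₀) x₀ (hmono (le_max_right _ _) hx₀)).sub (htv i₀ x₀ hx₀)
    obtain ⟨V, hV, hz⟩ := h2
    have h3 := hz (fun _ => x₀) fun _ => mem_of_mem_nhds hV
    have h4 : t (max i i₀) = t i₀ := by
      rw [eq_const_of_cob_eq_zero (ht (max i i₀)) x₀, eq_const_of_cob_eq_zero (ht i₀) x₀]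
      funext _
      simp only [Pi.sub_apply, sub_sub_sub_cancel_left] at h3
      exact (sub_eq_zero.1 h3).symm
    rwa [h4] at h1
  | succ k =>
    have hex : ∀ i, ∃ ψ : Cochain X G k, ∀ x ∈ K i, VanishesNear (φ - cob ψ) x := by
      intro i
      obtain ⟨t, ht, hv⟩ := ha i _ φ (hφi i)
      exact ⟨cone x₀ t, by rwa [← eq_cob_cone ht]⟩
    -- Two primitives differ by a cocycle near `K i`. Subtracting its global replacement `t` from
    -- the new one keeps it a primitive near `K (i + 1)`.
    have hstep : ∀ i (ψ : {ψ : Cochain X G k // ∀ x ∈ K i, VanishesNear (φ - cob ψ) x}),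
        ∃ ψ' : {ψ : Cochain X G k // ∀ x ∈ K (i + 1), VanishesNear (φ - cob ψ) x},
          ∀ x ∈ K i, VanishesNear (ψ'.1 - ψ.1) x := by
      rintro i ⟨ψ, hψ⟩
      obtain ⟨ψ', hψ'⟩ := hex (i + 1)
      obtain ⟨t, ht, hv⟩ := ha i _ (ψ' - ψ) fun x hx => by
        have := (hψ x hx).sub (hψ' x (hmono (Nat.le_succ i) hx))
        rw [map_sub]
        simpa using this
      refine ⟨⟨ψ' - t, fun x hx => ?_⟩, fun x hx => ?_⟩
      · rw [map_sub, ht, sub_zero]; exact hψ' x hx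
      · have := hv x hx
        rwa [sub_right_comm] at this
    choose nxt hnxt using hstep
    let ψ : ∀ i, {ψ : Cochain X G k // ∀ x ∈ K i, VanishesNear (φ - cob ψ) x} := fun i =>
      Nat.rec ⟨_, (hex 0).choose_spec⟩ (fun i ψ => nxt i ψ) i
    have hψ : ∀ i, ∀ x ∈ K i, VanishesNear ((ψ (i + 1)).1 - (ψ i).1) x := fun i => hnxt i (ψ i)
    have hψ' : ∀ l i, l ≤ i → ∀ x ∈ K l, VanishesNear ((ψ l).1 - (ψ i).1) x := by
      intro l i hli x hx
      induction i, hli using Nat.le_induction with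
      | base => rw [sub_self]; exact VanishesNear.zero x
      | succ i hi ih => simpa using ih.sub (hψ i x (hmono hi hx))
    classical
    let ν : X → ℕ := fun x => if h : ∃ i, x ∈ K i then Nat.find h else 0
    have hν : ∀ i x, x ∈ K i → x ∈ K (ν x) ∧ ν x ≤ i := by
      intro i x hx
      have h : ∃ i, x ∈ K i := ⟨i, hx⟩
      simp only [ν, dif_pos h]
      exact ⟨Nat.find_spec h, Nat.find_min' h hx⟩
    -- The primitives are glued discontinuously, using the first stage of the exhaustion containing
    -- the first vertex.
    let Ψ : Cochain X G k := fun s => (ψ (ν (s 0))).1 s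
    refine ⟨cob Ψ, cob_cob Ψ, fun x hx => ?_⟩
    obtain ⟨i, hi⟩ := Set.mem_iUnion.1 hx
    have hi' := hK i hi
    suffices h : VanishesNear (Ψ - (ψ (i + 1)).1) x by
      have := ((ψ (i + 1)).2 x (interior_subset hi')).sub h.cob
      rw [map_sub] at this
      simpa using this
    -- Near `x` only stages up to `i + 1` can occur. A stage whose closed set misses `x` is avoided
    -- by shrinking the neighbourhood; every other stage agrees with stage `i + 1` near `x`.
    have hW : ∀ l ∈ Finset.range (i + 2), ∃ W ∈ 𝓝 x, ∀ s : Fin (k + 1) → X, (∀ j, s j ∈ W) →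
        s 0 ∈ K l → ((ψ l).1 - (ψ (i + 1)).1) s = 0 := by
      intro l hl
      by_cases hxl : x ∈ K l
      · obtain ⟨W, hW, h⟩ := hψ' l (i + 1) (by have := Finset.mem_range.1 hl; omega) x hxl
        exact ⟨W, hW, fun s hs _ => h s hs⟩
      · exact ⟨(K l)ᶜ, (hc l).isOpen_compl.mem_nhds hxl, fun s hs h => absurd h (hs 0)⟩
    choose! W hW hWz using hW
    refine ⟨interior (K (i + 1)) ∩ ⋂ l ∈ Finset.range (i + 2), W l,
      Filter.inter_mem (isOpen_interior.mem_nhds hi') ((Filter.biInter_finset_mem _).2 hW), ?_⟩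
    intro s hs
    obtain ⟨h1, h2⟩ := hν (i + 1) (s 0) (interior_subset (hs 0).1)
    have h3 : ν (s 0) ∈ Finset.range (i + 2) := Finset.mem_range.2 (by omega)
    exact hWz _ h3 s (fun j => Set.mem_iInter₂.1 (hs j).2 _ h3) h1

variable {E : Type*} [NormedAddCommGroup E] [NormedSpace ℝ E]

/-- Contraction to the centre stays in `K`, so homotopy invariance compares `φ` with its pullback
along a constant map, which is a genuine cocycle. -/
theorem StarConvex.acyclic {K : Set E} (hK : IsCompact K) {c : E} (hs : StarConvex ℝ c K) :
    Acyclic G K := by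
  intro k φ hφ
  rcases K.eq_empty_or_nonempty with rfl | ⟨z₀, hz₀⟩
  · exact ⟨0, map_zero _, by simp⟩
  have hmem : ∀ z ∈ K, ∀ t ∈ Set.Icc (0 : ℝ) 1, c + t • (z - c) ∈ K := by
    intro z hz t ht
    have := hs hz (a := 1 - t) (b := t) (by linarith [ht.2]) ht.1 (by ring)
    convert this using 1
    rw [sub_smul, one_smul, smul_sub]; abel
  have hc : c ∈ K := by simpa using hmem z₀ hz₀ 0 (by simp)
  -- Clamping time to the unit interval defines the contraction for all real times.
  let h : ℝ → E → E := fun t z => c + (Set.projIcc (0 : ℝ) 1 zero_le_one t : ℝ) • (z - c)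
  have hh : Continuous fun p : ℝ × E => h p.1 p.2 := by
    have : Continuous (Set.projIcc (0 : ℝ) 1 zero_le_one) := continuous_projIcc
    fun_prop
  have key := homotopy_exactOn_compact hK hh (φ := φ)
    (fun t z hz => hφ _ (hmem z hz _ (Set.projIcc (0 : ℝ) 1 zero_le_one t).2)) 1 0
  have h1 : pb (h 1) φ = φ := by
    have : h 1 = id := by funext z; simp [h]
    rw [this]; rfl
  have h0 : h 0 = fun _ => c := by funext z; simp [h]
  have hcob : cob (pb (h 0) φ) = 0 := by
    rw [cob_pb, h0]
    funext s
    obtain ⟨V, hV, hz⟩ := hφ c hc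
    exact hz _ fun _ => mem_of_mem_nhds hV
  rw [h1] at key
  cases k with
  | zero => exact ⟨_, hcob, key⟩
  | succ k =>
    obtain ⟨ψ, -, hψ⟩ := mem_exactOn_succ.1 key
    refine ⟨pb (h 0) φ + cob ψ, by rw [map_add, hcob, cob_cob, add_zero], fun x hx => ?_⟩
    rw [← sub_sub]; exact hψ x hx

/-- Exhaustion by compact star-shaped sets reduces this to the compact case. -/
theorem StarConvex.acyclic_of_isOpen [ProperSpace E] {Z : Set E} (hZ : IsOpen Z) {c : E}
    (hc : c ∈ Z) (hs : StarConvex ℝ c Z) : Acyclic G Z := by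
  -- The distance to the complement is required along the whole segment from `c` to `z`, not merely
  -- at `z`; this makes each stage star-shaped.
  let K : ℕ → Set E := fun i => {z | ‖z - c‖ ≤ i + 1 ∧ ∀ w ∉ Z, ∀ t ∈ Set.Icc (0 : ℝ) 1,
    1 / ((i : ℝ) + 1) ≤ dist (c + t • (z - c)) w}
  have hclosed : ∀ i, IsClosed (K i) := by
    intro i
    have : K i = {z | ‖z - c‖ ≤ i + 1} ∩ ⋂ w ∈ Zᶜ, ⋂ t ∈ Set.Icc (0 : ℝ) 1,
        {z | 1 / ((i : ℝ) + 1) ≤ dist (c + t • (z - c)) w} := by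
      ext z
      simp only [K, Set.mem_inter_iff, Set.mem_iInter, Set.mem_compl_iff]
      rfl
    rw [this]
    refine (isClosed_le (by fun_prop) (by fun_prop)).inter (isClosed_biInter fun w _ =>
      isClosed_biInter fun t _ => isClosed_le (by fun_prop) (by fun_prop))
  have hcompact : ∀ i, IsCompact (K i) := by
    intro i
    refine (isCompact_closedBall c ((i : ℝ) + 1)).of_isClosed_subset (hclosed i) fun z hz => ?_
    rw [mem_closedBall_iff_norm]; exact hz.1
  have hstar : ∀ i, StarConvex ℝ c (K i) := by
    intro i z hz a b ha hb hab
    have e : a • c + b • z = c + b • (z - c) := by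
      rw [show a = 1 - b by linarith, sub_smul, one_smul, smul_sub]; abel
    rw [e]
    have hb1 : b ≤ 1 := by linarith
    refine ⟨?_, fun w hw t ht => ?_⟩
    · rw [add_sub_cancel_left, norm_smul, Real.norm_of_nonneg hb]
      exact (mul_le_of_le_one_left (norm_nonneg _) hb1).trans hz.1
    · rw [add_sub_cancel_left, smul_smul]
      exact hz.2 w hw _ ⟨mul_nonneg ht.1 hb, mul_le_one₀ ht.2 hb hb1⟩
  have hint : ∀ i, K i ⊆ interior (K (i + 1)) := by
    intro i z hz
    have hi : (0 : ℝ) < i + 1 := by positivity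
    have hδ : 0 < 1 / ((i : ℝ) + 1) - 1 / ((i : ℝ) + 1 + 1) := by
      rw [sub_pos]
      exact one_div_lt_one_div_of_lt hi (by linarith)
    have hδ1 : 1 / ((i : ℝ) + 1) - 1 / ((i : ℝ) + 1 + 1) ≤ 1 := by
      have h1 : 1 / ((i : ℝ) + 1) ≤ 1 := by
        rw [div_le_one hi]; linarith [(Nat.cast_nonneg i : (0 : ℝ) ≤ i)]
      have h2 : 0 ≤ 1 / ((i : ℝ) + 1 + 1) := by positivity
      linarith
    rw [mem_interior_iff_mem_nhds]
    filter_upwards [Metric.ball_mem_nhds z hδ] with z' hz'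
    rw [Metric.mem_ball, dist_eq_norm] at hz'
    refine ⟨?_, fun w hw t ht => ?_⟩
    · have : ‖z' - c‖ ≤ ‖z' - z‖ + ‖z - c‖ := by
        simpa using norm_add_le (z' - z) (z - c)
      push_cast
      linarith [hz.1]
    · have h1 := hz.2 w hw t ht
      have h2 : dist (c + t • (z - c)) w ≤ dist (c + t • (z - c)) (c + t • (z' - c)) +
        dist (c + t • (z' - c)) w := dist_triangle _ _ _
      have h3 : dist (c + t • (z - c)) (c + t • (z' - c)) ≤ ‖z' - z‖ := by
        rw [dist_add_left, dist_eq_norm, ← smul_sub, norm_smul, Real.norm_of_nonneg ht.1,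
          sub_sub_sub_cancel_right, norm_sub_rev]
        exact mul_le_of_le_one_left (norm_nonneg _) ht.2
      push_cast
      linarith
  have hunion : ⋃ i, K i = Z := by
    ext z
    rw [Set.mem_iUnion]
    constructor
    · rintro ⟨i, hi⟩
      by_contra hz
      have := hi.2 z hz 1 (by simp)
      simp only [one_smul, add_sub_cancel, dist_self] at this
      have : (0 : ℝ) < 1 / ((i : ℝ) + 1) := by positivity
      linarith
    · intro hz
      have hcpt : IsCompact ((fun t : ℝ => c + t • (z - c)) '' Set.Icc (0 : ℝ) 1) :=
        isCompact_Icc.image (by fun_prop)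
      have hsub : (fun t : ℝ => c + t • (z - c)) '' Set.Icc (0 : ℝ) 1 ⊆ Z := by
        rintro _ ⟨t, ht, rfl⟩
        have := hs hz (a := 1 - t) (b := t) (by linarith [ht.2]) ht.1 (by ring)
        convert this using 1
        simp only [sub_smul, one_smul, smul_sub]; abel
      obtain ⟨δ, hδ, hδZ⟩ := hcpt.exists_thickening_subset_open hZ hsub
      obtain ⟨i, hi⟩ := exists_nat_one_div_lt hδ
      obtain ⟨l, hl⟩ := exists_nat_ge ‖z - c‖
      refine ⟨max i l, ?_, fun w hw t ht => ?_⟩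
      · have : (l : ℝ) ≤ (max i l : ℕ) := by exact_mod_cast le_max_right _ _
        linarith
      · by_contra hlt
        refine hw (hδZ (Metric.mem_thickening_iff.2 ⟨_, ⟨t, ht, rfl⟩, ?_⟩))
        rw [dist_comm]
        have : 1 / (((max i l : ℕ) : ℝ) + 1) ≤ 1 / ((i : ℝ) + 1) := by
          apply one_div_le_one_div_of_le (by positivity)
          have : (i : ℝ) ≤ (max i l : ℕ) := by exact_mod_cast le_max_left _ _
          linarith
        push Not at hlt
        linarith
  rw [← hunion]
  refine Acyclic.iUnion hclosed hint (fun i => StarConvex.acyclic (hcompact i) (hstar i)) ?_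
  rw [← hunion, Set.mem_iUnion] at hc
  obtain ⟨i, hi⟩ := hc
  exact ⟨i, c, hi⟩

end Acyclic

/-! ### Germs of local cohomology with supports. -/

section Local

variable {X Y G : Type*} [AddCommGroup G] [TopologicalSpace X] [TopologicalSpace Y] {k : ℕ}

/-- The cochains whose support is contained in `Γ` near `p`. -/
def suppAt (Γ : Set X) (p : X) (k : ℕ) : AddSubgroup (Cochain X G k) where
  carrier := {φ | ∀ᶠ z in 𝓝 p, z ∉ Γ → VanishesNear φ z}
  zero_mem' := Filter.Eventually.of_forall fun z _ => VanishesNear.zero z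
  add_mem' := fun hφ hψ => by
    filter_upwards [hφ, hψ] with z h h' hz using (h hz).add (h' hz)
  neg_mem' := fun hφ => by
    filter_upwards [hφ] with z h hz using (h hz).neg

theorem mem_suppAt {Γ : Set X} {p : X} {φ : Cochain X G k} :
    φ ∈ suppAt Γ p k ↔ ∀ᶠ z in 𝓝 p, z ∉ Γ → VanishesNear φ z := Iff.rfl

/-- The germs at `p` that are zero in the local cohomology with supports in `Γ`. -/
def nullAt (Γ : Set X) (p : X) (k : ℕ) : AddSubgroup (Cochain X G k) :=
  exactOn (suppAt Γ p) {p} k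

theorem mem_nullAt_zero {Γ : Set X} {p : X} {φ : Cochain X G 0} :
    φ ∈ nullAt Γ p 0 ↔ VanishesNear φ p := by
  simp [nullAt, mem_exactOn_zero]

theorem mem_nullAt_succ {Γ : Set X} {p : X} {φ : Cochain X G (k + 1)} :
    φ ∈ nullAt Γ p (k + 1) ↔ ∃ ψ ∈ suppAt Γ p k, VanishesNear (φ - cob ψ) p := by
  simp [nullAt, mem_exactOn_succ]

theorem mem_nullAt_of_vanishesNear {Γ : Set X} {p : X} {φ : Cochain X G k}
    (h : VanishesNear φ p) : φ ∈ nullAt Γ p k :=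
  mem_exactOn_of_vanishing (by simpa using h)

theorem mem_nullAt_congr {Γ : Set X} {p : X} {φ φ' : Cochain X G k} (h : φ ∈ nullAt Γ p k)
    (hv : VanishesNear (φ' - φ) p) : φ' ∈ nullAt Γ p k :=
  mem_exactOn_congr h (by simpa using hv)

theorem suppAt_mono {Γ Γ' : Set X} {p : X} (h : ∀ᶠ z in 𝓝 p, z ∈ Γ → z ∈ Γ')
    {φ : Cochain X G k} (hφ : φ ∈ suppAt Γ p k) : φ ∈ suppAt Γ' p k := by
  filter_upwards [h, mem_suppAt.1 hφ] with z h1 h2 h3 using h2 fun h4 => h3 (h1 h4)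

theorem nullAt_mono {Γ Γ' : Set X} {p : X} (h : ∀ᶠ z in 𝓝 p, z ∈ Γ → z ∈ Γ')
    {φ : Cochain X G k} (hφ : φ ∈ nullAt Γ p k) : φ ∈ nullAt Γ' p k :=
  exactOn_mono (fun _ _ => suppAt_mono h) subset_rfl hφ

theorem suppAt_pb {f : X → Y} {Γ : Set X} {Γ' : Set Y} {p : X}
    (hf : ∀ᶠ z in 𝓝 p, ContinuousAt f z) (hΓ : ∀ᶠ z in 𝓝 p, f z ∈ Γ' → z ∈ Γ)
    {φ : Cochain Y G k} (hφ : φ ∈ suppAt Γ' (f p) k) : pb f φ ∈ suppAt Γ p k := by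
  have := hf.self_of_nhds.eventually (mem_suppAt.1 hφ)
  rw [mem_suppAt]
  filter_upwards [hf, hΓ, this] with z h1 h2 h3 h4 using (h3 fun h => h4 (h2 h)).pb h1

theorem nullAt_pb {f : X → Y} {Γ : Set X} {Γ' : Set Y} {p : X}
    (hf : ∀ᶠ z in 𝓝 p, ContinuousAt f z) (hΓ : ∀ᶠ z in 𝓝 p, f z ∈ Γ' → z ∈ Γ)
    {φ : Cochain Y G k} (hφ : φ ∈ nullAt Γ' (f p) k) : pb f φ ∈ nullAt Γ p k :=
  exactOn_pb (fun _ _ h => suppAt_pb hf hΓ h) (by simp) (by simpa using hf.self_of_nhds) hφ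

/-- The indicator function of `{θ ≥ 0}`. -/
noncomputable def heaviside (θ : X → ℝ) : X → ℤ := fun x => if 0 ≤ θ x then 1 else 0

theorem heaviside_of_pos {θ : X → ℝ} {x : X} (h : ContinuousAt θ x) (hx : 0 < θ x) :
    ∀ᶠ z in 𝓝 x, heaviside θ z = 1 := by
  filter_upwards [h.eventually (lt_mem_nhds hx)] with z hz
  simp [heaviside, hz.le]

theorem heaviside_of_neg {θ : X → ℝ} {x : X} (h : ContinuousAt θ x) (hx : θ x < 0) :
    ∀ᶠ z in 𝓝 x, heaviside θ z = 0 := by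
  filter_upwards [h.eventually (gt_mem_nhds hx)] with z hz
  simp [heaviside, hz]

theorem vanishesNear_step_heaviside {θ : X → ℝ} {x : X} (h : ContinuousAt θ x) (hx : θ x ≠ 0)
    (φ : Cochain X G k) : VanishesNear (step (heaviside θ) φ) x := by
  refine vanishesNear_step ?_ φ
  rcases lt_or_gt_of_ne hx with hx | hx
  · have := heaviside_of_neg h hx
    filter_upwards [this] with z hz
    rw [hz, this.self_of_nhds]
  · have := heaviside_of_pos h hx
    filter_upwards [this] with z hz
    rw [hz, this.self_of_nhds]

section Suspension

variable {Λ : Set X} {θ : X → ℝ} {q : X}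

theorem step_mem_suppAt (hθ : ∀ᶠ z in 𝓝 q, ContinuousAt θ z) {φ : Cochain X G k}
    (hφ : φ ∈ suppAt Λ q k) :
    step (heaviside θ) φ ∈ suppAt (Λ ∩ {z | θ z = 0}) q (k + 1) := by
  filter_upwards [hθ, mem_suppAt.1 hφ] with z h1 h2 hz
  by_cases h : z ∈ Λ
  · exact vanishesNear_step_heaviside h1 (fun h0 => hz ⟨h, h0⟩) φ
  · exact (h2 h).step _

theorem step_mem_nullAt (hθ : ∀ᶠ z in 𝓝 q, ContinuousAt θ z) {φ : Cochain X G k}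
    (hφ : φ ∈ nullAt Λ q k) :
    step (heaviside θ) φ ∈ nullAt (Λ ∩ {z | θ z = 0}) q (k + 1) := by
  cases k with
  | zero => exact mem_nullAt_of_vanishesNear ((mem_nullAt_zero.1 hφ).step _)
  | succ k =>
    obtain ⟨ψ, hψ, h⟩ := mem_nullAt_succ.1 hφ
    refine mem_nullAt_succ.2 ⟨-step (heaviside θ) ψ, neg_mem (step_mem_suppAt hθ hψ), ?_⟩
    rw [map_neg, cob_step, neg_neg, ← step_sub]
    exact h.step _

/-- Surjectivity of the Mayer–Vietoris connecting map for the two halves of Λ, where θ is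
nonnegative and where it is nonpositive. Since both halves have no local cohomology in this degree,
`φ` has a primitive on each, and `ψ` is the difference of the two. -/
theorem exists_desuspension (hθ : ∀ᶠ z in 𝓝 q, ContinuousAt θ z)
    (hp : ∀ φ : Cochain X G (k + 1), φ ∈ suppAt (Λ ∩ {z | 0 ≤ θ z}) q (k + 1) →
      VanishesNear (cob φ) q → φ ∈ nullAt (Λ ∩ {z | 0 ≤ θ z}) q (k + 1))
    (hn : ∀ φ : Cochain X G (k + 1), φ ∈ suppAt (Λ ∩ {z | θ z ≤ 0}) q (k + 1) →
      VanishesNear (cob φ) q → φ ∈ nullAt (Λ ∩ {z | θ z ≤ 0}) q (k + 1))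
    {φ : Cochain X G (k + 1)} (hφ : φ ∈ suppAt (Λ ∩ {z | θ z = 0}) q (k + 1))
    (hc : VanishesNear (cob φ) q) :
    ∃ ψ : Cochain X G k, ψ ∈ suppAt Λ q k ∧ VanishesNear (cob ψ) q ∧
      φ - step (heaviside θ) ψ ∈ nullAt (Λ ∩ {z | θ z = 0}) q (k + 1) := by
  obtain ⟨ψ₁, h₁, hv₁⟩ := mem_nullAt_succ.1 (hp φ (suppAt_mono (Filter.Eventually.of_forall
    fun z (hz : z ∈ Λ ∩ {z | θ z = 0}) =>
      (⟨hz.1, (show θ z = 0 from hz.2).ge⟩ : z ∈ Λ ∩ {z | 0 ≤ θ z})) hφ) hc)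
  obtain ⟨ψ₂, h₂, hv₂⟩ := mem_nullAt_succ.1 (hn φ (suppAt_mono (Filter.Eventually.of_forall
    fun z (hz : z ∈ Λ ∩ {z | θ z = 0}) =>
      (⟨hz.1, (show θ z = 0 from hz.2).le⟩ : z ∈ Λ ∩ {z | θ z ≤ 0})) hφ) hc)
  have hcob : VanishesNear (cob (ψ₁ - ψ₂)) q := by
    rw [map_sub]; simpa using hv₂.sub hv₁
  refine ⟨ψ₁ - ψ₂, sub_mem (suppAt_mono (Filter.Eventually.of_forall fun z hz => hz.1) h₁)
    (suppAt_mono (Filter.Eventually.of_forall fun z hz => hz.1) h₂), hcob, ?_⟩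
  -- The primitive is `(1 - H) ψ₁ + H ψ₂`. Off the hypersurface, `1 - H` vanishes on the positive
  -- half supporting `ψ₁`, and `H` vanishes on the negative half supporting `ψ₂`.
  refine mem_nullAt_succ.2 ⟨ψ₁ - cut (heaviside θ) ψ₁ + cut (heaviside θ) ψ₂, ?_, ?_⟩
  · filter_upwards [hθ, mem_suppAt.1 h₁, mem_suppAt.1 h₂] with z hz h1 h2 hΛ
    refine VanishesNear.add ?_ ?_
    · by_cases h : z ∈ Λ ∩ {z | 0 ≤ θ z}
      · have h0 : 0 < θ z := lt_of_le_of_ne h.2 fun h0 => hΛ ⟨h.1, h0.symm⟩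
        have := (vanishesNear_cut_sub (heaviside_of_pos hz h0) ψ₁).neg
        rwa [neg_sub] at this
      · exact (h1 h).sub ((h1 h).cut _)
    · by_cases h : z ∈ Λ ∩ {z | θ z ≤ 0}
      · have h0 : θ z < 0 := lt_of_le_of_ne h.2 fun h0 => hΛ ⟨h.1, h0⟩
        exact vanishesNear_cut (heaviside_of_neg hz h0) ψ₂
      · exact (h2 h).cut _
  · have e : φ - step (heaviside θ) (ψ₁ - ψ₂) -
        cob (ψ₁ - cut (heaviside θ) ψ₁ + cut (heaviside θ) ψ₂) =
        (φ - cob ψ₁) + cut (heaviside θ) (cob (ψ₁ - ψ₂)) := by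
      simp only [step_eq, cut_sub, map_add, map_sub]; abel
    rw [e]
    exact hv₁.add (hcob.cut _)

/-- Injectivity of the same connecting map: a primitive ξ of the step splits `φ` as `(H φ - ξ) + (φ
- H φ + ξ)`, a sum of cocycles supported in the two halves. -/
theorem mem_nullAt_of_step (hθ : ∀ᶠ z in 𝓝 q, ContinuousAt θ z)
    (hp : ∀ φ : Cochain X G k, φ ∈ suppAt (Λ ∩ {z | 0 ≤ θ z}) q k →
      VanishesNear (cob φ) q → φ ∈ nullAt (Λ ∩ {z | 0 ≤ θ z}) q k)
    (hn : ∀ φ : Cochain X G k, φ ∈ suppAt (Λ ∩ {z | θ z ≤ 0}) q k →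
      VanishesNear (cob φ) q → φ ∈ nullAt (Λ ∩ {z | θ z ≤ 0}) q k)
    {φ : Cochain X G k} (hφ : φ ∈ suppAt Λ q k) (hc : VanishesNear (cob φ) q)
    (h : step (heaviside θ) φ ∈ nullAt (Λ ∩ {z | θ z = 0}) q (k + 1)) :
    φ ∈ nullAt Λ q k := by
  obtain ⟨ξ, hξ, hv⟩ := mem_nullAt_succ.1 h
  have hc' : VanishesNear (cob (cut (heaviside θ) φ - ξ)) q := by
    have e : cob (cut (heaviside θ) φ - ξ) =
        (step (heaviside θ) φ - cob ξ) + cut (heaviside θ) (cob φ) := by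
      rw [map_sub, cob_cut]; abel
    rw [e]; exact hv.add (hc.cut _)
  have h1 := hp (cut (heaviside θ) φ - ξ) (by
    filter_upwards [hθ, mem_suppAt.1 hφ, mem_suppAt.1 hξ] with z hz h1 h2 hΛ
    by_cases h : z ∈ Λ
    · have h0 : θ z < 0 := lt_of_not_ge fun h0 => hΛ ⟨h, h0⟩
      exact (vanishesNear_cut (heaviside_of_neg hz h0) φ).sub (h2 fun h' => h0.ne h'.2)
    · exact ((h1 h).cut _).sub (h2 fun h' => h h'.1)) hc'
  have h2 := hn (φ - (cut (heaviside θ) φ - ξ)) (by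
    filter_upwards [hθ, mem_suppAt.1 hφ, mem_suppAt.1 hξ] with z hz h1 h2 hΛ
    rw [← sub_add]
    by_cases h : z ∈ Λ
    · have h0 : 0 < θ z := lt_of_not_ge fun h0 => hΛ ⟨h, h0⟩
      have := (vanishesNear_cut_sub (heaviside_of_pos hz h0) φ).neg
      rw [neg_sub] at this
      exact this.add (h2 fun h' => h0.ne' h'.2)
    · exact ((h1 h).sub ((h1 h).cut _)).add (h2 fun h' => h h'.1)) (by
    rw [map_sub]; exact hc.sub hc')
  have := add_mem (nullAt_mono (Filter.Eventually.of_forall fun z hz => hz.1) h1)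
    (nullAt_mono (Filter.Eventually.of_forall fun z hz => hz.1) h2)
  simpa using this

end Suspension

theorem eventually_const_of_cob {φ : Cochain X G 0} {q : X} (h : VanishesNear (cob φ) q) :
    VanishesNear (φ - fun _ => φ fun _ => q) q := by
  obtain ⟨V, hV, hz⟩ := h
  refine ⟨V, hV, fun s hs => ?_⟩
  have := congrFun (cone_cob_zero q φ) s
  rw [← this]
  exact hz _ fun i => by
    cases i using Fin.cases with
    | zero => exact mem_of_mem_nhds hV
    | succ i => exact hs i

/-- A cocycle of degree zero is constant near `q`, and the constant is read off at a nearby point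
outside Λ. -/
theorem vanishesNear_of_frequently_notMem {Λ : Set X} {q : X} (hΛ : ∃ᶠ z in 𝓝 q, z ∉ Λ)
    {φ : Cochain X G 0} (hφ : φ ∈ suppAt Λ q 0) (hc : VanishesNear (cob φ) q) :
    VanishesNear φ q := by
  have h := eventually_const_of_cob hc
  obtain ⟨V, hV, hz⟩ := h
  obtain ⟨z, hz1, hz2, hz3⟩ := (hΛ.and_eventually ((mem_suppAt.1 hφ).and hV)).exists
  obtain ⟨W, hW, hz'⟩ := hz2 hz1
  have h1 := hz (fun _ => z) fun _ => hz3
  rw [Pi.sub_apply, hz' _ fun _ => mem_of_mem_nhds hW, zero_sub, neg_eq_zero] at h1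
  refine ⟨V, hV, fun s hs => ?_⟩
  have := hz s hs
  rwa [Pi.sub_apply, h1, sub_zero] at this

/-- Local cohomology with supports in `Q` vanishes at `q` if the complement of `Q` in arbitrarily
small neighbourhoods of `q` is acyclic. -/
theorem mem_nullAt_of_acyclic {Q : Set X} {q : X}
    (hQ : ∀ W ∈ 𝓝 q, ∃ V ∈ 𝓝 q, V ⊆ W ∧ IsOpen V ∧ (V \ Q).Nonempty ∧ Acyclic G (V \ Q))
    {φ : Cochain X G k} (hφ : φ ∈ suppAt Q q k) (hc : VanishesNear (cob φ) q) :
    φ ∈ nullAt Q q k := by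
  cases k with
  | zero =>
    refine mem_nullAt_zero.2 (vanishesNear_of_frequently_notMem ?_ hφ hc)
    rw [Filter.frequently_iff]
    intro W hW
    obtain ⟨V, -, hVW, -, ⟨z, hz⟩, -⟩ := hQ W hW
    exact ⟨z, hVW hz.1, hz.2⟩
  | succ k =>
    obtain ⟨W, hW, hWz⟩ := hc
    obtain ⟨V, hV, hVW, hVo, ⟨z₀, hz₀⟩, ha⟩ := hQ _ (Filter.inter_mem hW (mem_suppAt.1 hφ))
    -- Near `q` the cocycle is the coboundary of its cone, which need not be supported in `Q`.
    have key : ∀ s : Fin (k + 2) → X, (∀ i, s i ∈ V) → φ s = cob (cone q φ) s := by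
      intro s hs
      have h1 := congrFun (cone_cob q φ) s
      have h2 : cone q (cob φ) s = 0 := hWz _ fun i => by
        cases i using Fin.cases with
        | zero => exact mem_of_mem_nhds hW
        | succ i => exact (hVW (hs i)).1
      rw [h2] at h1
      exact sub_eq_zero.1 h1.symm
    -- Off `Q` the cone is a cocycle, since `φ` vanishes there. Subtracting the global cocycle `t`
    -- leaves a primitive of `φ` supported in `Q`.
    obtain ⟨t, ht, hv⟩ := ha k (cone q φ) fun z hz =>
      ((hVW hz.1).2 hz.2).congr (hVo.mem_nhds hz.1) fun s hs => (key s hs).symm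
    refine mem_nullAt_succ.2 ⟨cone q φ - t, ?_, ?_⟩
    · filter_upwards [hV] with z hz hzQ using hv z ⟨hz, hzQ⟩
    · rw [map_sub, ht, sub_zero]
      exact ⟨V, hV, fun s hs => sub_eq_zero.2 (key s hs)⟩

end Local

/-! ### Products of Heaviside steps: local Thom classes. -/

section Omega

variable {X Y G : Type*} [AddCommGroup G] [TopologicalSpace X] [TopologicalSpace Y] {k : ℕ}

/-- The iterated product `δH(θ (n - 1)) ∪ ⋯ ∪ δH(θ 0) ∪ b`. -/
noncomputable def iter (b : Cochain X G k) (θ : ℕ → X → ℝ) : ∀ n, Cochain X G (k + n)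
  | 0 => b
  | n + 1 => step (heaviside (θ n)) (iter b θ n)

/-- The product `δH(θ (n - 1)) ∪ ⋯ ∪ δH(θ 0)`, where `H` is the Heaviside function. -/
noncomputable def omega (θ : ℕ → X → ℝ) : ∀ n, Cochain X ℤ n
  | 0 => fun _ => 1
  | n + 1 => step (heaviside (θ n)) (omega θ n)

theorem pb_omega (f : X → Y) (θ : ℕ → Y → ℝ) (n : ℕ) :
    pb f (omega θ n) = omega (fun l x => θ l (f x)) n := by
  induction n with
  | zero => rfl
  | succ n ih => rw [omega, pb_step, ih]; rfl

theorem pb_iter (f : X → Y) (b : Cochain Y G k) (θ : ℕ → Y → ℝ) (n : ℕ) :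
    pb f (iter b θ n) = iter (pb f b) (fun l x => θ l (f x)) n := by
  induction n with
  | zero => rfl
  | succ n ih => rw [iter, pb_step, ih]; rfl

theorem cob_omega (θ : ℕ → X → ℝ) (n : ℕ) : cob (omega θ n) = 0 := by
  induction n with
  | zero => exact cob_const_zero 1
  | succ n ih =>
    rw [omega, cob_step, ih]
    funext s; simp [step]

theorem vanishesNear_cob_iter {b : Cochain X G k} {x : X} (h : VanishesNear (cob b) x)
    (θ : ℕ → X → ℝ) (n : ℕ) : VanishesNear (cob (iter b θ n)) x := by
  induction n with
  | zero => exact h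
  | succ n ih => rw [iter, cob_step]; exact (ih.step _).neg

theorem VanishesNear.iter {b : Cochain X G k} {x : X} (h : VanishesNear b x)
    (θ : ℕ → X → ℝ) (n : ℕ) : VanishesNear (iter b θ n) x := by
  induction n with
  | zero => exact h
  | succ n ih => exact ih.step _

theorem iter_sub (b b' : Cochain X G k) (θ : ℕ → X → ℝ) (n : ℕ) :
    iter (b - b') θ n = iter b θ n - iter b' θ n := by
  induction n with
  | zero => rfl
  | succ n ih => rw [iter, ih, step_sub]; rfl

theorem iter_zsmul (m : ℤ) (b : Cochain X G k) (θ : ℕ → X → ℝ) (n : ℕ) :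
    iter (m • b) θ n = m • iter b θ n := by
  induction n with
  | zero => rfl
  | succ n ih => rw [iter, ih, step_zsmul]; rfl

theorem cup_omega (b : Cochain X G k) (θ : ℕ → X → ℝ) (n : ℕ) :
    cup rfl (omega θ n) b = iter b θ n := by
  induction n with
  | zero =>
    funext s
    simp only [cup, omega, one_smul, iter]
    congr 1; funext i; congr 1; ext; simp
  | succ n ih => rw [omega, cup_step rfl, ih]; rfl

theorem iter_omega (θ η : ℕ → X → ℝ) (N n : ℕ) :
    iter (omega θ N) η n = omega (fun l => if l < N then θ l else η (l - N)) (N + n) := by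
  induction n with
  | zero =>
    show omega θ N = omega _ N
    have : ∀ n ≤ N, omega θ n = omega (fun l => if l < N then θ l else η (l - N)) n := by
      intro n
      induction n with
      | zero => intro _; rfl
      | succ n ih =>
        intro hn
        rw [omega, omega, ih (by omega), if_pos (by omega)]
    exact this N le_rfl
  | succ n ih =>
    change step (heaviside (η n)) _ =
      step (heaviside (if N + n < N then θ (N + n) else η (N + n - N))) _
    rw [ih, if_neg (by omega), Nat.add_sub_cancel_left]
    rfl

theorem vanishesNear_omega_sub {θ η : ℕ → X → ℝ} {n : ℕ} {p : X}
    (h : ∀ᶠ z in 𝓝 p, ∀ l < n, θ l z = η l z) : VanishesNear (omega θ n - omega η n) p := by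
  suffices key : ∀ s : Fin (n + 1) → X, (∀ i, ∀ l < n, θ l (s i) = η l (s i)) →
      omega θ n s = omega η n s from ⟨_, h, fun s hs => sub_eq_zero.2 (key s hs)⟩
  clear h
  intro s hs
  induction n with
  | zero => rfl
  | succ n ih =>
    simp only [omega, step, heaviside, hs _ n (Nat.lt_succ_self n)]
    rw [ih (fun i => s i.succ) fun i l hl => hs _ l (by omega)]

/-- Where one coordinate is nonzero its Heaviside function is locally constant, so that factor of
the product vanishes. -/
theorem vanishesNear_iter {b : Cochain X G k} {θ : ℕ → X → ℝ} {n : ℕ} {x : X}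
    (h : ∀ l < n, ContinuousAt (θ l) x) (hx : ∃ l < n, θ l x ≠ 0) :
    VanishesNear (iter b θ n) x := by
  induction n with
  | zero => simp at hx
  | succ n ih =>
    by_cases h0 : θ n x = 0
    · refine (ih (fun l hl => h l (by omega)) ?_).step _
      obtain ⟨l, hl, hne⟩ := hx
      refine ⟨l, lt_of_le_of_ne (by omega) fun e => hne (e ▸ h0), hne⟩
    · exact vanishesNear_step_heaviside (h n (by omega)) h0 _

theorem vanishesNear_omega {θ : ℕ → X → ℝ} {n : ℕ} {x : X}
    (h : ∀ l < n, ContinuousAt (θ l) x) (hx : ∃ l < n, θ l x ≠ 0) :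
    VanishesNear (omega θ n) x := by
  induction n with
  | zero => simp at hx
  | succ n ih =>
    by_cases h0 : θ n x = 0
    · refine (ih (fun l hl => h l (by omega)) ?_).step _
      obtain ⟨l, hl, hne⟩ := hx
      refine ⟨l, lt_of_le_of_ne (by omega) fun e => hne (e ▸ h0), hne⟩
    · exact vanishesNear_step_heaviside (h n (by omega)) h0 _

theorem omega_mem_suppAt {θ : ℕ → X → ℝ} {n : ℕ} {p : X} {Γ : Set X}
    (h : ∀ᶠ z in 𝓝 p, ∀ l < n, ContinuousAt (θ l) z)
    (hΓ : ∀ᶠ z in 𝓝 p, (∀ l < n, θ l z = 0) → z ∈ Γ) : omega θ n ∈ suppAt Γ p n := by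
  filter_upwards [h, hΓ] with z h1 h2 h3
  refine vanishesNear_omega h1 ?_
  by_contra! h4
  exact h3 (h2 h4)

theorem iter_mem_suppAt {b : Cochain X G k} {η : ℕ → X → ℝ} {n : ℕ} {p : X} {Γ Γ' : Set X}
    (hb : b ∈ suppAt Γ p k)
    (h : ∀ᶠ z in 𝓝 p, ∀ l < n, ContinuousAt (η l) z)
    (hΓ : ∀ᶠ z in 𝓝 p, z ∈ Γ → (∀ l < n, η l z = 0) → z ∈ Γ') :
    iter b η n ∈ suppAt Γ' p (k + n) := by
  filter_upwards [mem_suppAt.1 hb, h, hΓ] with z h0 h1 h2 h3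
  by_cases hz : z ∈ Γ
  · refine vanishesNear_iter h1 ?_
    by_contra! h4
    exact h3 (h2 hz h4)
  · exact (h0 hz).iter _ _

theorem iter_mem_nullAt {b : Cochain X G k} {η : ℕ → X → ℝ} {n : ℕ} {p : X} {Γ Γ' : Set X}
    (hb : b ∈ nullAt Γ p k)
    (h : ∀ᶠ z in 𝓝 p, ∀ l < n, ContinuousAt (η l) z)
    (hΓ : ∀ᶠ z in 𝓝 p, z ∈ Γ → (∀ l < n, η l z = 0) → z ∈ Γ') :
    iter b η n ∈ nullAt Γ' p (k + n) := by
  -- The support shrinks by one hypersurface for each factor.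
  suffices key : ∀ m ≤ n, iter b η m ∈ nullAt (Γ ∩ {z | ∀ l < m, η l z = 0}) p (k + m) from
    nullAt_mono (by filter_upwards [hΓ] with z hz hz' using hz hz'.1 hz'.2) (key n le_rfl)
  intro m hm
  induction m with
  | zero => simpa [iter] using hb
  | succ m ih =>
    have := step_mem_nullAt (θ := η m) (h.mono fun z hz => hz m (by omega)) (ih (by omega))
    refine nullAt_mono (Filter.Eventually.of_forall fun z hz => ?_) this
    refine ⟨hz.1.1, fun l hl => ?_⟩
    rcases Nat.lt_succ_iff_lt_or_eq.1 hl with hl | rfl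
    · exact hz.1.2 l hl
    · exact hz.2

end Omega

/-! ### Local cohomology with supports in a linear subspace. -/

section Model

variable {E G : Type*} [NormedAddCommGroup E] [NormedSpace ℝ E] [ProperSpace E] [AddCommGroup G]

/-- In a small ball, the complement of the half of the subspace is star-shaped about `q + ε • w`, a
point in the opposite half. A segment from there ending outside the closed half never enters it:
outside the subspace it stays outside until its start, and inside the subspace `f` stays negative.
-/
theorem half_space_mem_nullAt {n : ℕ} {θ : ℕ → E →L[ℝ] ℝ} {f : E →L[ℝ] ℝ} {q w : E}
    (hfq : f q = 0) (hq : ∀ l < n, θ l q = 0) (hw : ∀ l < n, θ l w = 0) (hfw : f w < 0)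
    {k : ℕ} {φ : Cochain E G k}
    (hφ : φ ∈ suppAt ({z | ∀ l < n, θ l z = 0} ∩ {z | 0 ≤ f z}) q k)
    (hc : VanishesNear (cob φ) q) :
    φ ∈ nullAt ({z | ∀ l < n, θ l z = 0} ∩ {z | 0 ≤ f z}) q k := by
  set Q : Set E := {z | ∀ l < n, θ l z = 0} ∩ {z | 0 ≤ f z} with hQ
  have hQc : IsClosed Q := by
    refine IsClosed.inter ?_ (isClosed_le continuous_const f.continuous)
    have : {z | ∀ l < n, θ l z = 0} = ⋂ l, ⋂ (_ : l < n), {z | θ l z = 0} := by ext; simp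
    rw [this]
    exact isClosed_iInter fun l => isClosed_iInter fun _ =>
      isClosed_eq (θ l).continuous continuous_const
  refine mem_nullAt_of_acyclic (fun W hW => ?_) hφ hc
  obtain ⟨r, hr, hrW⟩ := Metric.mem_nhds_iff.1 hW
  obtain ⟨ε, hε, hεr⟩ : ∃ ε > (0 : ℝ), q + ε • w ∈ Metric.ball q r := by
    have h1 : Filter.Tendsto (fun ε : ℝ => q + ε • w) (𝓝[>] 0) (𝓝 q) := by
      have : Continuous fun ε : ℝ => q + ε • w := by fun_prop
      simpa using (this.tendsto 0).mono_left nhdsWithin_le_nhds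
    have h2 := h1.eventually (Metric.ball_mem_nhds q hr)
    obtain ⟨ε, h3, h4⟩ := (h2.and self_mem_nhdsWithin).exists
    exact ⟨ε, h4, h3⟩
  have hcQ : q + ε • w ∉ Q := by
    intro h
    have : 0 ≤ f (q + ε • w) := h.2
    simp only [map_add, map_smul, hfq, zero_add, smul_eq_mul] at this
    nlinarith
  refine ⟨Metric.ball q r, Metric.ball_mem_nhds q hr, hrW, Metric.isOpen_ball,
    ⟨_, hεr, hcQ⟩, ?_⟩
  refine StarConvex.acyclic_of_isOpen (Metric.isOpen_ball.sdiff hQc) ⟨hεr, hcQ⟩ ?_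
  rintro z ⟨hz, hzQ⟩ a b ha hb hab
  refine ⟨(convex_ball q r) hεr hz ha hb hab, fun h => ?_⟩
  rcases hb.eq_or_lt with rfl | hb
  · rw [add_zero] at hab
    subst hab
    rw [one_smul, zero_smul, add_zero] at h
    exact hcQ h
  · have h1 : ∀ l < n, θ l z = 0 := by
      intro l hl
      have := h.1 l hl
      simp only [map_add, map_smul, hq l hl, hw l hl, smul_eq_mul, mul_zero, add_zero,
        zero_add] at this
      exact (mul_eq_zero.1 this).resolve_left hb.ne'
    have h2 : f z < 0 := lt_of_not_ge fun h0 => hzQ ⟨h1, h0⟩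
    have h3 : 0 ≤ f (a • (q + ε • w) + b • z) := h.2
    simp only [map_add, map_smul, hfq, zero_add, smul_eq_mul] at h3
    have : a * (ε * f w) ≤ 0 := mul_nonpos_of_nonneg_of_nonpos ha (by nlinarith)
    nlinarith

/-- Local cohomology of a normed space with supports in a linear subspace of codimension `n`. -/
theorem local_cohomology_model {n : ℕ} {θ : ℕ → E →L[ℝ] ℝ} {c : ℕ → E} {q : E}
    (hq : ∀ l < n, θ l q = 0) (hc1 : ∀ l < n, θ l (c l) = 1)
    (hc0 : ∀ l < n, ∀ m < l, θ m (c l) = 0) :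
    (∀ (k : ℕ) (φ : Cochain E ℤ k), φ ∈ suppAt {z | ∀ l < n, θ l z = 0} q k →
      VanishesNear (cob φ) q → k ≠ n → φ ∈ nullAt {z | ∀ l < n, θ l z = 0} q k) ∧
    (∀ φ : Cochain E ℤ n, φ ∈ suppAt {z | ∀ l < n, θ l z = 0} q n →
      VanishesNear (cob φ) q → ∃ m : ℤ,
        φ - m • omega (fun l z => θ l z) n ∈ nullAt {z | ∀ l < n, θ l z = 0} q n) ∧
    (∀ m : ℤ, m • omega (fun l z => θ l z) n ∈ nullAt {z | ∀ l < n, θ l z = 0} q n →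
      m = 0) := by
  induction n with
  | zero =>
    -- In codimension zero the supports are unrestricted: the germ has the cohomology of a point,
    -- and a cocycle of degree zero is its value at `q`.
    refine ⟨fun k φ _ hc hk => ?_, fun φ _ hc => ⟨φ fun _ => q, ?_⟩, fun m h => ?_⟩
    · obtain ⟨k, rfl⟩ := Nat.exists_eq_succ_of_ne_zero hk
      refine mem_nullAt_succ.2 ⟨cone q φ, Filter.Eventually.of_forall fun z hz => by simp at hz, ?_⟩
      obtain ⟨V, hV, h⟩ := hc
      refine ⟨V, hV, fun s hs => ?_⟩
      rw [← cone_cob]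
      exact h _ fun i => by
        cases i using Fin.cases with
        | zero => exact mem_of_mem_nhds hV
        | succ i => exact hs i
    · refine mem_nullAt_of_vanishesNear ?_
      have := eventually_const_of_cob hc
      convert this using 2
      funext s; simp [omega]
    · obtain ⟨V, hV, h⟩ := mem_nullAt_zero.1 h
      simpa [omega] using h (fun _ => q) fun _ => mem_of_mem_nhds hV
  | succ n ih =>
    obtain ⟨ih1, ih2, ih3⟩ := ih (fun l hl => hq l (by omega)) (fun l hl => hc1 l (by omega))
      fun l hl => hc0 l (by omega)
    have hset : {z | ∀ l < n + 1, θ l z = 0} =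
        {z | ∀ l < n, θ l z = 0} ∩ {z | θ n z = 0} := by
      ext z
      refine ⟨fun h => ⟨fun l hl => h l (by omega), h n (by omega)⟩, fun h l hl => ?_⟩
      rcases Nat.lt_succ_iff_lt_or_eq.1 hl with hl | rfl
      exacts [h.1 l hl, h.2]
    rw [hset]
    have hθ : ∀ᶠ z in 𝓝 q, ContinuousAt (fun z => θ n z) z :=
      Filter.Eventually.of_forall fun z => (θ n).continuous.continuousAt
    -- The vector `c n` lies in the common zero set of the earlier functionals, so `-c n` and `c n`
    -- serve as centres for the two halves. Triangularity of the dual vectors is all that this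
    -- needs.
    have hp : ∀ (k : ℕ) (φ : Cochain E ℤ k),
        φ ∈ suppAt ({z | ∀ l < n, θ l z = 0} ∩ {z | 0 ≤ θ n z}) q k →
        VanishesNear (cob φ) q →
        φ ∈ nullAt ({z | ∀ l < n, θ l z = 0} ∩ {z | 0 ≤ θ n z}) q k := by
      intro k φ
      refine half_space_mem_nullAt (w := - c n) (hq n (by omega)) (fun l hl => hq l (by omega))
        (fun l hl => ?_) ?_
      · rw [map_neg, hc0 n (by omega) l hl, neg_zero]
      · rw [map_neg, hc1 n (by omega)]; norm_num
    have hn : ∀ (k : ℕ) (φ : Cochain E ℤ k),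
        φ ∈ suppAt ({z | ∀ l < n, θ l z = 0} ∩ {z | θ n z ≤ 0}) q k →
        VanishesNear (cob φ) q →
        φ ∈ nullAt ({z | ∀ l < n, θ l z = 0} ∩ {z | θ n z ≤ 0}) q k := by
      intro k φ
      have e : {z | θ n z ≤ 0} = {z | 0 ≤ (-θ n) z} := by ext z; simp
      rw [e]
      refine half_space_mem_nullAt (w := c n) ?_ (fun l hl => hq l (by omega))
        (fun l hl => hc0 n (by omega) l hl) ?_
      · simp [hq n (by omega)]
      · simp [hc1 n (by omega)]
    refine ⟨fun k φ hφ hc hk => ?_, fun φ hφ hc => ?_, fun m h => ?_⟩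
    · cases k with
      | zero =>
        refine mem_nullAt_zero.2 (vanishesNear_of_frequently_notMem ?_ hφ hc)
        rw [← hset, Filter.frequently_iff]
        intro W hW
        have h1 : Filter.Tendsto (fun ε : ℝ => q + ε • c n) (𝓝[>] 0) (𝓝 q) := by
          have : Continuous fun ε : ℝ => q + ε • c n := by fun_prop
          simpa using (this.tendsto 0).mono_left nhdsWithin_le_nhds
        obtain ⟨ε, h3, h4⟩ := ((h1.eventually hW).and self_mem_nhdsWithin).exists
        refine ⟨_, h3, fun h => ?_⟩
        have := h n (by omega)
        simp only [map_add, map_smul, hq n (by omega), hc1 n (by omega), smul_eq_mul, mul_one,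
          zero_add] at this
        exact h4.ne' this
      | succ k =>
        -- Desuspension lowers degree and codimension by one together.
        obtain ⟨ψ, hψ, hψc, h⟩ := exists_desuspension hθ (hp _) (hn _) hφ hc
        have := add_mem h (step_mem_nullAt hθ (ih1 k ψ hψ hψc (by omega)))
        simpa using this
    · obtain ⟨ψ, hψ, hψc, h⟩ := exists_desuspension hθ (hp _) (hn _) hφ hc
      obtain ⟨m, hm⟩ := ih2 ψ hψ hψc
      refine ⟨m, ?_⟩
      have := add_mem h (step_mem_nullAt hθ hm)
      rw [step_sub, step_zsmul] at this
      rw [sub_add_sub_cancel] at this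
      exact this
    · refine ih3 m (mem_nullAt_of_step hθ (hp _) (hn _) ?_ ?_ ?_)
      · refine zsmul_mem (omega_mem_suppAt ?_ ?_) m
        · exact Filter.Eventually.of_forall fun z l _ => (θ l).continuous.continuousAt
        · exact Filter.Eventually.of_forall fun z hz => hz
      · rw [map_zsmul, cob_omega, smul_zero]; exact VanishesNear.zero q
      · rw [step_zsmul]; exact h

end Model

/-! ### Locally flat subsets and transport of the model computation. -/

section Flat

variable {X G : Type*} [AddCommGroup G] [TopologicalSpace X] {k : ℕ}

/-- `Ψ` is a germ at `p` of a homeomorphism onto a normed space, with inverse `Φ`, in which the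
functions `Θ 0, …, Θ (N - 1)` become linearly independent linear functionals `θ l`, with common
zero set `Γ`. -/
structure IsFlatChart {E : Type*} [NormedAddCommGroup E] [NormedSpace ℝ E]
    (Γ : Set X) (p : X) (N : ℕ) (Θ : ℕ → X → ℝ) (Ψ : X → E) (Φ : E → X)
    (θ : ℕ → E →L[ℝ] ℝ) (c : ℕ → E) : Prop where
  mem : p ∈ Γ
  continuousAt : ∀ᶠ z in 𝓝 p, ContinuousAt Ψ z
  continuousAt_symm : ∀ᶠ w in 𝓝 (Ψ p), ContinuousAt Φ w
  left_inv : ∀ᶠ z in 𝓝 p, Φ (Ψ z) = z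
  right_inv : ∀ᶠ w in 𝓝 (Ψ p), Ψ (Φ w) = w
  eq_linear : ∀ᶠ z in 𝓝 p, ∀ l < N, Θ l z = θ l (Ψ z)
  mem_iff : ∀ᶠ z in 𝓝 p, z ∈ Γ ↔ ∀ l < N, Θ l z = 0
  dual_one : ∀ l < N, θ l (c l) = 1
  dual_zero : ∀ l < N, ∀ m < l, θ m (c l) = 0

/-- `Γ` is near `p` a locally flat submanifold of codimension `N`, with defining functions
`Θ 0, …, Θ (N - 1)`. -/
def Flat (Γ : Set X) (p : X) (N : ℕ) (Θ : ℕ → X → ℝ) : Prop :=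
  ∃ (E : Type) (_ : NormedAddCommGroup E) (_ : NormedSpace ℝ E) (_ : ProperSpace E)
    (Ψ : X → E) (Φ : E → X) (θ : ℕ → E →L[ℝ] ℝ) (c : ℕ → E), IsFlatChart Γ p N Θ Ψ Φ θ c

variable {Γ : Set X} {p : X} {N : ℕ} {Θ : ℕ → X → ℝ}

section Chart

variable {E : Type*} [NormedAddCommGroup E] [NormedSpace ℝ E]
  {Ψ : X → E} {Φ : E → X} {θ : ℕ → E →L[ℝ] ℝ} {c : ℕ → E}

theorem IsFlatChart.continuousAt_defining (h : IsFlatChart Γ p N Θ Ψ Φ θ c) :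
    ∀ᶠ z in 𝓝 p, ∀ l < N, ContinuousAt (Θ l) z := by
  filter_upwards [h.continuousAt, eventually_eventually_nhds.2 h.eq_linear] with z h1 h2 l hl
  have : ContinuousAt (fun z => θ l (Ψ z)) z := (θ l).continuous.continuousAt.comp h1
  exact this.congr (h2.mono fun w hw => (hw l hl).symm)

theorem IsFlatChart.tendsto_symm (h : IsFlatChart Γ p N Θ Ψ Φ θ c) :
    Filter.Tendsto Φ (𝓝 (Ψ p)) (𝓝 p) := by
  have := h.continuousAt_symm.self_of_nhds
  rwa [ContinuousAt, h.left_inv.self_of_nhds] at this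

theorem IsFlatChart.symm_mem_iff (h : IsFlatChart Γ p N Θ Ψ Φ θ c) :
    ∀ᶠ w in 𝓝 (Ψ p), Φ w ∈ Γ ↔ w ∈ {w | ∀ l < N, θ l w = 0} := by
  filter_upwards [h.tendsto_symm.eventually h.mem_iff, h.tendsto_symm.eventually h.eq_linear,
    h.right_inv] with w h1 h2 h3
  rw [h1]
  refine forall₂_congr fun l hl => ?_
  rw [h2 l hl, h3]

theorem IsFlatChart.mem_iff_linear (h : IsFlatChart Γ p N Θ Ψ Φ θ c) :
    ∀ᶠ z in 𝓝 p, z ∈ Γ ↔ Ψ z ∈ {w | ∀ l < N, θ l w = 0} := by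
  filter_upwards [h.mem_iff, h.eq_linear] with z h1 h2
  rw [h1]
  exact forall₂_congr fun l hl => by rw [h2 l hl]

theorem IsFlatChart.pb_symm_mem_suppAt (h : IsFlatChart Γ p N Θ Ψ Φ θ c) {φ : Cochain X G k}
    (hφ : φ ∈ suppAt Γ p k) : pb Φ φ ∈ suppAt {w | ∀ l < N, θ l w = 0} (Ψ p) k :=
  suppAt_pb h.continuousAt_symm (h.symm_mem_iff.mono fun _ hw => hw.1)
    (by rwa [h.left_inv.self_of_nhds])

theorem IsFlatChart.pb_symm_mem_nullAt (h : IsFlatChart Γ p N Θ Ψ Φ θ c) {φ : Cochain X G k}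
    (hφ : φ ∈ nullAt Γ p k) : pb Φ φ ∈ nullAt {w | ∀ l < N, θ l w = 0} (Ψ p) k :=
  nullAt_pb h.continuousAt_symm (h.symm_mem_iff.mono fun _ hw => hw.1)
    (by rwa [h.left_inv.self_of_nhds])

theorem IsFlatChart.mem_nullAt_of_pb_symm (h : IsFlatChart Γ p N Θ Ψ Φ θ c) {φ : Cochain X G k}
    (hφ : pb Φ φ ∈ nullAt {w | ∀ l < N, θ l w = 0} (Ψ p) k) : φ ∈ nullAt Γ p k := by
  have := nullAt_pb h.continuousAt (h.mem_iff_linear.mono fun _ hw => hw.2) hφ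
  refine mem_nullAt_congr this ⟨_, h.left_inv, fun s hs => ?_⟩
  have hs : ∀ i, Φ (Ψ (s i)) = s i := hs
  simp [pb, hs]

theorem IsFlatChart.vanishesNear_cob_pb_symm (h : IsFlatChart Γ p N Θ Ψ Φ θ c)
    {φ : Cochain X G k} (hφ : VanishesNear (cob φ) p) : VanishesNear (cob (pb Φ φ)) (Ψ p) := by
  rw [cob_pb]
  refine VanishesNear.pb ?_ h.continuousAt_symm.self_of_nhds
  rwa [h.left_inv.self_of_nhds]

theorem IsFlatChart.vanishesNear_pb_symm_omega (h : IsFlatChart Γ p N Θ Ψ Φ θ c) :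
    VanishesNear (omega (fun l w => θ l w) N - pb Φ (omega Θ N)) (Ψ p) := by
  rw [pb_omega]
  refine vanishesNear_omega_sub ?_
  filter_upwards [h.tendsto_symm.eventually h.eq_linear, h.right_inv] with w h1 h2 l hl
  rw [h1 l hl, h2]

theorem IsFlatChart.zero (h : IsFlatChart Γ p N Θ Ψ Φ θ c) : ∀ l < N, θ l (Ψ p) = 0 :=
  h.mem_iff_linear.self_of_nhds.1 h.mem

end Chart

theorem Flat.continuousAt (h : Flat Γ p N Θ) : ∀ᶠ z in 𝓝 p, ∀ l < N, ContinuousAt (Θ l) z := by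
  obtain ⟨E, _, _, _, Ψ, Φ, θ, c, h⟩ := h
  exact h.continuousAt_defining

theorem Flat.mem_iff (h : Flat Γ p N Θ) : ∀ᶠ z in 𝓝 p, z ∈ Γ ↔ ∀ l < N, Θ l z = 0 := by
  obtain ⟨E, _, _, _, Ψ, Φ, θ, c, h⟩ := h
  exact h.mem_iff

theorem Flat.omega_mem_suppAt (h : Flat Γ p N Θ) : omega Θ N ∈ suppAt Γ p N :=
  AlexanderSpanier.omega_mem_suppAt h.continuousAt (h.mem_iff.mono fun _ hz => hz.2)

theorem Flat.mem_nullAt (h : Flat Γ p N Θ) {φ : Cochain X ℤ k} (hφ : φ ∈ suppAt Γ p k)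
    (hc : VanishesNear (cob φ) p) (hk : k ≠ N) : φ ∈ nullAt Γ p k := by
  obtain ⟨E, _, _, _, Ψ, Φ, θ, c, h⟩ := h
  exact h.mem_nullAt_of_pb_symm ((local_cohomology_model h.zero h.dual_one h.dual_zero).1 k _
    (h.pb_symm_mem_suppAt hφ) (h.vanishesNear_cob_pb_symm hc) hk)

theorem Flat.exists_sub_zsmul_mem_nullAt (h : Flat Γ p N Θ) {φ : Cochain X ℤ N}
    (hφ : φ ∈ suppAt Γ p N) (hc : VanishesNear (cob φ) p) :
    ∃ m : ℤ, φ - m • omega Θ N ∈ nullAt Γ p N := by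
  obtain ⟨E, _, _, _, Ψ, Φ, θ, c, h⟩ := h
  obtain ⟨m, hm⟩ := (local_cohomology_model h.zero h.dual_one h.dual_zero).2.1 _
    (h.pb_symm_mem_suppAt hφ) (h.vanishesNear_cob_pb_symm hc)
  refine ⟨m, h.mem_nullAt_of_pb_symm ?_⟩
  refine mem_nullAt_congr hm ?_
  have := h.vanishesNear_pb_symm_omega.zsmul m
  rw [smul_sub] at this
  have e : pb Φ (φ - m • omega Θ N) - (pb Φ φ - m • omega (fun l w => θ l w) N) =
      m • omega (fun l w => θ l w) N - m • pb Φ (omega Θ N) := by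
    have : pb Φ (φ - m • omega Θ N) = pb Φ φ - m • pb Φ (omega Θ N) := rfl
    rw [this]; abel
  rwa [e]

theorem Flat.eq_zero_of_zsmul_mem_nullAt (h : Flat Γ p N Θ) {m : ℤ}
    (hm : m • omega Θ N ∈ nullAt Γ p N) : m = 0 := by
  obtain ⟨E, _, _, _, Ψ, Φ, θ, c, h⟩ := h
  refine (local_cohomology_model h.zero h.dual_one h.dual_zero).2.2 m ?_
  refine mem_nullAt_congr (h.pb_symm_mem_nullAt hm) ?_
  have := h.vanishesNear_pb_symm_omega.zsmul m
  rw [smul_sub] at this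
  exact this

theorem suppAt_eventually {φ : Cochain X G k} (h : φ ∈ suppAt Γ p k) :
    ∀ᶠ z in 𝓝 p, φ ∈ suppAt Γ z k :=
  eventually_eventually_nhds.2 h

theorem nullAt_eventually {φ : Cochain X G k} (h : φ ∈ nullAt Γ p k) :
    ∀ᶠ z in 𝓝 p, φ ∈ nullAt Γ z k := by
  cases k with
  | zero =>
    filter_upwards [(mem_nullAt_zero.1 h).eventually] with z hz using mem_nullAt_zero.2 hz
  | succ k =>
    obtain ⟨ψ, hψ, hv⟩ := mem_nullAt_succ.1 h
    filter_upwards [suppAt_eventually hψ, hv.eventually] with z h1 h2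
    exact mem_nullAt_succ.2 ⟨ψ, h1, h2⟩

/-- Flatness of the cylinder lets a whole homotopy be treated as one local class. -/
theorem Flat.prod_real (h : Flat Γ p N Θ) (t : ℝ) :
    Flat {a : ℝ × X | a.2 ∈ Γ} (t, p) N fun l a => Θ l a.2 := by
  obtain ⟨E, _, _, _, Ψ, Φ, θ, c, h⟩ := h
  have hsnd : Filter.Tendsto (Prod.snd : ℝ × X → X) (𝓝 (t, p)) (𝓝 p) :=
    continuous_snd.continuousAt
  have hsnd' : Filter.Tendsto (Prod.snd : ℝ × E → E) (𝓝 (t, Ψ p)) (𝓝 (Ψ p)) :=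
    continuous_snd.continuousAt
  refine ⟨ℝ × E, inferInstance, inferInstance, inferInstance, fun a => (a.1, Ψ a.2),
    fun b => (b.1, Φ b.2), fun l => (θ l).comp (ContinuousLinearMap.snd ℝ ℝ E),
    fun l => (0, c l), h.mem, ?_, ?_, ?_, ?_, ?_, ?_, h.dual_one, h.dual_zero⟩
  · filter_upwards [hsnd.eventually h.continuousAt] with a ha
    exact continuousAt_fst.prodMk (ha.comp continuousAt_snd)
  · filter_upwards [hsnd'.eventually h.continuousAt_symm] with b hb
    exact continuousAt_fst.prodMk (hb.comp continuousAt_snd)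
  · filter_upwards [hsnd.eventually h.left_inv] with a ha
    exact Prod.ext rfl ha
  · filter_upwards [hsnd'.eventually h.right_inv] with b hb
    exact Prod.ext rfl hb
  · filter_upwards [hsnd.eventually h.eq_linear] with a ha using ha
  · filter_upwards [hsnd.eventually h.mem_iff] with a ha using ha

/-- Homotopic systems of defining functions have the same local class. -/
theorem Flat.homotopy (h : Flat Γ p N Θ) {H : ℝ → ℕ → X → ℝ}
    (hc : ∀ t ∈ Set.Icc (0 : ℝ) 1, ∀ᶠ a : ℝ × X in 𝓝 (t, p), ∀ l < N,
      ContinuousAt (fun b : ℝ × X => H b.1 l b.2) a)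
    (hz : ∀ t ∈ Set.Icc (0 : ℝ) 1, ∀ᶠ a : ℝ × X in 𝓝 (t, p),
      (∀ l < N, H a.1 l a.2 = 0) → a.2 ∈ Γ) :
    omega (H 0) N - omega (H 1) N ∈ nullAt Γ p N := by
  let pr : ℝ → ℝ := fun t => Set.projIcc (0 : ℝ) 1 zero_le_one t
  have hpr : Continuous pr := continuous_subtype_val.comp continuous_projIcc
  have hpr' : Continuous fun a : ℝ × X => (pr a.1, a.2) :=
    (hpr.comp continuous_fst).prodMk continuous_snd
  have hmem : ∀ t, pr t ∈ Set.Icc (0 : ℝ) 1 := fun t => (Set.projIcc (0 : ℝ) 1 zero_le_one t).2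
  have key : omega (H (pr 0)) N - omega (H (pr 1)) N ∈ nullAt Γ p N := by
    refine PreconnectedSpace.induction₂'
      (fun a b => omega (H (pr a)) N - omega (H (pr b)) N ∈ nullAt Γ p N) (fun t => ?_)
      ⟨fun a b c hab hbc => by
        have := add_mem hab hbc
        rwa [sub_add_sub_cancel] at this⟩ 0 1
    have htend : Filter.Tendsto (fun a : ℝ × X => (pr a.1, a.2)) (𝓝 (t, p)) (𝓝 (pr t, p)) :=
      hpr'.continuousAt
    -- On the cylinder the homotopy gives a single class with supports over Γ, hence one integer `m`
    -- near `(t, p)`. Restriction to nearby time slices gives the same multiple of `omega Θ N`, so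
    -- the class is locally constant in time.
    obtain ⟨m, hm⟩ := (h.prod_real t).exists_sub_zsmul_mem_nullAt
      (φ := omega (fun l a => H (pr a.1) l a.2) N)
      (AlexanderSpanier.omega_mem_suppAt
        (by
          filter_upwards [htend.eventually (hc _ (hmem t))] with a ha l hl
          exact ContinuousAt.comp (f := fun a : ℝ × X => (pr a.1, a.2)) (ha l hl)
            hpr'.continuousAt)
        (by filter_upwards [htend.eventually (hz _ (hmem t))] with a ha using ha))
      (by rw [cob_omega]; exact VanishesNear.zero _)
    have hev : ∀ᶠ t' in 𝓝 t, omega (H (pr t')) N - m • omega Θ N ∈ nullAt Γ p N := by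
      have h1 : Filter.Tendsto (fun t' : ℝ => (t', p)) (𝓝 t) (𝓝 (t, p)) := by
        have : Continuous fun t' : ℝ => (t', p) := by fun_prop
        exact this.continuousAt
      filter_upwards [h1.eventually (nullAt_eventually hm)] with t' ht'
      have := nullAt_pb (f := fun x : X => (t', x)) (p := p) (Γ := Γ)
        (Filter.Eventually.of_forall fun x => by fun_prop)
        (Filter.Eventually.of_forall fun x hx => hx) ht'
      have e : pb (fun x : X => (t', x)) (omega (fun l a => H (pr a.1) l a.2) N -
          m • omega (fun l (a : ℝ × X) => Θ l a.2) N) = omega (H (pr t')) N - m • omega Θ N := by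
        have h2 := pb_omega (fun x : X => (t', x)) (fun l a => H (pr a.1) l a.2) N
        have h3 := pb_omega (fun x : X => (t', x)) (fun l (a : ℝ × X) => Θ l a.2) N
        rw [← show omega (fun l x => Θ l x) N = omega Θ N from rfl, ← h3,
          ← show omega (fun l x => H (pr t') l x) N = omega (H (pr t')) N from rfl, ← h2]
        rfl
      rwa [e] at this
    filter_upwards [hev] with t' ht'
    have h0 := hev.self_of_nhds
    have h1 := sub_mem h0 ht'
    have h2 := sub_mem ht' h0
    rw [sub_sub_sub_cancel_right] at h1 h2
    exact ⟨h1, h2⟩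
  have e0 : pr 0 = 0 := by simp [pr]
  have e1 : pr 1 = 1 := by simp [pr]
  rwa [e0, e1] at key

end Flat

/-! ### From local to global classes with supports. -/

section Glue

variable {X G : Type*} [AddCommGroup G] [TopologicalSpace X] {k : ℕ}

theorem isOpen_vanishesNear (φ : Cochain X G k) : IsOpen {x | VanishesNear φ x} :=
  isOpen_iff_mem_nhds.2 fun _ hx => hx.eventually

/-- The points where the two cochains differ form a closed set meeting `L₁` and `L₂` in disjoint
compact sets. The indicator of an open set separating these selects which cochain to use; no
continuity is needed. -/
theorem exists_glue [T2Space X] {L₁ L₂ : Set X} (h₁ : IsCompact L₁) (h₂ : IsCompact L₂)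
    {φ₁ φ₂ : Cochain X G k} (h : ∀ x ∈ L₁ ∩ L₂, VanishesNear (φ₁ - φ₂) x) :
    ∃ φ : Cochain X G k, (∀ x ∈ L₁, VanishesNear (φ - φ₁) x) ∧
      (∀ x ∈ L₂, VanishesNear (φ - φ₂) x) ∧
      ∀ z, VanishesNear φ₁ z → VanishesNear φ₂ z → VanishesNear φ z := by
  classical
  have hD : IsClosed {x | VanishesNear (φ₁ - φ₂) x}ᶜ := (isOpen_vanishesNear _).isClosed_compl
  obtain ⟨S, S', hS, hS', hLS, hLS', hd⟩ := SeparatedNhds.of_isCompact_isCompact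
    (h₁.inter_right hD) (h₂.inter_right hD) (by
      rw [Set.disjoint_left]
      exact fun x hx hx' => hx.2 (h x ⟨hx.1, hx'.1⟩))
  let χ : X → ℤ := S.indicator 1
  refine ⟨cut χ φ₁ + (φ₂ - cut χ φ₂), fun x hx => ?_, fun x hx => ?_, fun z hz hz' =>
    (hz.cut _).add (hz'.sub (hz'.cut _))⟩
  · have e : cut χ φ₁ + (φ₂ - cut χ φ₂) - φ₁ = cut χ (φ₁ - φ₂) - (φ₁ - φ₂) := by
      rw [cut_sub]; abel
    rw [e]
    by_cases hv : VanishesNear (φ₁ - φ₂) x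
    · exact (hv.cut _).sub hv
    · refine vanishesNear_cut_sub ?_ _
      filter_upwards [hS.mem_nhds (hLS ⟨hx, hv⟩)] with z hz
      simp [χ, hz]
  · have e : cut χ φ₁ + (φ₂ - cut χ φ₂) - φ₂ = cut χ (φ₁ - φ₂) := by
      rw [cut_sub]; abel
    rw [e]
    by_cases hv : VanishesNear (φ₁ - φ₂) x
    · exact hv.cut _
    · refine vanishesNear_cut ?_ _
      filter_upwards [hS'.mem_nhds (hLS' ⟨hx, hv⟩)] with z hz
      have : z ∉ S := fun h => Set.disjoint_left.1 hd h hz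
      simp [χ, this]

/-- Cut off a cochain outside a neighbourhood of the compact set `L`. -/
theorem exists_cut [T2Space X] [LocallyCompactSpace X] {L O : Set X} (hL : IsCompact L)
    (hO : IsOpen O) (hLO : L ⊆ O) (φ : Cochain X G k) :
    ∃ φ' : Cochain X G k, (∀ x ∈ L, VanishesNear (φ' - φ) x) ∧
      (∀ z, VanishesNear φ z → VanishesNear φ' z) ∧ (∀ z ∉ O, VanishesNear φ' z) ∧
      φ' ∈ compactSupp X G k := by
  classical
  obtain ⟨C, hC, hLC, hCO⟩ := exists_compact_between hL hO hLO
  refine ⟨cut (C.indicator 1) φ, fun x hx => vanishesNear_cut_sub ?_ _, fun z hz => hz.cut _,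
    fun z hz => vanishesNear_cut ?_ _, C, hC, fun s hs => ?_⟩
  · filter_upwards [isOpen_interior.mem_nhds (hLC hx)] with z hz
    simp [interior_subset hz]
  · filter_upwards [hC.isClosed.isOpen_compl.mem_nhds fun h => hz (hCO h)] with w hw
    simp [show w ∉ C from hw]
  · simp [cut, hs 0]

theorem exists_vanishing_cut [T2Space X] [LocallyCompactSpace X] {L Γ : Set X}
    (hL : IsCompact L) {φ : Cochain X G k} (hφ : ∀ p ∈ L, φ ∈ suppAt Γ p k) :
    ∃ φ' : Cochain X G k, (∀ x ∈ L, VanishesNear (φ' - φ) x) ∧ φ' ∈ vanishing Γᶜ k := by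
  obtain ⟨φ', h1, h2, h3, -⟩ := exists_cut hL (isOpen_interior (s := {z | z ∉ Γ →
    VanishesNear φ z})) (fun p hp => mem_interior_iff_mem_nhds.2 (hφ p hp)) φ
  refine ⟨φ', h1, fun z hz => ?_⟩
  by_cases h : z ∈ interior {z | z ∉ Γ → VanishesNear φ z}
  · exact h2 z (interior_subset h hz)
  · exact h3 z h

theorem suppAt_of_vanishing {Γ : Set X} {φ : Cochain X G k} (h : φ ∈ vanishing Γᶜ k) (p : X) :
    φ ∈ suppAt Γ p k :=
  Filter.Eventually.of_forall h

/-- The coboundary of a primitive is defined everywhere, so a germ of an exact cocycle extends to a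
cocycle on the whole space, supported in Γ and locally null. Such extensions are used as corrections
on overlaps. -/
theorem exists_exact_of_mem_exactOn {Γ K : Set X} {φ : Cochain X G k}
    (h : φ ∈ exactOn (fun j => vanishing Γᶜ j) K k) :
    ∃ t : Cochain X G k, cob t = 0 ∧ t ∈ vanishing Γᶜ k ∧ (∀ p, t ∈ nullAt Γ p k) ∧
      ∀ x ∈ K, VanishesNear (φ - t) x := by
  cases k with
  | zero => exact ⟨0, map_zero _, zero_mem _, fun _ => zero_mem _, fun x hx => by rw [sub_zero]; exact h x hx⟩
  | succ k =>
    obtain ⟨ψ, hψ, hv⟩ := mem_exactOn_succ.1 h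
    refine ⟨cob ψ, cob_cob ψ, fun z hz => (hψ z hz).cob, fun p => ?_, hv⟩
    refine mem_nullAt_succ.2 ⟨ψ, suppAt_of_vanishing hψ p, ?_⟩
    rw [sub_self]; exact VanishesNear.zero p

variable [T2Space X] [LocallyCompactSpace X] {Γ : Set X} {N : ℕ}

/-- A cocycle with supports in `Γ` that is locally zero is zero near compact sets, if the local
cohomology vanishes in lower degrees. -/
theorem mem_exactOn_of_nullAt
    (hvan : ∀ p ∈ Γ, ∀ i < N, ∀ φ : Cochain X G i, φ ∈ suppAt Γ p i →
      VanishesNear (cob φ) p → φ ∈ nullAt Γ p i)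
    (hkN : k ≤ N) {K : Set X} (hK : IsCompact K) (hKΓ : K ⊆ Γ) {φ : Cochain X G k}
    (hφ : ∀ p ∈ K, φ ∈ nullAt Γ p k) :
    φ ∈ exactOn (fun j => vanishing Γᶜ j) K k := by
  induction k generalizing K with
  | zero => exact fun x hx => mem_nullAt_zero.1 (hφ x hx)
  | succ k ih =>
    suffices h : ∃ L, IsCompact L ∧ K ⊆ L ∧ L ⊆ K ∧
        φ ∈ exactOn (fun j => vanishing Γᶜ j) L (k + 1) by
      obtain ⟨L, -, hKL, -, h⟩ := h
      exact exactOn_mono (fun _ => le_rfl) hKL h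
    refine IsCompact.induction_on (p := fun t => ∃ L, IsCompact L ∧ t ⊆ L ∧ L ⊆ K ∧
      φ ∈ exactOn (fun j => vanishing Γᶜ j) L (k + 1)) hK
      ⟨∅, isCompact_empty, subset_rfl, Set.empty_subset _,
        mem_exactOn_of_vanishing fun x hx => absurd hx (Set.notMem_empty x)⟩
      (fun s t hst ⟨L, h1, h2, h3⟩ => ⟨L, h1, hst.trans h2, h3⟩) ?_ ?_
    · rintro s t ⟨L₁, hL₁, hs, hLK₁, h₁⟩ ⟨L₂, hL₂, ht, hLK₂, h₂⟩
      obtain ⟨ψ₁, hψ₁, hv₁⟩ := mem_exactOn_succ.1 h₁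
      obtain ⟨ψ₂, hψ₂, hv₂⟩ := mem_exactOn_succ.1 h₂
      -- The difference of two primitives is a cocycle of degree below `N`. It is locally null
      -- because local cohomology vanishes there, hence exact near the overlap by induction.
      have hnull : ∀ p ∈ L₁ ∩ L₂, ψ₁ - ψ₂ ∈ nullAt Γ p k := by
        intro p hp
        refine hvan p (hKΓ (hLK₁ hp.1)) k (by omega) _
          (suppAt_of_vanishing (sub_mem hψ₁ hψ₂) p) ?_
        have := (hv₂ p hp.2).sub (hv₁ p hp.1)
        rw [map_sub]; simpa using this
      obtain ⟨t', ht', htΓ, -, htv⟩ := exists_exact_of_mem_exactOn (ih (by omega)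
        (hL₁.inter hL₂) (fun p hp => hKΓ (hLK₁ hp.1)) hnull)
      -- Since `cob t' = 0`, adding `t'` keeps `ψ₂` a primitive, and it now agrees with `ψ₁` near
      -- the overlap.
      obtain ⟨ψ, h1, h2, h3⟩ := exists_glue hL₁ hL₂ (φ₁ := ψ₁) (φ₂ := ψ₂ + t')
        (by simpa [sub_sub] using htv)
      refine ⟨L₁ ∪ L₂, hL₁.union hL₂, Set.union_subset_union hs ht, Set.union_subset hLK₁ hLK₂,
        mem_exactOn_succ.2 ⟨ψ, fun z hz => h3 z (hψ₁ z hz) ((hψ₂ z hz).add (htΓ z hz)), ?_⟩⟩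
      rintro x (hx | hx)
      · have := (hv₁ x hx).sub (h1 x hx).cob
        rw [map_sub] at this
        simpa using this
      · have := (hv₂ x hx).sub (h2 x hx).cob
        rw [map_sub, map_add, ht', add_zero] at this
        simpa using this
    · intro x hx
      obtain ⟨ψ, hψ, hv⟩ := mem_nullAt_succ.1 (hφ x hx)
      obtain ⟨L, hLx, hLO, hL⟩ := local_compact_nhds
        (Filter.inter_mem (suppAt_eventually hψ) hv.eventually)
      obtain ⟨ψ', h1, h2⟩ := exists_vanishing_cut (hL.inter_right hK.isClosed)
        (φ := ψ) (Γ := Γ) fun p hp => (hLO hp.1).1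
      refine ⟨L ∩ K, mem_nhdsWithin.2 ?_, L ∩ K, hL.inter_right hK.isClosed, subset_rfl,
        Set.inter_subset_right, mem_exactOn_succ.2 ⟨ψ', h2, fun z hz => ?_⟩⟩
      · obtain ⟨O, hO, hOo, hxO⟩ := mem_nhds_iff.1 hLx
        exact ⟨O, hOo, hxO, Set.inter_subset_inter_left _ hO⟩
      · have := (hLO hz.1).2.sub (h1 z hz).cob
        rw [map_sub] at this
        simpa using this

/-- Local sections of the top local cohomology with supports in a compact set glue. -/
theorem exists_global_section
    (hvan : ∀ p ∈ Γ, ∀ i < N, ∀ φ : Cochain X G i, φ ∈ suppAt Γ p i →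
      VanishesNear (cob φ) p → φ ∈ nullAt Γ p i)
    (hΓ : IsCompact Γ) (Good : X → Cochain X G N → Prop)
    (hsub : ∀ p ∈ Γ, ∀ φ φ' : Cochain X G N, φ ∈ suppAt Γ p N → φ' ∈ suppAt Γ p N →
      VanishesNear (cob φ) p → VanishesNear (cob φ') p → Good p φ → Good p φ' →
      φ - φ' ∈ nullAt Γ p N)
    (hadd : ∀ p ∈ Γ, ∀ φ φ' : Cochain X G N, Good p φ → φ' - φ ∈ nullAt Γ p N → Good p φ')
    (hloc : ∀ p₀ ∈ Γ, ∃ φ ∈ suppAt Γ p₀ N, VanishesNear (cob φ) p₀ ∧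
      ∀ᶠ p in 𝓝 p₀, p ∈ Γ → Good p φ) :
    ∃ τ ∈ vanishing Γᶜ N, (∀ z, VanishesNear (cob τ) z) ∧ ∀ p ∈ Γ, Good p τ := by
  suffices h : ∃ L, IsCompact L ∧ Γ ⊆ L ∧ L ⊆ Γ ∧ ∃ τ ∈ vanishing Γᶜ N,
      ∀ p ∈ L, VanishesNear (cob τ) p ∧ Good p τ by
    obtain ⟨L, -, hΓL, -, τ, hτ, h⟩ := h
    refine ⟨τ, hτ, fun z => ?_, fun p hp => (h p (hΓL hp)).2⟩
    by_cases hz : z ∈ Γ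
    · exact (h z (hΓL hz)).1
    · exact (hτ z hz).cob
  refine IsCompact.induction_on (p := fun t => ∃ L, IsCompact L ∧ t ⊆ L ∧ L ⊆ Γ ∧
      ∃ τ ∈ vanishing Γᶜ N, ∀ p ∈ L, VanishesNear (cob τ) p ∧ Good p τ) hΓ
    ⟨∅, isCompact_empty, subset_rfl, Set.empty_subset _, 0, zero_mem _,
      fun x hx => absurd hx (Set.notMem_empty x)⟩
    (fun s t hst ⟨L, h1, h2, h3⟩ => ⟨L, h1, hst.trans h2, h3⟩) ?_ ?_
  · rintro s t ⟨L₁, hL₁, hs, hLK₁, τ₁, hτ₁, h₁⟩ ⟨L₂, hL₂, ht, hLK₂, τ₂, hτ₂, h₂⟩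
    have hnull : ∀ p ∈ L₁ ∩ L₂, τ₁ - τ₂ ∈ nullAt Γ p N := fun p hp =>
      hsub p (hLK₁ hp.1) _ _ (suppAt_of_vanishing hτ₁ p) (suppAt_of_vanishing hτ₂ p)
        (h₁ p hp.1).1 (h₂ p hp.2).1 (h₁ p hp.1).2 (h₂ p hp.2).2
    -- Normalized sections differ on the overlap by a locally null cocycle, which is therefore
    -- exact. The correction `t'` is null at every point, so it does not affect `Good`.
    obtain ⟨t', ht', htΓ, htn, htv⟩ := exists_exact_of_mem_exactOn (mem_exactOn_of_nullAt hvan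
      le_rfl (hL₁.inter hL₂) (fun p hp => hLK₁ hp.1) hnull)
    obtain ⟨τ, h1, h2, h3⟩ := exists_glue hL₁ hL₂ (φ₁ := τ₁) (φ₂ := τ₂ + t')
      (by simpa [sub_sub] using htv)
    refine ⟨L₁ ∪ L₂, hL₁.union hL₂, Set.union_subset_union hs ht, Set.union_subset hLK₁ hLK₂,
      τ, fun z hz => h3 z (hτ₁ z hz) ((hτ₂ z hz).add (htΓ z hz)), ?_⟩
    rintro x (hx | hx)
    · refine ⟨?_, hadd x (hLK₁ hx) τ₁ τ (h₁ x hx).2 (mem_nullAt_of_vanishesNear (h1 x hx))⟩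
      have := (h₁ x hx).1.add (h1 x hx).cob
      rw [map_sub] at this
      simpa using this
    · refine ⟨?_, hadd x (hLK₂ hx) τ₂ τ (h₂ x hx).2 ?_⟩
      · have := (h₂ x hx).1.add (h2 x hx).cob
        rw [map_sub, map_add, ht', add_zero] at this
        simpa using this
      · have := add_mem (htn x) (mem_nullAt_of_vanishesNear (h2 x hx))
        rwa [show t' + (τ - (τ₂ + t')) = τ - τ₂ by abel] at this
  · intro x hx
    obtain ⟨φ, hφ, hv, hg⟩ := hloc x hx
    obtain ⟨L, hLx, hLO, hL⟩ := local_compact_nhds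
      (Filter.inter_mem (suppAt_eventually hφ) (Filter.inter_mem hv.eventually hg))
    obtain ⟨φ', h1, h2⟩ := exists_vanishing_cut (hL.inter_right hΓ.isClosed)
      (φ := φ) (Γ := Γ) fun p hp => (hLO hp.1).1
    refine ⟨L ∩ Γ, mem_nhdsWithin.2 ?_, L ∩ Γ, hL.inter_right hΓ.isClosed, subset_rfl,
      Set.inter_subset_right, φ', h2, fun z hz => ⟨?_, ?_⟩⟩
    · obtain ⟨O, hO, hOo, hxO⟩ := mem_nhds_iff.1 hLx
      exact ⟨O, hOo, hxO, Set.inter_subset_inter_left _ hO⟩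
    · have := (hLO hz.1).2.1.add (h1 z hz).cob
      rw [map_sub] at this
      simpa using this
    · exact hadd z hz.2 φ φ' ((hLO hz.1).2.2 hz.2) (mem_nullAt_of_vanishesNear (h1 z hz))

end Glue

/-! ### Linear maps of positive determinant fix the local class. -/

section Orientation

/-- The `l`-th coordinate of `ℝ ^ m`, or zero if there is none. -/
noncomputable def coordL (m l : ℕ) : (Fin m → ℝ) →L[ℝ] ℝ :=
  if h : l < m then ContinuousLinearMap.proj ⟨l, h⟩ else 0

theorem coordL_of_lt {m l : ℕ} (h : l < m) (x : Fin m → ℝ) : coordL m l x = x ⟨l, h⟩ := by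
  simp [coordL, h]

theorem coordL_eq_zero_iff {m : ℕ} {x : Fin m → ℝ} : (∀ l < m, coordL m l x = 0) ↔ x = 0 := by
  refine ⟨fun h => ?_, fun h l _ => by simp [h]⟩
  funext i
  have := h i i.2
  rwa [coordL_of_lt i.2] at this

variable {X : Type*} [TopologicalSpace X]

/-- A system of functions given by a germ of a homeomorphism to a finite-dimensional space. -/
theorem flat_point {E : Type} [NormedAddCommGroup E] [NormedSpace ℝ E] [ProperSpace E] {m : ℕ}
    (e : E ≃L[ℝ] (Fin m → ℝ)) {p : X} {κ : X → E} {κ' : E → X}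
    (h1 : ∀ᶠ z in 𝓝 p, ContinuousAt κ z) (h2 : ∀ᶠ w in 𝓝 (κ p), ContinuousAt κ' w)
    (h3 : ∀ᶠ z in 𝓝 p, κ' (κ z) = z) (h4 : ∀ᶠ w in 𝓝 (κ p), κ (κ' w) = w) (h0 : κ p = 0) :
    Flat {p} p m fun l z => coordL m l (e (κ z)) := by
  refine ⟨E, inferInstance, inferInstance, inferInstance, κ, κ',
    fun l => (coordL m l).comp (e : E →L[ℝ] (Fin m → ℝ)),
    fun l => e.symm (fun i => if (i : ℕ) = l then 1 else 0), rfl, h1, h2, h3, h4,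
    Filter.Eventually.of_forall fun _ _ _ => rfl, ?_, ?_, ?_⟩
  · filter_upwards [h3] with z hz
    rw [coordL_eq_zero_iff, map_eq_zero_iff e e.injective, Set.mem_singleton_iff]
    constructor
    · rintro rfl; exact h0
    · intro h
      rw [← hz, h, ← h0, h3.self_of_nhds]
  · intro l hl
    simp [coordL_of_lt hl]
  · intro l hl i hi
    simp [coordL_of_lt (hi.trans hl), hi.ne]

theorem flat_linear {E : Type} [NormedAddCommGroup E] [NormedSpace ℝ E] [ProperSpace E] {m : ℕ}
    (e : E ≃L[ℝ] (Fin m → ℝ)) : Flat {(0 : E)} 0 m fun l z => coordL m l (e z) :=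
  flat_point e (κ := id) (κ' := id) (Filter.Eventually.of_forall fun _ => continuousAt_id)
    (Filter.Eventually.of_forall fun _ => continuousAt_id) (Filter.Eventually.of_forall fun _ => rfl)
    (Filter.Eventually.of_forall fun _ => rfl) rfl

/-- The straight line homotopy between two continuous self-maps of `ℝ ^ m` which do not vanish
away from the origin. -/
theorem segment_mem_nullAt {m : ℕ} {S T : (Fin m → ℝ) → Fin m → ℝ} (hS : Continuous S)
    (hT : Continuous T)
    (h : ∀ t ∈ Set.Icc (0 : ℝ) 1, ∀ x, (1 - t) • S x + t • T x = 0 → x = 0) :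
    omega (fun l x => coordL m l (S x)) m - omega (fun l x => coordL m l (T x)) m ∈
      nullAt {(0 : Fin m → ℝ)} 0 m := by
  have hU : IsOpen (Set.univ : Set (ℝ × (Fin m → ℝ))) := isOpen_univ
  have key := (flat_linear (ContinuousLinearEquiv.refl ℝ (Fin m → ℝ))).homotopy
    (H := fun t l x => coordL m l ((1 - Set.projIcc (0 : ℝ) 1 zero_le_one t : ℝ) • S x +
      (Set.projIcc (0 : ℝ) 1 zero_le_one t : ℝ) • T x)) ?_ ?_
  · simpa using key
  · refine fun t _ => Filter.Eventually.of_forall fun a l _ => Continuous.continuousAt ?_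
    have : Continuous (Set.projIcc (0 : ℝ) 1 zero_le_one) := continuous_projIcc
    fun_prop
  · refine fun t _ => Filter.Eventually.of_forall fun a ha => ?_
    exact h _ (Set.projIcc (0 : ℝ) 1 zero_le_one a.1).2 _ (coordL_eq_zero_iff.1 ha)

/-- The linear map of a matrix preserves the orientation class. -/
def PreservesOrientation {m : ℕ} (A : Matrix (Fin m) (Fin m) ℝ) : Prop :=
  omega (fun l x => coordL m l (A.mulVec x)) m - omega (fun l x => coordL m l x) m ∈
    nullAt {(0 : Fin m → ℝ)} 0 m

theorem PreservesOrientation.mul {m : ℕ} {A B : Matrix (Fin m) (Fin m) ℝ}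
    (hA : PreservesOrientation A) (hB : PreservesOrientation B) (hdet : B.det ≠ 0) :
    PreservesOrientation (A * B) := by
  have hc : Continuous fun x => B.mulVec x := continuous_const.matrix_mulVec continuous_id
  have h1 := nullAt_pb (f := fun x => B.mulVec x) (p := 0) (Γ := {(0 : Fin m → ℝ)})
    (Γ' := {(0 : Fin m → ℝ)}) (Filter.Eventually.of_forall fun x => hc.continuousAt)
    (Filter.Eventually.of_forall fun x hx => Matrix.eq_zero_of_mulVec_eq_zero hdet hx)
    (by rw [Matrix.mulVec_zero]; exact hA)
  have e : pb (fun x => B.mulVec x) (omega (fun l x => coordL m l (A.mulVec x)) m -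
      omega (fun l x => coordL m l x) m) =
      omega (fun l x => coordL m l ((A * B).mulVec x)) m -
        omega (fun l x => coordL m l (B.mulVec x)) m := by
    have h2 := pb_omega (fun x => B.mulVec x) (fun l x => coordL m l (A.mulVec x)) m
    have h3 := pb_omega (fun x => B.mulVec x) (fun l x => coordL m l x) m
    rw [← h3]
    simp only [← Matrix.mulVec_mulVec]
    rw [← h2]
    rfl
  rw [e] at h1
  have := add_mem h1 hB
  rwa [sub_add_sub_cancel] at this

theorem preservesOrientation_of_segment {m : ℕ} {A : Matrix (Fin m) (Fin m) ℝ}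
    (h : ∀ t ∈ Set.Icc (0 : ℝ) 1, ∀ x, (1 - t) • A.mulVec x + t • x = 0 → x = 0) :
    PreservesOrientation A :=
  segment_mem_nullAt (continuous_const.matrix_mulVec continuous_id) continuous_id h

theorem preservesOrientation_one {m : ℕ} : PreservesOrientation (1 : Matrix (Fin m) (Fin m) ℝ) := by
  simp only [PreservesOrientation, Matrix.one_mulVec, sub_self]
  exact zero_mem _

theorem preservesOrientation_diagonal {m : ℕ} {D : Fin m → ℝ} (hD : ∀ i, 0 < D i) :
    PreservesOrientation (Matrix.diagonal D) := by
  refine preservesOrientation_of_segment fun t ht x hx => funext fun i => ?_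
  have := congrFun hx i
  simp only [Pi.add_apply, Pi.smul_apply, Matrix.mulVec_diagonal, smul_eq_mul,
    Pi.zero_apply] at this
  have h1 : 0 < (1 - t) * D i + t := by
    rcases ht.1.eq_or_lt with rfl | h0
    · simpa using hD i
    · have := mul_nonneg (sub_nonneg.2 ht.2) (hD i).le
      linarith
  have h2 : ((1 - t) * D i + t) * x i = 0 := by linarith
  exact (mul_eq_zero.1 h2).resolve_left h1.ne'

theorem preservesOrientation_transvection {m : ℕ} {i j : Fin m} (hij : i ≠ j) (a : ℝ) :
    PreservesOrientation (Matrix.transvection i j a) := by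
  refine preservesOrientation_of_segment fun t ht x hx => ?_
  have h0 : ∀ l, (1 - t) * (x l + if l = i then a * x j else 0) + t * x l = 0 := by
    intro l
    have := congrFun hx l
    simp only [Matrix.transvection, Matrix.add_mulVec, Matrix.one_mulVec, Pi.add_apply,
      Pi.smul_apply, smul_eq_mul, Pi.zero_apply] at this
    convert this using 4
    rw [Matrix.single_mulVec]
    by_cases h : l = i
    · subst h; simp
    · simp [h]
  -- A transvection leaves coordinate `j` unchanged, so that coordinate vanishes first; then the
  -- shear term drops out of the others.
  have hj : x j = 0 := by
    have := h0 j
    rw [if_neg hij.symm] at this; linarith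
  funext l
  have := h0 l
  rw [hj] at this
  simp only [mul_zero, ite_self, add_zero] at this
  simp only [Pi.zero_apply]; linarith

/-- The segment from `diag(c, c⁻¹)` to the quarter turn has determinant `(1 - t)² + t²`, which never
vanishes, whatever the sign of `c`. -/
theorem eq_zero_of_rotation {t c a b : ℝ} (hc : c ≠ 0)
    (h1 : (1 - t) * (c * a) + t * (-b) = 0) (h2 : (1 - t) * (c⁻¹ * b) + t * a = 0) :
    a = 0 ∧ b = 0 := by
  have hp : 0 < (1 - t) ^ 2 + t ^ 2 := by nlinarith [sq_nonneg (1 - 2 * t)]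
  have hcc : c * c⁻¹ = 1 := mul_inv_cancel₀ hc
  have e1 : ((1 - t) ^ 2 + t ^ 2) * a = 0 := by
    linear_combination (1 - t) * c⁻¹ * h1 + t * h2 - (1 - t) ^ 2 * a * hcc
  have e2 : ((1 - t) ^ 2 + t ^ 2) * b = 0 := by
    linear_combination (1 - t) * c * h2 - t * h1 - (1 - t) ^ 2 * b * hcc
  exact ⟨(mul_eq_zero.1 e1).resolve_left hp.ne', (mul_eq_zero.1 e2).resolve_left hp.ne'⟩

/-- For negative `c` the segment to the identity passes through singular matrices. The quarter turn
`J` in the plane of `i` and `j` serves as an intermediate point, joined by segments to both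
matrices. -/
theorem preservesOrientation_diag2n {m : ℕ} {i j : Fin m} (hij : i ≠ j) {c : ℝ} (hc : c ≠ 0) :
    PreservesOrientation (Matrix.SpecialLinearGroup.diag2n hij c hc).1 := by
  let J : (Fin m → ℝ) → Fin m → ℝ := fun x k => if k = i then - x j else if k = j then x i else x k
  have hJ : Continuous J := by
    refine continuous_pi fun k => ?_
    simp only [J]
    split_ifs <;> fun_prop
  have hD : ∀ x, (Matrix.SpecialLinearGroup.diag2n hij c hc).1.mulVec x =
      fun k => (if k = i then c else if k = j then c⁻¹ else 1) * x k := by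
    intro x
    rw [Matrix.SpecialLinearGroup.diag2n_coe]
    funext k
    rw [Matrix.mulVec_diagonal]
  have key : ∀ d : ℝ, d ≠ 0 → ∀ t ∈ Set.Icc (0 : ℝ) 1, ∀ x : Fin m → ℝ,
      (1 - t) • (fun k => (if k = i then d else if k = j then d⁻¹ else 1) * x k) + t • J x = 0 →
      x = 0 := by
    intro d hd t ht x hx
    have hi := congrFun hx i
    have hj := congrFun hx j
    simp only [Pi.add_apply, Pi.smul_apply, smul_eq_mul, if_true, if_neg hij.symm, J,
      Pi.zero_apply] at hi hj
    obtain ⟨h1, h2⟩ := eq_zero_of_rotation hd hi hj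
    funext k
    by_cases hki : k = i
    · rw [hki]; exact h1
    by_cases hkj : k = j
    · rw [hkj]; exact h2
    have := congrFun hx k
    simp only [Pi.add_apply, Pi.smul_apply, smul_eq_mul, if_neg hki, if_neg hkj, J,
      Pi.zero_apply] at this
    simp only [Pi.zero_apply]; linarith
  have h1 := segment_mem_nullAt (S := fun x => (Matrix.SpecialLinearGroup.diag2n hij c hc).1.mulVec x)
    (T := J) (continuous_const.matrix_mulVec continuous_id) hJ
    (fun t ht x hx => key c hc t ht x (by rwa [hD] at hx))
  have h2 := segment_mem_nullAt (S := id) (T := J) continuous_id hJ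
    (fun t ht x hx => key 1 one_ne_zero t ht x (by
      convert hx using 3; funext k; simp))
  have := sub_mem h1 h2
  rwa [sub_sub_sub_cancel_right] at this

/-- After splitting off a positive diagonal matrix carrying the determinant, the remaining factor
lies in the special linear group, generated by transvections and matrices `diag(c, c⁻¹)` in
coordinate planes. -/
theorem preservesOrientation_of_det_pos {m : ℕ} {A : Matrix (Fin m) (Fin m) ℝ}
    (hA : 0 < A.det) : PreservesOrientation A := by
  have hSL : ∀ B : Matrix.SpecialLinearGroup (Fin m) ℝ, PreservesOrientation B.1 := by
    intro B
    rcases subsingleton_or_nontrivial (Fin m) with h | h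
    · rw [Subsingleton.elim B 1]; exact preservesOrientation_one
    · exact Matrix.SpecialLinearGroup.diagonal_transvection_induction'
        (fun B => PreservesOrientation B.1) B
        (fun i j hij c hc => preservesOrientation_diag2n hij hc)
        (fun i j hij a => preservesOrientation_transvection hij a)
        (fun A B hA hB => hA.mul hB (by rw [B.2]; exact one_ne_zero))
  rcases Nat.eq_zero_or_pos m with rfl | hm
  · have : A = 1 := by ext i; exact i.elim0
    rw [this]; exact preservesOrientation_one
  let i₀ : Fin m := ⟨0, hm⟩
  let D : Fin m → ℝ := Function.update 1 i₀ A.det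
  have hDpos : ∀ i, 0 < D i := by
    intro i
    by_cases h : i = i₀
    · rw [h]; simpa [D] using hA
    · simp [D, h]
  have hDdet : (Matrix.diagonal D).det = A.det := by
    rw [Matrix.det_diagonal]
    simp [D, Finset.prod_update_of_mem]
  let B : Matrix.SpecialLinearGroup (Fin m) ℝ := ⟨A * Matrix.diagonal fun i => (D i)⁻¹, by
    have : (Matrix.diagonal fun i => (D i)⁻¹).det = A.det⁻¹ := by
      rw [Matrix.det_diagonal, Finset.prod_inv_distrib, ← Matrix.det_diagonal, hDdet]
    rw [Matrix.det_mul, this, mul_inv_cancel₀ hA.ne']⟩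
  have e : A = B.1 * Matrix.diagonal D := by
    show A = A * Matrix.diagonal (fun i => (D i)⁻¹) * Matrix.diagonal D
    rw [Matrix.mul_assoc, Matrix.diagonal_mul_diagonal]
    have : (fun i => (D i)⁻¹ * D i) = 1 := funext fun i => inv_mul_cancel₀ (hDpos i).ne'
    rw [this]
    simp
  rw [e]
  exact (hSL B).mul (preservesOrientation_diagonal hDpos) (by rw [hDdet]; exact hA.ne')

/-- Linear automorphisms of positive determinant preserve the local orientation class. -/
theorem omega_comp_linear_mem_nullAt {E : Type} [NormedAddCommGroup E] [NormedSpace ℝ E]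
    {m : ℕ} (e : E ≃L[ℝ] (Fin m → ℝ)) {T : E →L[ℝ] E} (hT : 0 < T.det) :
    omega (fun l x => coordL m l (e (T x))) m - omega (fun l x => coordL m l (e x)) m ∈
      nullAt {(0 : E)} 0 m := by
  let T' : (Fin m → ℝ) →ₗ[ℝ] (Fin m → ℝ) :=
    (e.toLinearEquiv : E →ₗ[ℝ] _) ∘ₗ (T : E →ₗ[ℝ] E) ∘ₗ (e.toLinearEquiv.symm : _ →ₗ[ℝ] E)
  have hdet : 0 < (LinearMap.toMatrix' T').det := by
    rw [LinearMap.det_toMatrix', LinearMap.det_conj]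
    exact hT
  have h := preservesOrientation_of_det_pos hdet
  have h1 := nullAt_pb (f := fun x => e x) (p := (0 : E)) (Γ := {(0 : E)})
    (Γ' := {(0 : Fin m → ℝ)}) (Filter.Eventually.of_forall fun x => e.continuous.continuousAt)
    (Filter.Eventually.of_forall fun x hx => (map_eq_zero_iff e e.injective).1 hx)
    (by rw [map_zero]; exact h)
  have h2 := pb_omega (fun x => e x) (fun l x => coordL m l ((LinearMap.toMatrix' T').mulVec x)) m
  have h3 := pb_omega (fun x => e x) (fun l x => coordL m l x) m
  have e1 : ∀ x, (LinearMap.toMatrix' T').mulVec (e x) = e (T x) := by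
    intro x
    rw [LinearMap.toMatrix'_mulVec]
    simp [T']
  simp only [e1] at h2
  rw [← h2, ← h3]
  exact h1

end Orientation

/-! ### Injectivity of suspension with compact supports. -/

section Desuspension

variable {X Y Z G : Type*} [AddCommGroup G] [TopologicalSpace X] [TopologicalSpace Y]
  [TopologicalSpace Z] {k : ℕ}

theorem iter_congr (b : Cochain X G k) {θ η : ℕ → X → ℝ} {n : ℕ}
    (h : ∀ l < n, θ l = η l) : iter b θ n = iter b η n := by
  induction n with
  | zero => rfl
  | succ n ih => rw [iter, iter, ih fun l hl => h l (by omega), h n (by omega)]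

theorem compactSupp_pb {f : X → Y} (hf : IsProperMap f) {φ : Cochain Y G k}
    (h : φ ∈ compactSupp Y G k) : pb f φ ∈ compactSupp X G k :=
  cochainPullback_mem_compactlySupported ℤ G hf h

theorem vanishesNear_of_notMem {C : Set X} (hC : IsClosed C) {φ : Cochain X G k}
    (h : ∀ s : Fin (k + 1) → X, (∀ i, s i ∉ C) → φ s = 0) {x : X} (hx : x ∉ C) :
    VanishesNear φ x :=
  ⟨Cᶜ, hC.isOpen_compl.mem_nhds hx, h⟩

/-- If ψ is a primitive of the suspension, then `H φ - ψ` is a cocycle on `Z × ℝ` equal to `φ` on a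
high slice and to zero on a low one. Moving the slice is a homotopy with compact supports, so `φ` is
exact. -/
theorem mem_exactOn_of_step [T2Space Z] {φ : Cochain Z G k} (hφ : φ ∈ compactSupp Z G k)
    (hc : ∀ z, VanishesNear (cob φ) z)
    (h : step (heaviside Prod.snd) (pb (Prod.fst : Z × ℝ → Z) φ) ∈
      exactOn (compactSupp (Z × ℝ) G) Set.univ (k + 1)) :
    φ ∈ exactOn (compactSupp Z G) Set.univ k := by
  obtain ⟨ψ, ⟨L, hL, hψ⟩, hv⟩ := mem_exactOn_succ.1 h
  obtain ⟨K, hK, hφK⟩ := hφ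
  obtain ⟨R, hR⟩ := (hL.image continuous_snd).isBounded.subset_closedBall (0 : ℝ)
  have hRL : ∀ p ∈ L, |p.2| ≤ R := fun p hp => by
    simpa using hR (Set.mem_image_of_mem _ hp)
  set μ : Cochain (Z × ℝ) G k := cut (heaviside Prod.snd) (pb Prod.fst φ) - ψ with hμ
  have hcμ : ∀ p, VanishesNear (cob μ) p := fun p => by
    have : cob μ = (step (heaviside Prod.snd) (pb Prod.fst φ) - cob ψ) +
        cut (heaviside Prod.snd) (pb (Prod.fst : Z × ℝ → Z) (cob φ)) := by
      rw [hμ, map_sub, cob_cut, cob_pb]; abel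
    rw [this]
    exact (hv p trivial).add (((hc _).pb continuous_fst.continuousAt).cut _)
  -- The slices at heights `|R| + 1` and `-(|R| + 1)` miss the support `L` of ψ. The set `K` and the
  -- projection of `L` bound the supports at all heights.
  have key := homotopy_exactOn_compactSupp (Z := Z) (h := fun t z => (z, t)) (by fun_prop) hcμ
    (C := Prod.fst ⁻¹' K ∪ L) (fun s hs => by
      have h1 : pb (Prod.fst : Z × ℝ → Z) φ s = 0 := hφK _ fun i hi => hs i (Or.inl hi)
      simp [hμ, cut, h1, hψ s fun i hi => hs i (Or.inr hi)])
    (fun t => ⟨K ∪ Prod.fst '' L, hK.union (hL.image continuous_fst),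
      Filter.Eventually.of_forall fun t' z hz => hz.imp id fun hz => ⟨_, hz, rfl⟩⟩)
    (|R| + 1) (-(|R| + 1))
  have hR' := le_abs_self R
  have hR0 := abs_nonneg R
  convert key using 1
  funext s
  have e1 : ψ (fun i => (s i, |R| + 1)) = 0 := hψ _ fun i hi => by
    have := (le_abs_self _).trans (hRL _ hi); simp only at this; linarith
  have e2 : ψ (fun i => (s i, -(|R| + 1))) = 0 := hψ _ fun i hi => by
    have := (neg_le_abs _).trans (hRL _ hi); simp only at this; linarith
  have h1 : (0 : ℝ) ≤ |R| + 1 := by linarith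
  have h2 : ¬ (0 : ℝ) ≤ -(|R| + 1) := by linarith
  simp only [pb, hμ, Pi.sub_apply, cut, heaviside, e1, e2, if_pos h1, if_neg h2]
  simp

/-- Appending a coordinate. -/
def snocHomeomorph (Y : Type*) [TopologicalSpace Y] (n : ℕ) :
    (Y × (Fin n → ℝ)) × ℝ ≃ₜ Y × (Fin (n + 1) → ℝ) where
  toFun p := (p.1.1, Fin.snoc p.1.2 p.2)
  invFun q := ((q.1, Fin.init q.2), q.2 (Fin.last n))
  left_inv p := by simp
  right_inv q := by simp
  continuous_toFun := by
    refine continuous_fst.fst.prodMk (continuous_pi fun i => ?_)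
    refine Fin.lastCases ?_ (fun i => ?_) i
    · simpa using continuous_snd
    · simpa only [Fin.snoc_castSucc] using
        show Continuous fun p : (Y × (Fin n → ℝ)) × ℝ => p.1.2 i by fun_prop
  continuous_invFun := by
    refine (continuous_fst.prodMk (continuous_pi fun i => ?_)).prodMk
      ((continuous_apply _).comp continuous_snd)
    exact (continuous_apply i.castSucc).comp continuous_snd

/-- The standard coordinates on the second factor. -/
noncomputable def sndCoord (Y : Type*) (n : ℕ) : ℕ → Y × (Fin n → ℝ) → ℝ :=
  fun l p => coordL n l p.2

theorem continuous_sndCoord (n l : ℕ) : Continuous (sndCoord Y n l) :=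
  (coordL n l).continuous.comp continuous_snd

theorem vanishesNear_iter_sndCoord {b : Cochain Y G k} {n : ℕ} {p : Y × (Fin n → ℝ)}
    (h : p.2 = 0 → VanishesNear b p.1) :
    VanishesNear (iter (pb Prod.fst b) (sndCoord Y n) n) p := by
  by_cases h0 : p.2 = 0
  · exact ((h h0).pb continuous_fst.continuousAt).iter _ _
  · refine vanishesNear_iter (fun l _ => (continuous_sndCoord n l).continuousAt) ?_
    by_contra! h1
    exact h0 (coordL_eq_zero_iff.1 h1)

variable [T2Space Y] [LocallyCompactSpace Y]

/-- The germ of the product has compact support, but its values far from the diagonal need not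
vanish; cutting off gives a representative that is literally compactly supported. -/
theorem exists_compactSupp_iter {b : Cochain Y G k} (hb : b ∈ compactSupp Y G k) (n : ℕ) :
    ∃ φ ∈ compactSupp (Y × (Fin n → ℝ)) G (k + n),
      ∀ p, VanishesNear (φ - iter (pb Prod.fst b) (sndCoord Y n) n) p := by
  obtain ⟨K, hK, hbK⟩ := hb
  obtain ⟨φ, h1, h2, -, h3⟩ := exists_cut (hK.prod (isCompact_singleton (x := (0 : Fin n → ℝ))))
    isOpen_univ (Set.subset_univ _) (iter (pb Prod.fst b) (sndCoord Y n) n)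
  refine ⟨φ, h3, fun p => ?_⟩
  by_cases hp : p ∈ K ×ˢ {(0 : Fin n → ℝ)}
  · exact h1 p hp
  · have : VanishesNear (iter (pb Prod.fst b) (sndCoord Y n) n) p :=
      vanishesNear_iter_sndCoord fun h0 =>
        vanishesNear_of_notMem hK.isClosed hbK fun hpK => hp ⟨hpK, h0⟩
    exact (h2 p this).sub this

/-- The suspension isomorphism is injective. -/
theorem mem_exactOn_of_iter {n : ℕ} {b : Cochain Y G k} (hb : b ∈ compactSupp Y G k)
    (hc : ∀ y, VanishesNear (cob b) y)
    (h : iter (pb Prod.fst b) (sndCoord Y n) n ∈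
      exactOn (compactSupp (Y × (Fin n → ℝ)) G) Set.univ (k + n)) :
    b ∈ exactOn (compactSupp Y G) Set.univ k := by
  induction n with
  | zero =>
    have := exactOn_pb (P := compactSupp Y G) (K := Set.univ) (L := Set.univ)
      (fun j ψ hψ => compactSupp_pb (Homeomorph.prodUnique Y (Fin 0 → ℝ)).symm.isProperMap hψ)
      (fun _ _ => trivial)
      (fun x _ => (Homeomorph.prodUnique Y (Fin 0 → ℝ)).symm.continuous.continuousAt) h
    exact this
  | succ n ih =>
    refine ih ?_
    obtain ⟨φ, hφ, hv⟩ := exists_compactSupp_iter hb n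
    have h1 := exactOn_pb (P := compactSupp ((Y × (Fin n → ℝ)) × ℝ) G) (K := Set.univ)
      (L := Set.univ)
      (fun j ψ hψ => compactSupp_pb (snocHomeomorph Y n).isProperMap hψ)
      (fun _ _ => trivial) (fun x _ => (snocHomeomorph Y n).continuous.continuousAt) h
    -- The factor of the last coordinate is outermost in the product, so splitting off that
    -- coordinate gives a suspension in one variable.
    have h2 : pb (snocHomeomorph Y n) (iter (pb Prod.fst b) (sndCoord Y (n + 1)) (n + 1)) =
        step (heaviside Prod.snd)
          (pb (Prod.fst : (Y × (Fin n → ℝ)) × ℝ → _)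
            (iter (pb Prod.fst b) (sndCoord Y n) n)) := by
      rw [pb_iter, iter, pb_iter]
      refine congrArg₂ step ?_ (iter_congr _ fun l hl => ?_)
      · funext p
        simp [sndCoord, coordL_of_lt, snocHomeomorph, Fin.snoc]
      · funext p
        simp [sndCoord, coordL_of_lt, hl, Nat.lt_succ_of_lt hl, snocHomeomorph, Fin.snoc]
    rw [h2] at h1
    have h3 : φ ∈ exactOn (compactSupp (Y × (Fin n → ℝ)) G) Set.univ (k + n) := by
      refine mem_exactOn_of_step hφ (fun z => ?_) (mem_exactOn_congr h1 fun p _ => ?_)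
      · have := (hv z).cob.add (vanishesNear_cob_iter
          (b := pb Prod.fst b) (x := z) ((hc z.1).pb continuous_fst.continuousAt)
            (sndCoord Y n) n)
        rwa [map_sub, sub_add_cancel] at this
      · rw [← step_sub]
        exact ((hv p.1).pb continuous_fst.continuousAt).step _
    exact mem_exactOn_congr h3 fun p _ => by
      have := (hv p).neg
      rwa [neg_sub] at this

end Desuspension

theorem pb_sub {X Y G : Type*} [AddCommGroup G] {k : ℕ} (f : X → Y) (φ ψ : Cochain Y G k) :
    pb f (φ - ψ) = pb f φ - pb f ψ := rfl

/-! ### Local orientation classes and changes of charts. -/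

section Charts

variable {X : Type*} [TopologicalSpace X] {n : ℕ}

/-- The vector-valued coordinates `e - e x` of a chart. -/
noncomputable def chartVec (e : OpenPartialHomeomorph X (EuclideanSpace ℝ (Fin n))) (x z : X) :
    Fin n → ℝ :=
  EuclideanSpace.equiv (Fin n) ℝ (e z - e x)

theorem eventually_continuousAt_chart {e : OpenPartialHomeomorph X (EuclideanSpace ℝ (Fin n))}
    {x : X} (hx : x ∈ e.source) : ∀ᶠ z in 𝓝 x, ContinuousAt e z :=
  Filter.Eventually.mono (e.open_source.mem_nhds hx) fun _ hz => e.continuousAt hz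

theorem flat_chart {e : OpenPartialHomeomorph X (EuclideanSpace ℝ (Fin n))} {x : X}
    (hx : x ∈ e.source) : Flat {x} x n fun l z => coordL n l (chartVec e x z) := by
  have h := flat_point (EuclideanSpace.equiv (Fin n) ℝ) (p := x) (κ := fun z => e z - e x)
    (κ' := fun w => e.symm (w + e x))
    ((eventually_continuousAt_chart hx).mono fun z hz => hz.sub continuousAt_const) ?_ ?_ ?_ ?_
  · exact h
  · have h1 : ∀ᶠ w in 𝓝 (e x - e x), w + e x ∈ e.target :=
      (by fun_prop : ContinuousAt (fun w => w + e x) (e x - e x)).eventually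
        (by simpa using e.open_target.mem_nhds (e.map_source hx))
    filter_upwards [h1] with w hw
    exact ContinuousAt.comp (f := fun w => w + e x) (e.symm.continuousAt hw) (by fun_prop)
  · filter_upwards [e.open_source.mem_nhds hx] with z hz
    simp [e.left_inv hz]
  · have h1 : ∀ᶠ w in 𝓝 (e x - e x), w + e x ∈ e.target :=
      (by fun_prop : ContinuousAt (fun w => w + e x) (e x - e x)).eventually
        (by simpa using e.open_target.mem_nhds (e.map_source hx))
    filter_upwards [h1] with w hw
    simp [e.right_inv hw]
  · simp

/-- At a point of nondifferentiability `fderiv` takes the value zero, whose determinant is positive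
only in dimension zero, where every map is differentiable. -/
theorem differentiableAt_of_det_pos {E : Type*} [NormedAddCommGroup E] [NormedSpace ℝ E]
    [FiniteDimensional ℝ E] {T : E → E} {u : E} (h : 0 < (fderiv ℝ T u).det) :
    DifferentiableAt ℝ T u := by
  by_contra hd
  rw [fderiv_zero_of_not_differentiableAt hd] at h
  have h1 : ((0 : E →L[ℝ] E).det) = (0 : ℝ) ^ Module.finrank ℝ E := LinearMap.det_zero
  rw [h1] at h
  have h2 : Module.finrank ℝ E = 0 := by
    by_contra h2
    rw [zero_pow h2] at h
    exact lt_irrefl _ h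
  have := Module.finrank_zero_iff.1 h2
  exact hd (hasFDerivAt_of_subsingleton T u).differentiableAt

/-- Charts with positive transition Jacobians define the same local class. -/
theorem omega_chart_sub_mem_nullAt {e e' : OpenPartialHomeomorph X (EuclideanSpace ℝ (Fin n))}
    {x : X} (hx : x ∈ e.source) (hx' : x ∈ e'.source)
    (hdet : 0 < (fderiv ℝ (e.symm.trans e') (e x)).det)
    (L : EuclideanSpace ℝ (Fin n) ≃L[ℝ] (Fin n → ℝ)) :
    omega (fun l z => coordL n l (L (e' z - e' x))) n -
      omega (fun l z => coordL n l (L (e z - e x))) n ∈ nullAt {x} x n := by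
  set A := fderiv ℝ (e.symm.trans e') (e x) with hA
  have hT : HasFDerivAt (e.symm.trans e') A (e x) := (differentiableAt_of_det_pos hdet).hasFDerivAt
  have hlin : omega (fun l z => coordL n l (L (A (e z - e x)))) n -
      omega (fun l z => coordL n l (L (e z - e x))) n ∈ nullAt {x} x n := by
    have h : pb (fun z => e z - e x) (omega (fun l w => coordL n l (L (A w))) n -
        omega (fun l w => coordL n l (L w)) n) ∈ nullAt {x} x n := by
      refine nullAt_pb (Γ' := {0})
        ((eventually_continuousAt_chart hx).mono fun z hz => hz.sub continuousAt_const) ?_ ?_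
      · filter_upwards [e.open_source.mem_nhds hx] with z hz h0
        exact e.injOn hz hx (sub_eq_zero.1 h0)
      · change _ ∈ nullAt _ (e x - e x) _
        rw [sub_self]
        exact omega_comp_linear_mem_nullAt L hdet
    rwa [pb_sub, pb_omega, pb_omega] at h
  -- An invertible derivative is bounded below.
  obtain ⟨c, hc, hcA⟩ : ∃ c > (0 : ℝ), ∀ v, c * ‖v‖ ≤ ‖A v‖ := by
    set A' := A.toContinuousLinearEquivOfDetNeZero hdet.ne' with hA'
    refine ⟨(‖(A'.symm : EuclideanSpace ℝ (Fin n) →L[ℝ] EuclideanSpace ℝ (Fin n))‖ + 1)⁻¹,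
      by positivity, fun v => ?_⟩
    rw [inv_mul_le_iff₀ (by positivity)]
    have h1 : A'.symm (A v) = v := A'.symm_apply_apply v
    have h2 := (A'.symm : EuclideanSpace ℝ (Fin n) →L[ℝ] EuclideanSpace ℝ (Fin n)).le_opNorm (A v)
    rw [ContinuousLinearEquiv.coe_coe, h1] at h2
    linarith [norm_nonneg (A v)]
  have hhom : omega (fun l z => coordL n l (L (e' z - e' x))) n -
      omega (fun l z => coordL n l (L (A (e z - e x)))) n ∈ nullAt {x} x n := by
    -- The error of the linearization is at most `c / 4`, and during the homotopy its coefficient `1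
    -- - t` has absolute value below 2. The total `c / 2` is less than the lower bound `c`, so no
    -- new zeros arise.
    have hsm : ∀ᶠ z in 𝓝 x, ‖e' z - e' x - A (e z - e x)‖ ≤ c / 4 * ‖e z - e x‖ := by
      have h1 := hT.isLittleO.def (show (0 : ℝ) < c / 4 by positivity)
      have h2 := (e.continuousAt hx).eventually h1
      filter_upwards [h2, e.open_source.mem_nhds hx] with z hz hzs
      simpa [e.left_inv hzs, e.left_inv hx] using hz
    have h := (flat_chart hx).homotopy
      (H := fun t l z => coordL n l (L ((1 - t) • (e' z - e' x) + t • A (e z - e x)))) ?_ ?_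
    · simpa [chartVec] using h
    · intro t _
      have h1 : ∀ᶠ a : ℝ × X in 𝓝 (t, x), a.2 ∈ e.source ∩ e'.source :=
        continuous_snd.continuousAt.eventually
          ((e.open_source.inter e'.open_source).mem_nhds ⟨hx, hx'⟩)
      filter_upwards [h1] with a ha l _
      have h2 : ContinuousAt (fun b : ℝ × X => e b.2) a :=
        (e.continuousAt ha.1).comp continuousAt_snd
      have h3 : ContinuousAt (fun b : ℝ × X => e' b.2) a :=
        (e'.continuousAt ha.2).comp continuousAt_snd
      exact (coordL n l).continuous.continuousAt.comp (L.continuous.continuousAt.comp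
        (f := fun b : ℝ × X => (1 - b.1) • (e' b.2 - e' x) + b.1 • A (e b.2 - e x))
        (((by fun_prop : ContinuousAt (fun b : ℝ × X => 1 - b.1) a).smul
          (h3.sub continuousAt_const)).add (continuousAt_fst.smul
            (A.continuous.continuousAt.comp (h2.sub continuousAt_const)))))
    · intro t ht
      have h1 : ∀ᶠ a : ℝ × X in 𝓝 (t, x), |1 - a.1| < 2 := by
        refine ContinuousAt.eventually_lt (by fun_prop) continuousAt_const ?_
        rw [abs_lt]; constructor <;> linarith [ht.1, ht.2]
      have h2 : ∀ᶠ a : ℝ × X in 𝓝 (t, x), a.2 ∈ e.source ∧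
          ‖e' a.2 - e' x - A (e a.2 - e x)‖ ≤ c / 4 * ‖e a.2 - e x‖ :=
        (continuous_snd.tendsto (t, x)).eventually ((show ∀ᶠ z in 𝓝 x, z ∈ e.source from
          e.open_source.mem_nhds hx).and hsm)
      filter_upwards [h1, h2] with a ha ⟨has, ha'⟩ h0
      have h3 : (1 - a.1) • (e' a.2 - e' x) + a.1 • A (e a.2 - e x) = 0 := by
        exact (map_eq_zero_iff L L.injective).1 (coordL_eq_zero_iff.1 h0)
      have h4 : A (e a.2 - e x) = -((1 - a.1) • (e' a.2 - e' x - A (e a.2 - e x))) := by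
        rw [eq_neg_iff_add_eq_zero, ← h3]; module
      have h5 : c * ‖e a.2 - e x‖ ≤ 2 * (c / 4 * ‖e a.2 - e x‖) := by
        refine (hcA _).trans ?_
        rw [h4, norm_neg, norm_smul, Real.norm_eq_abs]
        exact mul_le_mul ha.le ha' (norm_nonneg _) (by norm_num)
      have h6 : ‖e a.2 - e x‖ = 0 := by
        have := norm_nonneg (e a.2 - e x)
        nlinarith
      exact e.injOn has hx (sub_eq_zero.1 (norm_eq_zero.1 h6))
  simpa using add_mem hhom hlin

end Charts

/-! ### A Euclidean embedding compatible with charts. -/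

section Embedding

variable {X : Type*} [TopologicalSpace X] {n : ℕ}

theorem exists_bump [T2Space X] [CompactSpace X] {U : Set X} (hU : IsOpen U) {x : X}
    (hx : x ∈ U) :
    ∃ (ρ : X → ℝ) (V : Set X), Continuous ρ ∧ IsOpen V ∧ x ∈ V ∧ (∀ z ∈ V, ρ z = 1) ∧
      tsupport ρ ⊆ U := by
  obtain ⟨K, hK, hxK, hKU⟩ := exists_compact_subset hU hx
  obtain ⟨ρ, h1, h2, -⟩ := exists_tsupport_one_of_isOpen_isClosed hU
    isClosed_closure.isCompact hK.isClosed hKU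
  exact ⟨ρ, interior K, ρ.continuous, isOpen_interior, hxK,
    fun z hz => h2 (interior_subset hz), h1⟩

/-- An embedding into a Euclidean space through which charts near each point factor linearly. -/
theorem exists_embedding [T2Space X] [CompactSpace X]
    {C : Set (OpenPartialHomeomorph X (EuclideanSpace ℝ (Fin n)))}
    (hC : ∀ x, ∃ e ∈ C, x ∈ e.source) :
    ∃ (D : ℕ) (F : X → Fin D → ℝ), Continuous F ∧ Function.Injective F ∧
      ∀ x, ∃ e ∈ C, ∃ V : Set X, IsOpen V ∧ x ∈ V ∧ V ⊆ e.source ∧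
        ∃ (p : (Fin D → ℝ) →L[ℝ] (Fin n → ℝ)) (i : (Fin n → ℝ) →L[ℝ] (Fin D → ℝ)),
          (∀ u, p (i u) = u) ∧ ∀ z ∈ V, p (F z) = EuclideanSpace.equiv (Fin n) ℝ (e z) := by
  classical
  choose e heC hes using hC
  choose ρ V hρ hVo hxV hρ1 hρs using fun x => exists_bump (e x).open_source (hes x)
  have hVs : ∀ x, V x ⊆ (e x).source := fun x z hz => hρs x (subset_tsupport _ (by
    simp [hρ1 x z hz]))
  obtain ⟨t, ht⟩ := isCompact_univ.elim_finite_subcover V hVo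
    (fun x _ => Set.mem_iUnion.2 ⟨x, hxV x⟩)
  have hcov : ∀ z, ∃ x : t, z ∈ V x := fun z => by simpa using ht (Set.mem_univ z)
  let L := EuclideanSpace.equiv (Fin n) ℝ
  let B := t → (Fin n → ℝ) × ℝ
  -- Each block records a cut-off chart together with its bump function. Where a bump equals 1 the
  -- block is the chart itself, and equality of bump values keeps a second point in the domain of
  -- the same chart.
  let H : X → B := fun z x => (ρ x z • L (e x z), ρ x z)
  have hH : Continuous H := by
    refine continuous_pi fun x => Continuous.prodMk ?_ (hρ x)
    refine ContinuousOn.continuous_of_tsupport_subset (s := (e x).source) ?_ (e x).open_source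
      ((tsupport_smul_subset_left _ _).trans (hρs x))
    exact (hρ x).continuousOn.smul (L.continuous.comp_continuousOn (e x).continuousOn)
  have hinj : Function.Injective H := by
    intro z z' h
    obtain ⟨x, hx⟩ := hcov z
    have h1 := congrFun h x
    simp only [H, Prod.mk.injEq, hρ1 x z hx] at h1
    have hz' : z' ∈ (e x).source := hρs x (subset_tsupport _ (by simp [← h1.2]))
    rw [← h1.2, one_smul, one_smul] at h1
    exact (e x).injOn (hVs x hx) hz' (L.injective h1.1)
  let Q : B ≃L[ℝ] (Fin (Module.finrank ℝ B) → ℝ) :=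
    ContinuousLinearEquiv.ofFinrankEq (by simp)
  refine ⟨_, fun z => Q (H z), Q.continuous.comp hH, Q.injective.comp hinj, fun z => ?_⟩
  obtain ⟨x, hx⟩ := hcov z
  refine ⟨e x, heC x, V x, hVo x, hx, hVs x,
    ((ContinuousLinearMap.fst ℝ _ _).comp (ContinuousLinearMap.proj x)).comp
      (Q.symm : (Fin (Module.finrank ℝ B) → ℝ) →L[ℝ] B),
    (Q : B →L[ℝ] _).comp ((LinearMap.toContinuousLinearMap (LinearMap.single ℝ _ x)).comp
      (ContinuousLinearMap.inl ℝ _ _)), fun u => ?_, fun z' hz' => ?_⟩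
  · simp only [ContinuousLinearMap.comp_apply, ContinuousLinearEquiv.coe_coe,
      ContinuousLinearEquiv.symm_apply_apply]
    change ((LinearMap.single ℝ (fun _ : t => (Fin n → ℝ) × ℝ) x (u, 0)) x).1 = u
    simp
  · simp only [ContinuousLinearMap.comp_apply, ContinuousLinearEquiv.coe_coe,
      ContinuousLinearEquiv.symm_apply_apply]
    change ρ x z' • L (e x z') = L (e x z')
    rw [hρ1 x z' hz', one_smul]

end Embedding

/-! ### Cup products with classes of vector-valued functions. -/

section Vector

variable {X Y G : Type*} [AddCommGroup G] [TopologicalSpace X] [TopologicalSpace Y] {k m n : ℕ}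

theorem cup_sub_left {N : ℕ} (h : k + n = N) (τ τ' : Cochain X ℤ n) (b : Cochain X G k) :
    cup h (τ - τ') b = cup h τ b - cup h τ' b := by
  funext s; simp [cup, sub_smul]

theorem cup_sub_right {N : ℕ} (h : k + n = N) (τ : Cochain X ℤ n) (b b' : Cochain X G k) :
    cup h τ (b - b') = cup h τ b - cup h τ b' := by
  funext s; simp [cup, smul_sub]

theorem cup_mem_suppAt {N : ℕ} (h : k + n = N) {Γ Γ' : Set X} {p : X} {τ : Cochain X ℤ n}
    {b : Cochain X G k} (hτ : τ ∈ suppAt Γ p n) (hb : b ∈ suppAt Γ' p k) :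
    cup h τ b ∈ suppAt (Γ ∩ Γ') p N := by
  filter_upwards [mem_suppAt.1 hτ, mem_suppAt.1 hb] with z h1 h2 hz
  by_cases hz' : z ∈ Γ
  · exact (h2 fun h' => hz ⟨hz', h'⟩).cup_right h τ
  · exact (h1 hz').cup_left h b

/-- If `τ = δψ` near `p` with ψ supported in Γ, then `ψ ∪ b` is a primitive of `τ ∪ b`, because `b`
is a cocycle near `p`; its support lies in the intersection. -/
theorem cup_mem_nullAt {N : ℕ} (h : k + n = N) {Γ Γ' : Set X} {p : X} {τ : Cochain X ℤ n}
    {b : Cochain X G k} (hτ : τ ∈ nullAt Γ p n) (hb : b ∈ suppAt Γ' p k)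
    (hc : VanishesNear (cob b) p) : cup h τ b ∈ nullAt (Γ ∩ Γ') p N := by
  cases n with
  | zero => exact mem_nullAt_of_vanishesNear ((mem_nullAt_zero.1 hτ).cup_left h b)
  | succ n =>
    subst h
    obtain ⟨ψ, hψ, hv⟩ := mem_nullAt_succ.1 hτ
    refine mem_nullAt_succ.2 ⟨cup rfl ψ b, cup_mem_suppAt rfl hψ hb, ?_⟩
    have e : cup rfl τ b - cob (cup rfl ψ b) = cup rfl (τ - cob ψ) b -
        ((-1 : ℤ) ^ n) • cup (by omega : k + 1 + n = k + n + 1) ψ (cob b) := by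
      rw [cob_cup, cup_sub_left]; abel
    rw [e]
    exact (hv.cup_left _ b).sub ((hc.cup_right _ ψ).zsmul _)

/-- The product of the steps of all coordinates of a vector-valued function. -/
noncomputable def omegaV (a : X → Fin m → ℝ) : Cochain X ℤ m :=
  omega (fun l z => coordL m l (a z)) m

/-- The cup product of `omegaV a` with `b`. -/
noncomputable def iterV (b : Cochain X G k) (a : X → Fin m → ℝ) : Cochain X G (k + m) :=
  iter b (fun l z => coordL m l (a z)) m

theorem pb_omegaV (f : X → Y) (a : Y → Fin m → ℝ) :
    pb f (omegaV a) = omegaV fun x => a (f x) := pb_omega _ _ _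

theorem pb_iterV (f : X → Y) (b : Cochain Y G k) (a : Y → Fin m → ℝ) :
    pb f (iterV b a) = iterV (pb f b) fun x => a (f x) := pb_iter _ _ _ _

theorem cob_omegaV (a : X → Fin m → ℝ) : cob (omegaV a) = 0 := cob_omega _ _

theorem cup_omegaV (a : X → Fin m → ℝ) (b : Cochain X G k) :
    cup rfl (omegaV a) b = iterV b a := cup_omega _ _ _

theorem iterV_sub (b b' : Cochain X G k) (a : X → Fin m → ℝ) :
    iterV (b - b') a = iterV b a - iterV b' a := iter_sub _ _ _ _

theorem iterV_zsmul (j : ℤ) (b : Cochain X G k) (a : X → Fin m → ℝ) :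
    iterV (j • b) a = j • iterV b a := iter_zsmul _ _ _ _

theorem vanishesNear_cob_iterV {b : Cochain X G k} {x : X} (h : VanishesNear (cob b) x)
    (a : X → Fin m → ℝ) : VanishesNear (cob (iterV b a)) x := vanishesNear_cob_iter h _ _

theorem vanishesNear_cob_omegaV (a : X → Fin m → ℝ) (x : X) :
    VanishesNear (cob (omegaV a)) x := by
  rw [cob_omegaV]; exact VanishesNear.zero x

theorem coordL_continuousAt {a : X → Fin m → ℝ} {z : X} (h : ContinuousAt a z) (l : ℕ) :
    ContinuousAt (fun z => coordL m l (a z)) z := (coordL m l).continuous.continuousAt.comp h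

theorem omegaV_mem_suppAt {a : X → Fin m → ℝ} {p : X} {Γ : Set X}
    (h : ∀ᶠ z in 𝓝 p, ContinuousAt a z) (hΓ : ∀ᶠ z in 𝓝 p, a z = 0 → z ∈ Γ) :
    omegaV a ∈ suppAt Γ p m :=
  omega_mem_suppAt (h.mono fun _ hz l _ => coordL_continuousAt hz l)
    (hΓ.mono fun _ hz h0 => hz (coordL_eq_zero_iff.1 h0))

theorem iterV_mem_suppAt {b : Cochain X G k} {a : X → Fin m → ℝ} {p : X} {Γ Γ' : Set X}
    (hb : b ∈ suppAt Γ p k) (h : ∀ᶠ z in 𝓝 p, ContinuousAt a z)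
    (hΓ : ∀ᶠ z in 𝓝 p, z ∈ Γ → a z = 0 → z ∈ Γ') : iterV b a ∈ suppAt Γ' p (k + m) :=
  iter_mem_suppAt hb (h.mono fun _ hz l _ => coordL_continuousAt hz l)
    (hΓ.mono fun _ hz h1 h0 => hz h1 (coordL_eq_zero_iff.1 h0))

theorem iterV_mem_nullAt {b : Cochain X G k} {a : X → Fin m → ℝ} {p : X} {Γ Γ' : Set X}
    (hb : b ∈ nullAt Γ p k) (h : ∀ᶠ z in 𝓝 p, ContinuousAt a z)
    (hΓ : ∀ᶠ z in 𝓝 p, z ∈ Γ → a z = 0 → z ∈ Γ') : iterV b a ∈ nullAt Γ' p (k + m) :=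
  iter_mem_nullAt hb (h.mono fun _ hz l _ => coordL_continuousAt hz l)
    (hΓ.mono fun _ hz h1 h0 => hz h1 (coordL_eq_zero_iff.1 h0))

theorem iterV_sub_mem_nullAt {b : Cochain X G k} {a a' : X → Fin m → ℝ} {p : X} {Γ Γ' Λ : Set X}
    (hb : b ∈ suppAt Γ' p k) (hc : VanishesNear (cob b) p)
    (h : omegaV a - omegaV a' ∈ nullAt Γ p m) (hΛ : Γ ∩ Γ' ⊆ Λ) :
    iterV b a - iterV b a' ∈ nullAt Λ p (k + m) := by
  rw [← cup_omegaV, ← cup_omegaV, ← cup_sub_left]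
  exact nullAt_mono (Filter.Eventually.of_forall fun z hz => hΛ hz) (cup_mem_nullAt rfl h hb hc)

/-- Concatenation of vectors. -/
noncomputable def appendL (m n : ℕ) :
    ((Fin m → ℝ) × (Fin n → ℝ)) ≃L[ℝ] (Fin (m + n) → ℝ) :=
  ((LinearEquiv.sumArrowLequivProdArrow (Fin m) (Fin n) ℝ ℝ).symm.trans
    (LinearEquiv.funCongrLeft ℝ ℝ finSumFinEquiv.symm)).toContinuousLinearEquiv

theorem coordL_appendL {m n l : ℕ} (hl : l < m + n) (a : Fin m → ℝ) (b : Fin n → ℝ) :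
    coordL (m + n) l (appendL m n (a, b)) =
      if l < m then coordL m l a else coordL n (l - m) b := by
  rw [coordL_of_lt hl]
  have e : appendL m n (a, b) ⟨l, hl⟩ = Sum.elim a b (finSumFinEquiv.symm ⟨l, hl⟩) := rfl
  rw [e]
  split_ifs with h
  · rw [coordL_of_lt h]
    have : (⟨l, hl⟩ : Fin (m + n)) = Fin.castAdd n ⟨l, h⟩ := rfl
    rw [this, finSumFinEquiv_symm_apply_castAdd]; rfl
  · have h' : l - m < n := by omega
    rw [coordL_of_lt h']
    have : (⟨l, hl⟩ : Fin (m + n)) = Fin.natAdd m ⟨l - m, h'⟩ := by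
      ext; simp; omega
    rw [this, finSumFinEquiv_symm_apply_natAdd]; rfl

theorem omega_congr {θ η : ℕ → X → ℝ} {n : ℕ} (h : ∀ l < n, θ l = η l) :
    omega θ n = omega η n := by
  induction n with
  | zero => rfl
  | succ n ih => rw [omega, omega, ih fun l hl => h l (by omega), h n (by omega)]

theorem iterV_omegaV (a : X → Fin m → ℝ) (b : X → Fin n → ℝ) :
    iterV (omegaV a) b =
      omega (fun l z => coordL (m + n) l (appendL m n (a z, b z))) (m + n) := by
  rw [iterV, omegaV, iter_omega]
  refine omega_congr fun l hl => ?_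
  funext z
  rw [coordL_appendL hl]
  split_ifs <;> rfl

/-- The straight line homotopy, or any other one, of a pair of vector-valued functions with only
common zero `p`. -/
theorem pair_homotopy {p : X} {Θ : ℕ → X → ℝ} (h : Flat {p} p (m + n) Θ)
    {H : ℝ → X → Fin m → ℝ} {K : ℝ → X → Fin n → ℝ}
    (hH : ∀ t ∈ Set.Icc (0 : ℝ) 1, ∀ᶠ a : ℝ × X in 𝓝 (t, p),
      ContinuousAt (fun b : ℝ × X => H b.1 b.2) a)
    (hK : ∀ t ∈ Set.Icc (0 : ℝ) 1, ∀ᶠ a : ℝ × X in 𝓝 (t, p),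
      ContinuousAt (fun b : ℝ × X => K b.1 b.2) a)
    (hz : ∀ t ∈ Set.Icc (0 : ℝ) 1, ∀ᶠ a : ℝ × X in 𝓝 (t, p),
      H a.1 a.2 = 0 → K a.1 a.2 = 0 → a.2 = p) :
    iterV (omegaV (H 0)) (K 0) - iterV (omegaV (H 1)) (K 1) ∈ nullAt {p} p (m + n) := by
  rw [iterV_omegaV, iterV_omegaV]
  refine h.homotopy (H := fun t l z => coordL (m + n) l (appendL m n (H t z, K t z))) ?_ ?_
  · intro t ht
    filter_upwards [hH t ht, hK t ht] with a h1 h2 l _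
    exact coordL_continuousAt ((appendL m n).continuous.continuousAt.comp (h1.prodMk h2)) l
  · intro t ht
    filter_upwards [hz t ht] with a ha h0
    have h1 := (map_eq_zero_iff _ (appendL m n).injective).1 (coordL_eq_zero_iff.1 h0)
    exact ha (congrArg Prod.fst h1) (congrArg Prod.snd h1)

theorem flat_pair {p : X} {a : X → Fin m → ℝ} {b : X → Fin n → ℝ}
    {κ : (Fin m → ℝ) × (Fin n → ℝ) → X}
    (h1 : ∀ᶠ z in 𝓝 p, ContinuousAt (fun z => (a z, b z)) z)
    (h2 : ∀ᶠ w in 𝓝 0, ContinuousAt κ w)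
    (h3 : ∀ᶠ z in 𝓝 p, κ (a z, b z) = z)
    (h4 : ∀ᶠ w in 𝓝 0, (a (κ w), b (κ w)) = w) (ha : a p = 0) (hb : b p = 0) :
    Flat {p} p (m + n) fun l z => coordL (m + n) l (appendL m n (a z, b z)) := by
  have h0 : (a p, b p) = (0 : (Fin m → ℝ) × (Fin n → ℝ)) := by rw [ha, hb]; rfl
  exact flat_point (appendL m n) (κ := fun z => (a z, b z)) h1 (by rwa [h0]) h3 (by rwa [h0]) h0

/-- A germ of a homeomorphism onto a product makes the zero set of its first component flat. -/
theorem flat_fst {F : Type} [NormedAddCommGroup F] [NormedSpace ℝ F] [ProperSpace F]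
    {Γ : Set X} {p : X} {a : X → Fin m → ℝ} {b : X → F} {κ : (Fin m → ℝ) × F → X}
    (hp : p ∈ Γ)
    (h1 : ∀ᶠ z in 𝓝 p, ContinuousAt (fun z => (a z, b z)) z)
    (h2 : ∀ᶠ w in 𝓝 (a p, b p), ContinuousAt κ w)
    (h3 : ∀ᶠ z in 𝓝 p, κ (a z, b z) = z)
    (h4 : ∀ᶠ w in 𝓝 (a p, b p), (a (κ w), b (κ w)) = w)
    (h5 : ∀ᶠ z in 𝓝 p, z ∈ Γ ↔ a z = 0) :
    Flat Γ p m fun l z => coordL m l (a z) := by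
  refine ⟨(Fin m → ℝ) × F, inferInstance, inferInstance, inferInstance, fun z => (a z, b z), κ,
    fun l => (coordL m l).comp (ContinuousLinearMap.fst ℝ _ _),
    fun l => (fun i => if (i : ℕ) = l then 1 else 0, 0), hp, h1, h2, h3, h4,
    Filter.Eventually.of_forall fun _ _ _ => rfl, ?_, ?_, ?_⟩
  · filter_upwards [h5] with z hz
    rw [hz, coordL_eq_zero_iff]
  · intro l hl
    simp [coordL_of_lt hl]
  · intro l hl i hi
    simp [coordL_of_lt (hi.trans hl), hi.ne]

end Vector

/-! ### The graph as a locally flat subset of the product. -/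

section Adapted

variable {X Y : Type*} [TopologicalSpace X] [TopologicalSpace Y] {n D : ℕ}

/-- The coordinates of a chart, as a vector. -/
noncomputable def chartFun (e : OpenPartialHomeomorph X (EuclideanSpace ℝ (Fin n))) (x : X) :
    Fin n → ℝ :=
  EuclideanSpace.equiv (Fin n) ℝ (e x)

/-- The inverse of a chart. -/
noncomputable def chartInv (e : OpenPartialHomeomorph X (EuclideanSpace ℝ (Fin n)))
    (u : Fin n → ℝ) : X :=
  e.symm ((EuclideanSpace.equiv (Fin n) ℝ).symm u)

section Chart

variable {e : OpenPartialHomeomorph X (EuclideanSpace ℝ (Fin n))} {x : X}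

theorem chartInv_chartFun (hx : x ∈ e.source) : chartInv e (chartFun e x) = x := by
  simp [chartInv, chartFun, e.left_inv hx]

theorem continuousAt_chartFun (hx : x ∈ e.source) : ContinuousAt (chartFun e) x :=
  (EuclideanSpace.equiv (Fin n) ℝ).continuous.continuousAt.comp (e.continuousAt hx)

theorem chartFun_injOn {x' : X} (hx : x ∈ e.source) (hx' : x' ∈ e.source)
    (h : chartFun e x = chartFun e x') : x = x' :=
  e.injOn hx hx' ((EuclideanSpace.equiv (Fin n) ℝ).injective h)

theorem eventually_chartInv (hx : x ∈ e.source) : ∀ᶠ u in 𝓝 (chartFun e x),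
    ContinuousAt (chartInv e) u ∧ chartInv e u ∈ e.source ∧ chartFun e (chartInv e u) = u := by
  set L := EuclideanSpace.equiv (Fin n) ℝ
  have h : ∀ᶠ u in 𝓝 (L (e x)), L.symm u ∈ e.target :=
    L.symm.continuous.continuousAt.eventually
      (by simpa using e.open_target.mem_nhds (e.map_source hx))
  filter_upwards [h] with u hu
  refine ⟨?_, e.map_target hu, ?_⟩
  · exact ContinuousAt.comp (f := L.symm) (e.symm.continuousAt hu) L.symm.continuous.continuousAt
  · change L (e (e.symm (L.symm u))) = u
    rw [e.right_inv hu, L.apply_symm_apply]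

theorem eventually_mem_source (hx : x ∈ e.source) : ∀ᶠ z in 𝓝 x, z ∈ e.source :=
  e.open_source.mem_nhds hx

end Chart

/-- Points of the graph close to `(f x, F x)` come from points of `X` close to `x`, so a single
local retraction describes the graph there. -/
theorem eventually_mem_of_isEmbedding {F : X → Y} (hF : IsEmbedding F) {x : X} {U : Set X}
    (hU : U ∈ 𝓝 x) : ∀ᶠ v in 𝓝 (F x), ∀ z, F z = v → z ∈ U := by
  rw [hF.nhds_eq_comap, Filter.mem_comap] at hU
  obtain ⟨W, hW, hWU⟩ := hU
  filter_upwards [hW] with v hv z hz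
  exact hWU (show F z ∈ W from hz ▸ hv)

/-- An embedding `F` of `X` into `ℝ ^ D`, and charts of `X` and `Y` around each point `x` of `X`
and its image `f x`, such that the chart of `X` factors near `x` through a split linear map. -/
structure Adapted (n : ℕ) (f : X → Y) (F : X → Fin D → ℝ) where
  e : X → OpenPartialHomeomorph X (EuclideanSpace ℝ (Fin n))
  c : X → OpenPartialHomeomorph Y (EuclideanSpace ℝ (Fin n))
  V : X → Set X
  P : X → (Fin D → ℝ) →L[ℝ] (Fin n → ℝ)
  I : X → (Fin n → ℝ) →L[ℝ] (Fin D → ℝ)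
  continuous_map : Continuous f
  isEmbedding : IsEmbedding F
  isOpen_V : ∀ x, IsOpen (V x)
  mem_V : ∀ x, x ∈ V x
  V_subset : ∀ x, V x ⊆ (e x).source
  P_I : ∀ x u, P x (I x u) = u
  P_F : ∀ x, ∀ z ∈ V x, P x (F z) = chartFun (e x) z
  mem_c : ∀ x, f x ∈ (c x).source
  det_e : ∀ x x' z, z ∈ (e x).source → z ∈ (e x').source →
    0 < (fderiv ℝ ((e x).symm.trans (e x')) (e x z)).det
  det_c : ∀ x x' z, z ∈ (c x).source → z ∈ (c x').source →
    0 < (fderiv ℝ ((c x).symm.trans (c x')) (c x z)).det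

namespace Adapted

variable {f : X → Y} {F : X → Fin D → ℝ} (A : Adapted n f F) {x₀ x₁ : X}

/-- A local retraction of `ℝ ^ D` onto `X`. -/
noncomputable def ret (x₀ : X) (v : Fin D → ℝ) : X := chartInv (A.e x₀) (A.P x₀ v)

theorem ret_F {z : X} (hz : z ∈ A.V x₀) : A.ret x₀ (F z) = z := by
  rw [ret, A.P_F x₀ z hz, chartInv_chartFun (A.V_subset x₀ hz)]

theorem eventually_ret (h : x₁ ∈ A.V x₀) {U : Set X} (hU : U ∈ 𝓝 x₁) : ∀ᶠ v in 𝓝 (F x₁),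
    ContinuousAt (A.ret x₀) v ∧ A.ret x₀ v ∈ A.V x₀ ∧ A.ret x₀ v ∈ U ∧
      A.P x₀ (F (A.ret x₀ v)) = A.P x₀ v := by
  have h1 : ∀ᶠ v in 𝓝 (F x₁), ContinuousAt (A.ret x₀) v ∧
      chartFun (A.e x₀) (A.ret x₀ v) = A.P x₀ v := by
    have h2 := ((A.P x₀).continuous.tendsto (F x₁)).eventually
      (by rw [A.P_F x₀ x₁ h]; exact eventually_chartInv (A.V_subset x₀ h))
    filter_upwards [h2] with v hv
    exact ⟨ContinuousAt.comp (f := A.P x₀) hv.1 (A.P x₀).continuous.continuousAt, hv.2.2⟩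
  have h3 : ∀ᶠ v in 𝓝 (F x₁), A.ret x₀ v ∈ A.V x₀ ∩ U :=
    h1.self_of_nhds.1.eventually (by
      rw [A.ret_F h]; exact Filter.inter_mem ((A.isOpen_V x₀).mem_nhds h) hU)
  filter_upwards [h1, h3] with v hv hv'
  exact ⟨hv.1, hv'.1, hv'.2, by rw [A.P_F x₀ _ hv'.1, hv.2]⟩

/-- The graph. -/
def graph (_ : Adapted n f F) : Set (Y × (Fin D → ℝ)) := Set.range fun x => (f x, F x)

/-- Defining functions of the graph near `(f x₀, F x₀)`. -/
noncomputable def defining (x₀ : X) (z : Y × (Fin D → ℝ)) : Fin D → ℝ :=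
  z.2 - F (A.ret x₀ z.2) +
    A.I x₀ (chartFun (A.c x₀) z.1 - chartFun (A.c x₀) (f (A.ret x₀ z.2)))

/-- The conditions under which `defining` behaves well. -/
structure Near (x₀ : X) (z : Y × (Fin D → ℝ)) : Prop where
  continuousAt : ContinuousAt (A.ret x₀) z.2
  mem : A.ret x₀ z.2 ∈ A.V x₀
  P_eq : A.P x₀ (F (A.ret x₀ z.2)) = A.P x₀ z.2
  mem_source : z.1 ∈ (A.c x₀).source
  map_mem_source : f (A.ret x₀ z.2) ∈ (A.c x₀).source

theorem eventually_near (h : x₁ ∈ A.V x₀) (hc : f x₁ ∈ (A.c x₀).source) :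
    ∀ᶠ z in 𝓝 (f x₁, F x₁), A.Near x₀ z := by
  have h1 := (continuous_snd.tendsto (f x₁, F x₁)).eventually (A.eventually_ret h
    (A.continuous_map.continuousAt.preimage_mem_nhds ((A.c x₀).open_source.mem_nhds hc)))
  have h2 := (continuous_fst.tendsto (f x₁, F x₁)).eventually (eventually_mem_source hc)
  filter_upwards [h1, h2] with z hz hz'
  exact ⟨hz.1, hz.2.1, hz.2.2.2, hz', hz.2.2.1⟩

variable {A}

theorem Near.continuousAt_F {z : Y × (Fin D → ℝ)} (h : A.Near x₀ z) :
    ContinuousAt (fun z : Y × (Fin D → ℝ) => F (A.ret x₀ z.2)) z :=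
  A.isEmbedding.continuous.continuousAt.comp (h.continuousAt.comp continuousAt_snd)

theorem Near.continuousAt_chart {z : Y × (Fin D → ℝ)} (h : A.Near x₀ z) :
    ContinuousAt (fun z : Y × (Fin D → ℝ) => chartFun (A.c x₀) z.1) z :=
  (continuousAt_chartFun h.mem_source).comp continuousAt_fst

theorem Near.continuousAt_chart_map {z : Y × (Fin D → ℝ)} (h : A.Near x₀ z) :
    ContinuousAt (fun z : Y × (Fin D → ℝ) => chartFun (A.c x₀) (f (A.ret x₀ z.2))) z :=
  ContinuousAt.comp (f := fun z : Y × (Fin D → ℝ) => f (A.ret x₀ z.2))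
    (continuousAt_chartFun h.map_mem_source)
    (A.continuous_map.continuousAt.comp (h.continuousAt.comp continuousAt_snd))

theorem Near.continuousAt_defining {z : Y × (Fin D → ℝ)} (h : A.Near x₀ z) :
    ContinuousAt (A.defining x₀) z :=
  (continuousAt_snd.sub h.continuousAt_F).add ((A.I x₀).continuous.continuousAt.comp
    (h.continuousAt_chart.sub h.continuousAt_chart_map))

/-- The first term of `defining` lies in the kernel of `P x₀`, the second in the image of `I x₀`.
Applying `P x₀` separates them. -/
theorem Near.P_defining {z : Y × (Fin D → ℝ)} (h : A.Near x₀ z) :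
    A.P x₀ (A.defining x₀ z) =
      chartFun (A.c x₀) z.1 - chartFun (A.c x₀) (f (A.ret x₀ z.2)) := by
  rw [defining, map_add, map_sub, h.P_eq, sub_self, zero_add, A.P_I]

/-- The component seen by `P x₀` gives `z.1 = f (ret z.2)` through the chart of `Y`; the remaining
one then gives `z.2 = F (ret z.2)`. So `D` equations cut out exactly the graph. -/
theorem Near.eq_of_defining_eq_zero {z : Y × (Fin D → ℝ)} (h : A.Near x₀ z)
    (h0 : A.defining x₀ z = 0) : f (A.ret x₀ z.2) = z.1 ∧ F (A.ret x₀ z.2) = z.2 := by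
  have h1 := h.P_defining
  rw [h0, map_zero, eq_comm, sub_eq_zero] at h1
  rw [defining, h1, sub_self, map_zero, add_zero, sub_eq_zero] at h0
  exact ⟨(chartFun_injOn h.mem_source h.map_mem_source h1).symm, h0.symm⟩

theorem defining_eq_zero {z : X} (hz : z ∈ A.V x₀) : A.defining x₀ (f z, F z) = 0 := by
  simp [defining, A.ret_F hz]

variable (A)

theorem eventually_mem_graph_iff (h : x₁ ∈ A.V x₀) (hc : f x₁ ∈ (A.c x₀).source) :
    ∀ᶠ z in 𝓝 (f x₁, F x₁), z ∈ A.graph ↔ A.defining x₀ z = 0 := by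
  have h1 := (continuous_snd.tendsto (f x₁, F x₁)).eventually
    (eventually_mem_of_isEmbedding A.isEmbedding ((A.isOpen_V x₀).mem_nhds h))
  filter_upwards [A.eventually_near h hc, h1] with z hz hz'
  constructor
  · rintro ⟨x, rfl⟩
    exact defining_eq_zero (hz' x rfl)
  · intro h0
    obtain ⟨h2, h3⟩ := hz.eq_of_defining_eq_zero h0
    exact ⟨_, Prod.ext h2 h3⟩

/-- Together with `P x₀ z.2`, the chart coordinate of the point of `X`, the defining functions form
coordinates on the product. Only continuity of `f` and `F` is used. -/
theorem flat_defining (h : x₁ ∈ A.V x₀) (hc : f x₁ ∈ (A.c x₀).source) :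
    Flat A.graph (f x₁, F x₁) D fun l z => coordL D l (A.defining x₀ z) := by
  set p : Y × (Fin D → ℝ) := (f x₁, F x₁) with hp
  have hn := A.eventually_near h hc
  have hx₁ := A.V_subset x₀ h
  have hp0 : A.defining x₀ p = 0 := defining_eq_zero h
  have hPp : A.P x₀ p.2 = chartFun (A.e x₀) x₁ := A.P_F x₀ x₁ h
  -- The inverse is explicit: `w.2` recovers the point of `X`, `P x₀ w.1` the displacement in the
  -- chart of `Y`, and the rest of `w.1` the displacement from `F`.
  let κ : (Fin D → ℝ) × (Fin n → ℝ) → Y × (Fin D → ℝ) := fun w =>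
    (chartInv (A.c x₀) (A.P x₀ w.1 + chartFun (A.c x₀) (f (chartInv (A.e x₀) w.2))),
      w.1 + F (chartInv (A.e x₀) w.2) - A.I x₀ (A.P x₀ w.1))
  have hw : ∀ᶠ w : (Fin D → ℝ) × (Fin n → ℝ) in 𝓝 (A.defining x₀ p, A.P x₀ p.2),
      ContinuousAt (chartInv (A.e x₀)) w.2 ∧ chartInv (A.e x₀) w.2 ∈ A.V x₀ ∧
      chartFun (A.e x₀) (chartInv (A.e x₀) w.2) = w.2 ∧
      f (chartInv (A.e x₀) w.2) ∈ (A.c x₀).source := by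
    refine (continuous_snd.tendsto _).eventually
      (p := fun u => ContinuousAt (chartInv (A.e x₀)) u ∧ chartInv (A.e x₀) u ∈ A.V x₀ ∧
        chartFun (A.e x₀) (chartInv (A.e x₀) u) = u ∧
        f (chartInv (A.e x₀) u) ∈ (A.c x₀).source) ?_
    change ∀ᶠ u in 𝓝 (A.P x₀ p.2), _
    rw [hPp]
    have h1 := eventually_chartInv hx₁
    have h2 : ∀ᶠ u in 𝓝 (chartFun (A.e x₀) x₁),
        chartInv (A.e x₀) u ∈ A.V x₀ ∩ f ⁻¹' (A.c x₀).source :=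
      h1.self_of_nhds.1.eventually (by
        rw [chartInv_chartFun hx₁]
        exact Filter.inter_mem ((A.isOpen_V x₀).mem_nhds h)
          (A.continuous_map.continuousAt.preimage_mem_nhds ((A.c x₀).open_source.mem_nhds hc)))
    filter_upwards [h1, h2] with u hu hu'
    exact ⟨hu.1, hu'.1, hu.2.2, hu'.2⟩
  have hc1 : ∀ᶠ w : (Fin D → ℝ) × (Fin n → ℝ) in 𝓝 (A.defining x₀ p, A.P x₀ p.2),
      ContinuousAt (fun w : (Fin D → ℝ) × (Fin n → ℝ) =>
        A.P x₀ w.1 + chartFun (A.c x₀) (f (chartInv (A.e x₀) w.2))) w := by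
    filter_upwards [hw] with w hw
    have h1 : ContinuousAt (fun w : (Fin D → ℝ) × (Fin n → ℝ) => f (chartInv (A.e x₀) w.2)) w :=
      A.continuous_map.continuousAt.comp (hw.1.comp continuousAt_snd)
    exact ((A.P x₀).continuous.continuousAt.comp continuousAt_fst).add
      (ContinuousAt.comp (f := fun w : (Fin D → ℝ) × (Fin n → ℝ) => f (chartInv (A.e x₀) w.2))
        (continuousAt_chartFun hw.2.2.2) h1)
  have hw2 : ∀ᶠ w : (Fin D → ℝ) × (Fin n → ℝ) in 𝓝 (A.defining x₀ p, A.P x₀ p.2),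
      ContinuousAt (chartInv (A.c x₀))
        (A.P x₀ w.1 + chartFun (A.c x₀) (f (chartInv (A.e x₀) w.2))) ∧
      chartFun (A.c x₀) (κ w).1 =
        A.P x₀ w.1 + chartFun (A.c x₀) (f (chartInv (A.e x₀) w.2)) := by
    have h1 := hc1.self_of_nhds.eventually (p := fun u => ContinuousAt (chartInv (A.c x₀)) u ∧
      chartFun (A.c x₀) (chartInv (A.c x₀) u) = u) ?_
    · exact h1
    · change ∀ᶠ u in 𝓝 (A.P x₀ (A.defining x₀ p) +
        chartFun (A.c x₀) (f (chartInv (A.e x₀) (A.P x₀ p.2)))), _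
      rw [hp0, hPp, map_zero, zero_add, chartInv_chartFun hx₁]
      exact (eventually_chartInv hc).mono fun u hu => ⟨hu.1, hu.2.2⟩
  refine flat_fst (b := fun z => A.P x₀ z.2) (κ := κ) ⟨x₁, rfl⟩ ?_ ?_ ?_ ?_
    (A.eventually_mem_graph_iff h hc)
  · filter_upwards [hn] with z hz
    exact hz.continuousAt_defining.prodMk ((A.P x₀).continuous.continuousAt.comp continuousAt_snd)
  · filter_upwards [hw, hw2, hc1] with w h1 h2 h3
    refine ContinuousAt.prodMk (ContinuousAt.comp (f := fun w : (Fin D → ℝ) × (Fin n → ℝ) =>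
        A.P x₀ w.1 + chartFun (A.c x₀) (f (chartInv (A.e x₀) w.2))) h2.1 h3) ?_
    exact (continuousAt_fst.add (A.isEmbedding.continuous.continuousAt.comp
      (h1.1.comp continuousAt_snd))).sub ((A.I x₀).continuous.continuousAt.comp
        ((A.P x₀).continuous.continuousAt.comp continuousAt_fst))
  · filter_upwards [hn] with z hz
    refine Prod.ext ?_ ?_
    · change chartInv (A.c x₀) (A.P x₀ (A.defining x₀ z) +
        chartFun (A.c x₀) (f (A.ret x₀ z.2))) = z.1
      rw [hz.P_defining, sub_add_cancel, chartInv_chartFun hz.mem_source]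
    · change A.defining x₀ z + F (A.ret x₀ z.2) - A.I x₀ (A.P x₀ (A.defining x₀ z)) = z.2
      rw [hz.P_defining, defining]; abel
  · filter_upwards [hw, hw2] with w h1 h2
    have e1 : A.P x₀ (κ w).2 = w.2 := by
      change A.P x₀ (w.1 + F (chartInv (A.e x₀) w.2) - A.I x₀ (A.P x₀ w.1)) = w.2
      rw [map_sub, map_add, A.P_I, A.P_F x₀ _ h1.2.1, h1.2.2.1]; abel
    refine Prod.ext ?_ e1
    have e2 : A.ret x₀ (κ w).2 = chartInv (A.e x₀) w.2 := by rw [ret, e1]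
    change (κ w).2 - F (A.ret x₀ (κ w).2) +
      A.I x₀ (chartFun (A.c x₀) (κ w).1 - chartFun (A.c x₀) (f (A.ret x₀ (κ w).2))) = w.1
    rw [e2, h2.2, add_sub_cancel_right]
    change w.1 + F (chartInv (A.e x₀) w.2) - A.I x₀ (A.P x₀ w.1) -
      F (chartInv (A.e x₀) w.2) + A.I x₀ (A.P x₀ w.1) = w.1
    abel

end Adapted
end Adapted

/-! ### Comparison of the class of the graph with the orientation class. -/

section Adapted

variable {X Y : Type*} [TopologicalSpace X] [TopologicalSpace Y] {n D : ℕ}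

theorem omegaV_chart_sub_mem_nullAt {e e' : OpenPartialHomeomorph X (EuclideanSpace ℝ (Fin n))}
    {x : X} (hx : x ∈ e.source) (hx' : x ∈ e'.source)
    (hdet : 0 < (fderiv ℝ (e.symm.trans e') (e x)).det) :
    (omegaV (fun z => chartFun e' z - chartFun e' x) -
      omegaV (fun z => chartFun e z - chartFun e x) ∈ nullAt {x} x n) ∧
    (omegaV (fun z => chartFun e' x - chartFun e' z) -
      omegaV (fun z => chartFun e x - chartFun e z) ∈ nullAt {x} x n) := by
  constructor
  · have h := omega_chart_sub_mem_nullAt hx hx' hdet (EuclideanSpace.equiv (Fin n) ℝ)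
    simpa only [omegaV, chartFun, map_sub] using h
  -- The reversed differences are handled by composing the linear identification with negation on
  -- both sides.
  · have h := omega_chart_sub_mem_nullAt hx hx' hdet
      ((EuclideanSpace.equiv (Fin n) ℝ).trans (ContinuousLinearEquiv.neg ℝ))
    simpa [omegaV, chartFun] using h

namespace Adapted

variable {f : X → Y} {F : X → Fin D → ℝ} (A : Adapted n f F) {x₀ x₁ : X}

/-- The local orientation class of `Y × ℝ ^ D` at `(f x, F x)` in terms of a chart `c` of `Y`. -/
noncomputable def base (_ : Adapted n f F) (c : OpenPartialHomeomorph Y (EuclideanSpace ℝ (Fin n)))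
    (x : X) : Cochain (Y × (Fin D → ℝ)) ℤ (D + n) :=
  iterV (omegaV fun z => z.2 - F x) fun z => chartFun c z.1 - chartFun c (f x)

variable {c c' : OpenPartialHomeomorph Y (EuclideanSpace ℝ (Fin n))}

theorem flat_base (hc : f x₁ ∈ c.source) :
    Flat {(f x₁, F x₁)} (f x₁, F x₁) (D + n) fun l (z : Y × (Fin D → ℝ)) =>
      coordL (D + n) l (appendL D n (z.2 - F x₁, chartFun c z.1 - chartFun c (f x₁))) := by
  have h1 : ∀ᶠ w : (Fin D → ℝ) × (Fin n → ℝ) in 𝓝 0,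
      ContinuousAt (chartInv c) (w.2 + chartFun c (f x₁)) ∧
        chartFun c (chartInv c (w.2 + chartFun c (f x₁))) = w.2 + chartFun c (f x₁) := by
    have h2 : ContinuousAt (fun w : (Fin D → ℝ) × (Fin n → ℝ) => w.2 + chartFun c (f x₁)) 0 := by
      fun_prop
    refine h2.eventually (p := fun u => ContinuousAt (chartInv c) u ∧
      chartFun c (chartInv c u) = u) ?_
    change ∀ᶠ u in 𝓝 ((0 : Fin n → ℝ) + chartFun c (f x₁)), _
    rw [zero_add]
    exact (eventually_chartInv hc).mono fun u hu => ⟨hu.1, hu.2.2⟩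
  refine flat_pair (κ := fun w => (chartInv c (w.2 + chartFun c (f x₁)), w.1 + F x₁)) ?_ ?_ ?_ ?_
    (sub_self _) (sub_self _)
  · filter_upwards [(continuous_fst.tendsto (f x₁, F x₁)).eventually (eventually_mem_source hc)]
      with z hz
    exact (continuousAt_snd.sub continuousAt_const).prodMk
      (((continuousAt_chartFun hz).comp continuousAt_fst).sub continuousAt_const)
  · filter_upwards [h1] with w hw
    exact (ContinuousAt.comp (f := fun w : (Fin D → ℝ) × (Fin n → ℝ) => w.2 + chartFun c (f x₁))
      hw.1 (by fun_prop)).prodMk (by fun_prop)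
  · filter_upwards [(continuous_fst.tendsto (f x₁, F x₁)).eventually (eventually_mem_source hc)]
      with z hz
    simp [chartInv_chartFun hz]
  · filter_upwards [h1] with w hw
    simp [hw.2]

theorem base_eq : A.base c x₁ = omega (fun l (z : Y × (Fin D → ℝ)) => coordL (D + n) l
    (appendL D n (z.2 - F x₁, chartFun c z.1 - chartFun c (f x₁)))) (D + n) :=
  iterV_omegaV _ _

theorem base_sub_base_mem_nullAt (hc : f x₁ ∈ c.source) (hc' : f x₁ ∈ c'.source)
    (hdet : 0 < (fderiv ℝ (c.symm.trans c') (c (f x₁))).det) :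
    A.base c' x₁ - A.base c x₁ ∈ nullAt {(f x₁, F x₁)} (f x₁, F x₁) (D + n) := by
  refine iterV_sub_mem_nullAt (Γ := {z : Y × (Fin D → ℝ) | z.1 = f x₁})
    (Γ' := {z : Y × (Fin D → ℝ) | z.2 = F x₁})
    (omegaV_mem_suppAt (Filter.Eventually.of_forall fun z => by fun_prop)
      (Filter.Eventually.of_forall fun z hz => sub_eq_zero.1 hz)) (vanishesNear_cob_omegaV _ _) ?_
    (fun z hz => Prod.ext (show z.1 = f x₁ from hz.1) (show z.2 = F x₁ from hz.2))
  have h := nullAt_pb (f := (Prod.fst : Y × (Fin D → ℝ) → Y)) (p := (f x₁, F x₁))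
    (Γ := {z | z.1 = f x₁}) (Filter.Eventually.of_forall fun z => continuousAt_fst)
    (Filter.Eventually.of_forall fun z hz => hz) (omegaV_chart_sub_mem_nullAt hc hc' hdet).1
  rwa [pb_sub, pb_omegaV, pb_omegaV] at h

variable {A}

theorem eventually_prod {M : Type*} [TopologicalSpace M] {p : M} {q : M → Prop}
    (h : ∀ᶠ z in 𝓝 p, q z) (t : ℝ) : ∀ᶠ a : ℝ × M in 𝓝 (t, p), q a.2 :=
  (continuous_snd.tendsto (t, p)).eventually h

/-- The class of `defining` becomes the orientation class after multiplication with the class of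
the coordinates of `X`. -/
theorem iterV_defining_sub_base_mem_nullAt (h : x₁ ∈ A.V x₀) (hc : f x₁ ∈ (A.c x₀).source) :
    iterV (omegaV (A.defining x₀)) (fun z => A.P x₀ (F x₁ - z.2)) - A.base (A.c x₀) x₁ ∈
      nullAt {(f x₁, F x₁)} (f x₁, F x₁) (D + n) := by
  have hflat := flat_base (F := F) hc
  have hn := A.eventually_near h hc
  have hPc : Continuous (A.P x₀) := (A.P x₀).continuous
  have hIc : Continuous (A.I x₀) := (A.I x₀).continuous
  -- First homotopy: `F ∘ ret` is replaced by its linear model and `f ∘ ret` by a constant. Where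
  -- `K` vanishes, `ret` already equals `x₁`, so the deformed terms are zero there.
  have hA := pair_homotopy hflat
    (H := fun t z => z.2 - F x₁ - ((1 - t) • (F (A.ret x₀ z.2) - F x₁) +
      t • A.I x₀ (A.P x₀ (z.2 - F x₁))) + A.I x₀ (chartFun (A.c x₀) z.1 -
        chartFun (A.c x₀) (f x₁) -
        (1 - t) • (chartFun (A.c x₀) (f (A.ret x₀ z.2)) - chartFun (A.c x₀) (f x₁))))
    (K := fun _ z => A.P x₀ (F x₁ - z.2)) ?_ ?_ ?_
  -- Second homotopy: a quarter turn exchanging the coordinate `w` of `Y` with `P v`. The sign in `F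
  -- x₁ - z.2` is what makes it a rotation and not a reflection.
  · have hB := pair_homotopy hflat
      (H := fun t z => z.2 - F x₁ - t • A.I x₀ (A.P x₀ (z.2 - F x₁)) +
        t • A.I x₀ (chartFun (A.c x₀) z.1 - chartFun (A.c x₀) (f x₁)))
      (K := fun t z => (1 - t) • (chartFun (A.c x₀) z.1 - chartFun (A.c x₀) (f x₁)) -
        t • A.P x₀ (z.2 - F x₁)) ?_ ?_ ?_
    · have h1 := sub_mem hA hB
      convert h1 using 1
      have e1 : (fun z : Y × (Fin D → ℝ) => z.2 - F x₁ - ((1 - (0 : ℝ)) •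
          (F (A.ret x₀ z.2) - F x₁) + (0 : ℝ) • A.I x₀ (A.P x₀ (z.2 - F x₁))) +
          A.I x₀ (chartFun (A.c x₀) z.1 - chartFun (A.c x₀) (f x₁) - (1 - (0 : ℝ)) •
          (chartFun (A.c x₀) (f (A.ret x₀ z.2)) - chartFun (A.c x₀) (f x₁)))) =
          A.defining x₀ := by
        funext z; simp [defining]
      have e2 : (fun z : Y × (Fin D → ℝ) => z.2 - F x₁ - ((1 - (1 : ℝ)) •
          (F (A.ret x₀ z.2) - F x₁) + (1 : ℝ) • A.I x₀ (A.P x₀ (z.2 - F x₁))) +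
          A.I x₀ (chartFun (A.c x₀) z.1 - chartFun (A.c x₀) (f x₁) - (1 - (1 : ℝ)) •
          (chartFun (A.c x₀) (f (A.ret x₀ z.2)) - chartFun (A.c x₀) (f x₁)))) =
          fun z => z.2 - F x₁ - (1 : ℝ) • A.I x₀ (A.P x₀ (z.2 - F x₁)) +
            (1 : ℝ) • A.I x₀ (chartFun (A.c x₀) z.1 - chartFun (A.c x₀) (f x₁)) := by
        funext z; simp
      have e3 : (fun z : Y × (Fin D → ℝ) => (1 - (1 : ℝ)) • (chartFun (A.c x₀) z.1 -
          chartFun (A.c x₀) (f x₁)) - (1 : ℝ) • A.P x₀ (z.2 - F x₁)) =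
          fun z => A.P x₀ (F x₁ - z.2) := by
        funext z; simp
      rw [e1, e2, e3]
      simp only [zero_smul, sub_zero, one_smul, add_zero]
      simp only [base]
      abel
    · intro t _
      filter_upwards [eventually_prod hn t] with a ha
      have h1 := ContinuousAt.comp (f := fun b : ℝ × (Y × (Fin D → ℝ)) => b.2)
        ha.continuousAt_chart continuousAt_snd
      have h1' : ContinuousAt (fun b : ℝ × (Y × (Fin D → ℝ)) => chartFun (A.c x₀) b.2.1) a := h1
      fun_prop
    · intro t _
      filter_upwards [eventually_prod hn t] with a ha
      have h1 := ContinuousAt.comp (f := fun b : ℝ × (Y × (Fin D → ℝ)) => b.2)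
        ha.continuousAt_chart continuousAt_snd
      have h1' : ContinuousAt (fun b : ℝ × (Y × (Fin D → ℝ)) => chartFun (A.c x₀) b.2.1) a := h1
      fun_prop
    · intro t _
      filter_upwards [eventually_prod hn t] with a ha h0 h1
      set v := a.2.2 - F x₁
      set w := chartFun (A.c x₀) a.2.1 - chartFun (A.c x₀) (f x₁) with hw
      have h2 : A.P x₀ v - a.1 • A.P x₀ v + a.1 • w = 0 := by
        have := congrArg (A.P x₀) h0
        simpa only [map_add, map_sub, map_smul, A.P_I, map_zero] using this
      -- On the pair `(P v, w)` the homotopy is a matrix of determinant `t² + (1 - t)²`.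
      have h3 : (a.1 ^ 2 + (1 - a.1) ^ 2) • A.P x₀ v = 0 := by
        have h4 : (a.1 ^ 2 + (1 - a.1) ^ 2) • A.P x₀ v =
          (1 - a.1) • (A.P x₀ v - a.1 • A.P x₀ v + a.1 • w) -
            a.1 • ((1 - a.1) • w - a.1 • A.P x₀ v) := by module
        rw [h4, h2, h1]; simp
      have h5 : (a.1 ^ 2 + (1 - a.1) ^ 2) • w = 0 := by
        have h4 : (a.1 ^ 2 + (1 - a.1) ^ 2) • w =
          a.1 • (A.P x₀ v - a.1 • A.P x₀ v + a.1 • w) +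
            (1 - a.1) • ((1 - a.1) • w - a.1 • A.P x₀ v) := by module
        rw [h4, h2, h1]; simp
      have hne : a.1 ^ 2 + (1 - a.1) ^ 2 ≠ 0 := by nlinarith [sq_nonneg (a.1 - (1 - a.1))]
      have h6 := (smul_eq_zero.1 h3).resolve_left hne
      have h7 := (smul_eq_zero.1 h5).resolve_left hne
      rw [h6, h7] at h0
      simp only [map_zero, smul_zero, sub_zero, add_zero] at h0
      exact Prod.ext (chartFun_injOn ha.mem_source hc (sub_eq_zero.1 h7)) (sub_eq_zero.1 h0)
  · intro t _
    filter_upwards [eventually_prod hn t] with a ha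
    have h1 : ContinuousAt (fun b : ℝ × (Y × (Fin D → ℝ)) => chartFun (A.c x₀) b.2.1) a :=
      ContinuousAt.comp (f := fun b : ℝ × (Y × (Fin D → ℝ)) => b.2)
        ha.continuousAt_chart continuousAt_snd
    have h2 : ContinuousAt (fun b : ℝ × (Y × (Fin D → ℝ)) => F (A.ret x₀ b.2.2)) a :=
      ContinuousAt.comp (f := fun b : ℝ × (Y × (Fin D → ℝ)) => b.2)
        ha.continuousAt_F continuousAt_snd
    have h3 : ContinuousAt (fun b : ℝ × (Y × (Fin D → ℝ)) =>
        chartFun (A.c x₀) (f (A.ret x₀ b.2.2))) a :=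
      ContinuousAt.comp (f := fun b : ℝ × (Y × (Fin D → ℝ)) => b.2)
        ha.continuousAt_chart_map continuousAt_snd
    have h4 : ContinuousAt (fun b : ℝ × (Y × (Fin D → ℝ)) => A.I x₀ (A.P x₀ (b.2.2 - F x₁))) a := by
      fun_prop
    have h5 : ContinuousAt (fun b : ℝ × (Y × (Fin D → ℝ)) => 1 - b.1) a := by fun_prop
    have h6 : ContinuousAt (fun b : ℝ × (Y × (Fin D → ℝ)) => b.2.2 - F x₁) a := by fun_prop
    exact (h6.sub ((h5.smul (h2.sub continuousAt_const)).add (continuousAt_fst.smul h4))).add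
      (hIc.continuousAt.comp ((h1.sub continuousAt_const).sub
        (h5.smul (h3.sub continuousAt_const))))
  · exact fun t _ => Filter.Eventually.of_forall fun a => by fun_prop
  · intro t _
    filter_upwards [eventually_prod hn t] with a ha h0 h1
    have hP : A.P x₀ a.2.2 = chartFun (A.e x₀) x₁ := by
      rw [map_sub, sub_eq_zero, A.P_F x₀ x₁ h] at h1
      exact h1.symm
    have hr : A.ret x₀ a.2.2 = x₁ := by
      rw [ret, hP, chartInv_chartFun (A.V_subset x₀ h)]
    have hP' : A.P x₀ (a.2.2 - F x₁) = 0 := by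
      rw [map_sub, hP, A.P_F x₀ x₁ h, sub_self]
    rw [hr, hP'] at h0
    simp only [sub_self, smul_zero, map_zero, add_zero, sub_zero] at h0
    have h2 := congrArg (A.P x₀) h0
    rw [map_add, hP', A.P_I, zero_add, map_zero] at h2
    rw [h2, map_zero, add_zero] at h0
    exact Prod.ext (chartFun_injOn ha.mem_source hc (sub_eq_zero.1 h2)) (sub_eq_zero.1 h0)

/-- The product of the class of `defining` with the class of the coordinates of `X` does not
depend on the choice of the coordinates. -/
theorem iterV_defining_sub_iterV_defining_mem_nullAt (h : x₁ ∈ A.V x₀)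
    (hc : f x₁ ∈ (A.c x₀).source) :
    iterV (omegaV (A.defining x₀)) (fun z => A.P x₁ (F x₁ - z.2)) -
      iterV (omegaV (A.defining x₀)) (fun z => A.P x₀ (F x₁ - z.2)) ∈
      nullAt {(f x₁, F x₁)} (f x₁, F x₁) (D + n) := by
  set p : Y × (Fin D → ℝ) := (f x₁, F x₁) with hp
  have hn := A.eventually_near h hc
  have hx₁ := A.V_subset x₀ h
  have hx₁' := A.V_subset x₁ (A.mem_V x₁)
  have hPc : Continuous (A.P x₁) := (A.P x₁).continuous
  have hV := (continuous_snd.tendsto p).eventually (A.eventually_ret h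
    (Filter.inter_mem ((A.isOpen_V x₁).mem_nhds (A.mem_V x₁))
      ((A.e x₁).open_source.mem_nhds hx₁')))
  -- On the graph `P x₁` is the chart at `x₁` composed with the retraction, so the two choices of
  -- `K` agree wherever `defining` vanishes.
  have hfst := pair_homotopy (flat_base (F := F) hc) (H := fun _ => A.defining x₀)
    (K := fun t z => (1 - t) • A.P x₁ (F x₁ - z.2) +
      t • (chartFun (A.e x₁) x₁ - chartFun (A.e x₁) (A.ret x₀ z.2))) ?_ ?_ ?_
  -- Next the chart at `x₁` is exchanged for the chart at `x₀`; the positive Jacobian on `X` enters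
  -- here.
  · have hsnd : iterV (omegaV (A.defining x₀)) (fun z : Y × (Fin D → ℝ) =>
        chartFun (A.e x₁) x₁ - chartFun (A.e x₁) (A.ret x₀ z.2)) -
        iterV (omegaV (A.defining x₀)) (fun z : Y × (Fin D → ℝ) =>
          chartFun (A.e x₀) x₁ - chartFun (A.e x₀) (A.ret x₀ z.2)) ∈ nullAt {p} p (D + n) := by
      refine nullAt_mono (Γ := {z | A.ret x₀ z.2 = x₁} ∩ A.graph) ?_
        (iterV_sub_mem_nullAt (flat_defining A h hc).omega_mem_suppAt
        (vanishesNear_cob_omegaV _ _) ?_ subset_rfl)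
      · filter_upwards [hn, A.eventually_mem_graph_iff h hc] with z hz hz' ⟨h1, h2⟩
        obtain ⟨h3, h4⟩ := hz.eq_of_defining_eq_zero (hz'.1 h2)
        rw [show A.ret x₀ z.2 = x₁ from h1] at h3 h4
        exact Prod.ext h3.symm h4.symm
      · have hdet := A.det_e x₀ x₁ x₁ hx₁ hx₁'
        have e : A.ret x₀ p.2 = x₁ := A.ret_F h
        have h1 := nullAt_pb (f := fun z : Y × (Fin D → ℝ) => A.ret x₀ z.2) (p := p)
          (Γ := {z | A.ret x₀ z.2 = x₁}) (Γ' := {x₁}) (hn.mono fun z hz =>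
            hz.continuousAt.comp continuousAt_snd)
          (Filter.Eventually.of_forall fun z hz => hz)
          (φ := omegaV (fun z => chartFun (A.e x₁) x₁ - chartFun (A.e x₁) z) -
            omegaV (fun z => chartFun (A.e x₀) x₁ - chartFun (A.e x₀) z))
          (by rw [e]; exact (omegaV_chart_sub_mem_nullAt hx₁ hx₁' hdet).2)
        rwa [pb_sub, pb_omegaV, pb_omegaV] at h1
    have hthd : VanishesNear (iterV (omegaV (A.defining x₀)) (fun z : Y × (Fin D → ℝ) =>
          chartFun (A.e x₀) x₁ - chartFun (A.e x₀) (A.ret x₀ z.2)) -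
        iterV (omegaV (A.defining x₀)) (fun z => A.P x₀ (F x₁ - z.2))) p := by
      rw [iterV_omegaV, iterV_omegaV]
      refine vanishesNear_omega_sub ?_
      filter_upwards [hn] with z hz l _
      rw [← A.P_F x₀ x₁ h, ← A.P_F x₀ _ hz.mem, hz.P_eq, map_sub]
    have h1 := add_mem (add_mem hfst hsnd) (mem_nullAt_of_vanishesNear hthd)
    simpa using h1
  · exact fun t _ => (eventually_prod hn t).mono fun a ha =>
      ContinuousAt.comp (f := fun b : ℝ × (Y × (Fin D → ℝ)) => b.2)
        ha.continuousAt_defining continuousAt_snd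
  · intro t _
    filter_upwards [eventually_prod hV t] with a ha
    have h1 : ContinuousAt (fun b : ℝ × (Y × (Fin D → ℝ)) =>
        chartFun (A.e x₁) (A.ret x₀ b.2.2)) a :=
      ContinuousAt.comp (f := fun b : ℝ × (Y × (Fin D → ℝ)) => A.ret x₀ b.2.2)
        (continuousAt_chartFun ha.2.2.1.2)
        (ContinuousAt.comp (f := fun b : ℝ × (Y × (Fin D → ℝ)) => b.2.2) ha.1 (by fun_prop))
    fun_prop
  · intro t _
    filter_upwards [eventually_prod hn t, eventually_prod hV t] with a ha ha' h0 h1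
    obtain ⟨h3, h4⟩ := ha.eq_of_defining_eq_zero h0
    have h5 : A.P x₁ (F x₁ - a.2.2) =
        chartFun (A.e x₁) x₁ - chartFun (A.e x₁) (A.ret x₀ a.2.2) := by
      rw [show F x₁ - a.2.2 = F x₁ - F (A.ret x₀ a.2.2) by rw [h4], map_sub, A.P_F x₁ _ (A.mem_V x₁), A.P_F x₁ _ ha'.2.2.1.1]
    rw [h5, ← add_smul, sub_add_cancel, one_smul, sub_eq_zero] at h1
    have h6 := chartFun_injOn hx₁' ha'.2.2.1.2 h1
    rw [← h6] at h3 h4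
    exact Prod.ext h3.symm h4.symm

end Adapted
end Adapted

/-! ### Compact supports, translations and fibres. -/

section CompactSupport

variable {X Y G : Type*} [AddCommGroup G] [TopologicalSpace X] [TopologicalSpace Y] {k D : ℕ}

/-- A primitive with support in the compact set is cut off to be literally compactly supported,
without changing its germ along the diagonal. -/
theorem mem_exactOn_compactSupp_of_vanishing [T2Space X] [LocallyCompactSpace X] {K : Set X}
    (hK : IsCompact K) {φ : Cochain X G k} (h : φ ∈ exactOn (fun j => vanishing Kᶜ j) K k)
    (hφ : ∀ z ∉ K, VanishesNear φ z) : φ ∈ exactOn (compactSupp X G) Set.univ k := by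
  cases k with
  | zero =>
    exact mem_exactOn_of_vanishing fun x _ => by
      by_cases hx : x ∈ K
      exacts [mem_exactOn_zero.1 h x hx, hφ x hx]
  | succ k =>
    obtain ⟨ψ, hψ, hv⟩ := mem_exactOn_succ.1 h
    obtain ⟨ψ', h1, h2, -, h3⟩ := exists_cut hK isOpen_univ (Set.subset_univ _) ψ
    have h4 : ∀ z, VanishesNear (ψ' - ψ) z := fun z => by
      by_cases hz : z ∈ K
      exacts [h1 z hz, (h2 z (hψ z hz)).sub (hψ z hz)]
    refine mem_exactOn_succ.2 ⟨ψ', h3, fun z _ => ?_⟩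
    have e : φ - cob ψ' = (φ - cob ψ) - cob (ψ' - ψ) := by rw [map_sub]; abel
    rw [e]
    refine VanishesNear.sub ?_ (h4 z).cob
    by_cases hz : z ∈ K
    exacts [hv z hz, (hφ z hz).sub (hψ z hz).cob]

theorem exists_compactSupp_sub [T2Space X] [LocallyCompactSpace X] {K : Set X}
    (hK : IsCompact K) {φ : Cochain X G k} (hφ : ∀ z ∉ K, VanishesNear φ z) :
    ∃ φ' ∈ compactSupp X G k, ∀ z, VanishesNear (φ' - φ) z := by
  obtain ⟨ψ', h1, h2, -, h3⟩ := exists_cut hK isOpen_univ (Set.subset_univ _) φ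
  refine ⟨ψ', h3, fun z => ?_⟩
  by_cases hz : z ∈ K
  exacts [h1 z hz, (h2 z (hφ z hz)).sub (hφ z hz)]

theorem vanishesNear_cob_congr {φ φ' : Cochain X G k} {x : X} (h : VanishesNear (cob φ) x)
    (hv : VanishesNear (φ' - φ) x) : VanishesNear (cob φ') x := by
  have := hv.cob.add h
  rwa [map_sub, sub_add_cancel] at this

/-- Fibrewise translation of a cocycle supported in the zero section. -/
theorem shear_sub_mem_exactOn [T2Space Y] [CompactSpace Y] {s : Y → Fin D → ℝ}
    (hs : Continuous s) {φ : Cochain (Y × (Fin D → ℝ)) G k} (hc : ∀ z, VanishesNear (cob φ) z)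
    (h0 : ∀ z, z.2 ≠ 0 → VanishesNear φ z) :
    pb (fun z => (z.1, z.2 - s z.1)) φ - φ ∈
      exactOn (compactSupp (Y × (Fin D → ℝ)) G) Set.univ k := by
  obtain ⟨φ', ⟨C, hC, hφC⟩, hv⟩ := exists_compactSupp_sub
    (isCompact_univ.prod (isCompact_singleton (x := (0 : Fin D → ℝ)))) (φ := φ)
    (fun z hz => h0 z fun h => hz ⟨trivial, h⟩)
  obtain ⟨R, hR⟩ := (hC.image continuous_snd).isBounded.subset_closedBall (0 : Fin D → ℝ)
  obtain ⟨S, hS⟩ := (isCompact_univ.image hs).isBounded.subset_closedBall (0 : Fin D → ℝ)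
  have hsc : Continuous fun z : Y × (Fin D → ℝ) => (z.1, z.2 - s z.1) := by fun_prop
  have key := homotopy_exactOn_compactSupp
    (h := fun t (z : Y × (Fin D → ℝ)) => (z.1, z.2 - t • s z.1)) (by fun_prop)
    (fun z => vanishesNear_cob_congr (hc z) (hv z)) hφC (fun t => ⟨Set.univ ×ˢ Metric.closedBall 0
      (R + (|t| + 1) * S), isCompact_univ.prod (isCompact_closedBall _ _), ?_⟩) 1 0
  · simp only [one_smul, zero_smul, sub_zero] at key
    refine mem_exactOn_congr key fun z _ => ?_
    have e : pb (fun z => (z.1, z.2 - s z.1)) φ - φ -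
        (pb (fun z => (z.1, z.2 - s z.1)) φ' - pb (fun z => (z.1, z.2)) φ') =
        (φ' - φ) - pb (fun z => (z.1, z.2 - s z.1)) (φ' - φ) := by
      rw [pb_sub, show pb (fun z : Y × (Fin D → ℝ) => (z.1, z.2)) φ' = φ' from rfl]; abel
    rw [e]
    exact (hv z).sub ((hv _).pb hsc.continuousAt)
  -- For times near `t` the translation moves points by at most `(|t| + 1) * S`, which accounts for
  -- the radius of the ball.
  · have h1 : ∀ᶠ t' in 𝓝 t, |t'| < |t| + 1 :=
      ContinuousAt.eventually_lt (by fun_prop) continuousAt_const (by linarith)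
    filter_upwards [h1] with t' ht' z hz
    refine ⟨trivial, ?_⟩
    have h2 : ‖z.2 - t' • s z.1‖ ≤ R := by simpa using hR (Set.mem_image_of_mem Prod.snd hz)
    have h3 : ‖s z.1‖ ≤ S := by simpa using hS (Set.mem_image_of_mem s (Set.mem_univ z.1))
    have h4 : ‖z.2‖ ≤ ‖z.2 - t' • s z.1‖ + ‖t' • s z.1‖ := by
      simpa using norm_add_le (z.2 - t' • s z.1) (t' • s z.1)
    rw [norm_smul, Real.norm_eq_abs] at h4
    have h5 : |t'| * ‖s z.1‖ ≤ (|t| + 1) * S :=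
      mul_le_mul ht'.le h3 (norm_nonneg _) (by positivity)
    simp only [Metric.mem_closedBall, dist_zero_right]
    linarith

theorem mem_exactOn_of_iterV [T2Space Y] [LocallyCompactSpace Y] {b : Cochain Y G k}
    (hb : b ∈ compactSupp Y G k) (hc : ∀ y, VanishesNear (cob b) y)
    (h : iterV (pb Prod.fst b) (fun z : Y × (Fin D → ℝ) => z.2) ∈
      exactOn (compactSupp (Y × (Fin D → ℝ)) G) Set.univ (k + D)) :
    b ∈ exactOn (compactSupp Y G) Set.univ k :=
  mem_exactOn_of_iter hb hc h

/-- Injectivity of suspension over a point: the class is the suspension of the constant `m`. -/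
theorem eq_zero_of_zsmul_omegaV_mem_exactOn {m : ℤ}
    (h : m • omegaV (fun z : Unit × (Fin D → ℝ) => z.2) ∈
      exactOn (compactSupp (Unit × (Fin D → ℝ)) ℤ) Set.univ D) : m = 0 := by
  -- The degrees `D` and `0 + D` are equal but not by definition, hence the transport.
  have h1 : m • omega (fun l (z : Unit × (Fin D → ℝ)) => coordL D l z.2) (0 + D) ∈
      exactOn (compactSupp (Unit × (Fin D → ℝ)) ℤ) Set.univ (0 + D) := by
    have key : ∀ N, N = D → m • omega (fun l (z : Unit × (Fin D → ℝ)) => coordL D l z.2) N ∈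
      exactOn (compactSupp (Unit × (Fin D → ℝ)) ℤ) Set.univ N := by
      rintro N rfl; exact h
    exact key _ (Nat.zero_add D)
  have h2 := mem_exactOn_of_iterV (Y := Unit) (D := D) (b := fun _ : Fin 1 → Unit => m)
    ⟨Set.univ, isCompact_univ, fun s hs => (hs 0 trivial).elim⟩
    (fun y => by rw [cob_const_zero]; exact VanishesNear.zero y) (by
      convert h1 using 1
      have e : pb (Prod.fst : Unit × (Fin D → ℝ) → Unit) (fun _ : Fin 1 → Unit => m) =
          m • omega (fun l (z : Unit × (Fin D → ℝ)) => coordL D l z.2) 0 := by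
        funext s; simp [pb, omega]
      rw [e, iterV_zsmul, iterV, iter_omega]
      simp)
  obtain ⟨V, hV, h3⟩ := mem_exactOn_zero.1 h2 () trivial
  exact h3 (fun _ => ()) fun _ => mem_of_mem_nhds hV

theorem cut_mem_exactOn_compactSupp {χ : X → ℤ} (hχ : IsLocallyConstant χ)
    {φ : Cochain X G k} (h : φ ∈ exactOn (compactSupp X G) Set.univ k) :
    cut χ φ ∈ exactOn (compactSupp X G) Set.univ k := by
  cases k with
  | zero => exact mem_exactOn_of_vanishing fun x hx => (mem_exactOn_zero.1 h x hx).cut χ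
  | succ k =>
    obtain ⟨ψ, ⟨K, hK, hψ⟩, hv⟩ := mem_exactOn_succ.1 h
    refine mem_exactOn_succ.2 ⟨cut χ ψ, ⟨K, hK, fun s hs => by simp [cut, hψ s hs]⟩,
      fun x hx => ?_⟩
    have e : cut χ φ - cob (cut χ ψ) = cut χ (φ - cob ψ) - step χ ψ := by
      rw [cob_cut, cut_sub]; abel
    rw [e]
    exact ((hv x hx).cut χ).sub (vanishesNear_step (hχ.eventually_eq x) ψ)

theorem vanishesNear_cut_sub_zsmul {χ : X → ℤ} {x : X} (h : ∀ᶠ z in 𝓝 x, χ z = χ x)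
    (φ : Cochain X G k) : VanishesNear (cut χ φ - χ x • φ) x :=
  ⟨_, h, fun s hs => by
    have hs0 : χ (s 0) = χ x := hs 0
    simp [AlexanderSpanier.cut, hs0]⟩

end CompactSupport

/-! ### The normalized Thom class of the graph. -/

namespace Adapted

variable {X Y : Type*} [TopologicalSpace X] [TopologicalSpace Y] {n D : ℕ}
  {f : X → Y} {F : X → Fin D → ℝ} (A : Adapted n f F)

/-- The normalization of the class of the graph at its point over `x`. -/
def Normalized (x : X) (φ : Cochain (Y × (Fin D → ℝ)) ℤ D) : Prop :=
  iterV φ (fun z => A.P x (F x - z.2)) - A.base (A.c x) x ∈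
    nullAt {(f x, F x)} (f x, F x) (D + n)

/-- Multiplication by the coordinates of `X` maps local cohomology supported in the graph to that
supported at its point, because these coordinates vanish on the graph only there. -/
theorem iterV_mem_nullAt_point (x : X) {φ : Cochain (Y × (Fin D → ℝ)) ℤ D}
    (h : φ ∈ nullAt A.graph (f x, F x) D) :
    iterV φ (fun z => A.P x (F x - z.2)) ∈ nullAt {(f x, F x)} (f x, F x) (D + n) := by
  have hPc : Continuous (A.P x) := (A.P x).continuous
  refine iterV_mem_nullAt h (Filter.Eventually.of_forall fun z => by fun_prop) ?_
  have h1 := (continuous_snd.tendsto (f x, F x)).eventually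
    (eventually_mem_of_isEmbedding A.isEmbedding ((A.isOpen_V x).mem_nhds (A.mem_V x)))
  filter_upwards [h1] with z hz hzg h0
  obtain ⟨x', rfl⟩ := hzg
  have hx' := hz x' rfl
  rw [map_sub, A.P_F x x' hx', A.P_F x x (A.mem_V x), sub_eq_zero] at h0
  rw [chartFun_injOn (A.V_subset x (A.mem_V x)) (A.V_subset x hx') h0]
  rfl

theorem eq_zero_of_zsmul_base {x : X} {m : ℤ}
    (h : m • A.base (A.c x) x ∈ nullAt {(f x, F x)} (f x, F x) (D + n)) : m = 0 := by
  rw [base_eq] at h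
  exact (flat_base (F := F) (A.mem_c x)).eq_zero_of_zsmul_mem_nullAt h

/-- One system of defining functions has the right normalization at all nearby points of the graph:
coordinates on `X`, the comparison with `base` and charts of `Y` are exchanged in turn. -/
theorem normalized_defining {x₀ x : X} (h : x ∈ A.V x₀) (hc : f x ∈ (A.c x₀).source) :
    A.Normalized x (omegaV (A.defining x₀)) := by
  have h1 := add_mem (add_mem (iterV_defining_sub_iterV_defining_mem_nullAt h hc)
    (iterV_defining_sub_base_mem_nullAt h hc))
    (neg_mem (A.base_sub_base_mem_nullAt hc (A.mem_c x) (A.det_c x₀ x _ hc (A.mem_c x))))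
  simpa [Normalized] using h1

theorem flat_graph (x : X) :
    Flat A.graph (f x, F x) D fun l z => coordL D l (A.defining x z) :=
  A.flat_defining (A.mem_V x) (A.mem_c x)

/-- Uniqueness. The difference is `m` times the local generator, whose image is the orientation
class; equal normalizations force `m` to kill that class, so `m = 0`. -/
theorem sub_mem_nullAt_of_normalized {x : X} {φ φ' : Cochain (Y × (Fin D → ℝ)) ℤ D}
    (hφ : φ ∈ suppAt A.graph (f x, F x) D) (hφ' : φ' ∈ suppAt A.graph (f x, F x) D)
    (hc : VanishesNear (cob φ) (f x, F x)) (hc' : VanishesNear (cob φ') (f x, F x))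
    (h : A.Normalized x φ) (h' : A.Normalized x φ') :
    φ - φ' ∈ nullAt A.graph (f x, F x) D := by
  obtain ⟨m, hm⟩ := (A.flat_graph x).exists_sub_zsmul_mem_nullAt (sub_mem hφ hφ')
    (by rw [map_sub]; exact hc.sub hc')
  have h1 := A.iterV_mem_nullAt_point x hm
  rw [iterV_sub, iterV_sub, iterV_zsmul] at h1
  have h2 := zsmul_mem (A.normalized_defining (A.mem_V x) (A.mem_c x)) m
  rw [zsmul_sub] at h2
  have h3 : m = 0 := A.eq_zero_of_zsmul_base (x := x) (by
    have := sub_mem (sub_mem (sub_mem h h') h1) h2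
    convert this using 1
    simp only [omegaV]; abel)
  rw [h3, zero_smul, sub_zero] at hm
  exact hm

variable [T2Space Y] [LocallyCompactSpace Y] [CompactSpace X]

theorem isCompact_graph : IsCompact A.graph :=
  isCompact_range (A.continuous_map.prodMk A.isEmbedding.continuous)

/-- The class of the graph. -/
theorem exists_graph_class : ∃ τ ∈ vanishing A.graphᶜ D, (∀ z, VanishesNear (cob τ) z) ∧
    ∀ x, A.Normalized x τ := by
  refine (exists_global_section (N := D) (Γ := A.graph) ?_ A.isCompact_graph
    (fun p φ => ∀ x, (f x, F x) = p → A.Normalized x φ) ?_ ?_ ?_).imp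
    fun τ h => ⟨h.1, h.2.1, fun x => h.2.2 _ ⟨x, rfl⟩ x rfl⟩
  · rintro _ ⟨x, rfl⟩ i hi φ hφ hc
    exact (A.flat_graph x).mem_nullAt hφ hc hi.ne
  · rintro _ ⟨x, rfl⟩ φ φ' hφ hφ' hc hc' h h'
    exact A.sub_mem_nullAt_of_normalized hφ hφ' hc hc' (h x rfl) (h' x rfl)
  · rintro _ - φ φ' h h' x rfl
    have := add_mem (A.iterV_mem_nullAt_point x h') (h x rfl)
    rwa [iterV_sub, sub_add_sub_cancel] at this
  · rintro _ ⟨x₀, rfl⟩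
    refine ⟨_, (A.flat_graph x₀).omega_mem_suppAt, vanishesNear_cob_omegaV _ _, ?_⟩
    have h1 := (continuous_snd.tendsto (f x₀, F x₀)).eventually
      (eventually_mem_of_isEmbedding A.isEmbedding
        (Filter.inter_mem ((A.isOpen_V x₀).mem_nhds (A.mem_V x₀))
          (A.continuous_map.continuousAt.preimage_mem_nhds
            ((A.c x₀).open_source.mem_nhds (A.mem_c x₀)))))
    filter_upwards [h1] with p hp _ x hx
    subst hx
    exact A.normalized_defining (hp x rfl).1 (hp x rfl).2

end Adapted

theorem pb_zsmul {X Y G : Type*} [AddCommGroup G] {k : ℕ} (f : X → Y) (m : ℤ)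
    (φ : Cochain Y G k) : pb f (m • φ) = m • pb f φ := rfl

/-! ### The graph over the set where it is a section, and the sign there. -/

namespace Adapted

variable {X Y : Type*} [TopologicalSpace X] [TopologicalSpace Y] {n D : ℕ}
  {f : X → Y} {F : X → Fin D → ℝ} (A : Adapted n f F)

/-- Over the open set `U` the graph is the graph of the map `s` from `U` to `ℝ ^ D`. -/
structure IsSection (f : X → Y) (F : X → Fin D → ℝ) (U : Set Y) (s : Y → Fin D → ℝ) : Prop where
  isOpen : IsOpen U
  continuousOn : ContinuousOn s U
  exists_eq : ∀ y ∈ U, ∃ x, f x = y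
  eq : ∀ x, f x ∈ U → F x = s (f x)

variable {A} {U : Set Y} {s : Y → Fin D → ℝ}

theorem IsSection.mem_graph_iff (h : IsSection f F U s) {z : Y × (Fin D → ℝ)} (hz : z.1 ∈ U) :
    z ∈ A.graph ↔ z.2 - s z.1 = 0 := by
  rw [sub_eq_zero]
  constructor
  · rintro ⟨x, rfl⟩
    exact h.eq x hz
  · intro h'
    obtain ⟨x, hx⟩ := h.exists_eq _ hz
    exact ⟨x, Prod.ext hx ((h.eq x (hx ▸ hz)).trans (by rw [hx, h']))⟩

theorem IsSection.eventually_mem (h : IsSection f F U s) {p : Y × (Fin D → ℝ)} (hp : p.1 ∈ U) :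
    ∀ᶠ z in 𝓝 p, z.1 ∈ U :=
  (continuous_fst.tendsto p).eventually (h.isOpen.mem_nhds hp)

theorem IsSection.continuousAt (h : IsSection f F U s) {z : Y × (Fin D → ℝ)} (hz : z.1 ∈ U) :
    ContinuousAt (fun z : Y × (Fin D → ℝ) => z.2 - s z.1) z :=
  continuousAt_snd.sub ((h.continuousOn.continuousAt (h.isOpen.mem_nhds hz)).comp continuousAt_fst)

/-- The difference `z.2 - s z.1` is a second system of defining functions, completed to coordinates
by the chart of `Y`. -/
theorem IsSection.flat (h : IsSection f F U s) {x : X} (hx : f x ∈ U) :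
    Flat A.graph (f x, F x) D fun l z => coordL D l (z.2 - s z.1) := by
  set p : Y × (Fin D → ℝ) := (f x, F x) with hp
  have hU := h.eventually_mem (p := p) hx
  have hcs := (continuous_fst.tendsto p).eventually (eventually_mem_source (A.mem_c x))
  have hw : ∀ᶠ w : (Fin D → ℝ) × (Fin n → ℝ) in
      𝓝 (p.2 - s p.1, chartFun (A.c x) p.1),
      ContinuousAt (chartInv (A.c x)) w.2 ∧ chartInv (A.c x) w.2 ∈ U ∧
        chartFun (A.c x) (chartInv (A.c x) w.2) = w.2 := by
    refine (continuous_snd.tendsto _).eventually (p := fun u => ContinuousAt (chartInv (A.c x)) u ∧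
      chartInv (A.c x) u ∈ U ∧ chartFun (A.c x) (chartInv (A.c x) u) = u) ?_
    have h1 := eventually_chartInv (A.mem_c x)
    have h2 := h1.self_of_nhds.1.eventually (p := fun y => y ∈ U)
      (by rw [chartInv_chartFun (A.mem_c x)]; exact h.isOpen.mem_nhds hx)
    filter_upwards [h1, h2] with u hu hu'
    exact ⟨hu.1, hu', hu.2.2⟩
  refine flat_fst (b := fun z => chartFun (A.c x) z.1)
    (κ := fun w => (chartInv (A.c x) w.2, w.1 + s (chartInv (A.c x) w.2))) ⟨x, rfl⟩ ?_ ?_ ?_ ?_ ?_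
  · filter_upwards [hU, hcs] with z hz hz'
    exact (h.continuousAt hz).prodMk ((continuousAt_chartFun hz').comp continuousAt_fst)
  · filter_upwards [hw] with w hw
    have h1 : ContinuousAt (fun w : (Fin D → ℝ) × (Fin n → ℝ) => chartInv (A.c x) w.2) w :=
      hw.1.comp continuousAt_snd
    exact h1.prodMk (continuousAt_fst.add (ContinuousAt.comp
      (f := fun w : (Fin D → ℝ) × (Fin n → ℝ) => chartInv (A.c x) w.2)
      (h.continuousOn.continuousAt (h.isOpen.mem_nhds hw.2.1)) h1))
  · filter_upwards [hcs] with z hz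
    simp [chartInv_chartFun hz]
  · filter_upwards [hw] with w hw
    simp [hw.2.2]
  · filter_upwards [hU] with z hz using h.mem_graph_iff hz

/-- The class τ is `d` times the class of the section, and the latter maps to `m` times the
orientation class. The normalization of τ gives `d * m = 1`, so `d` is a unit without any comparison
of orientations over `U`. -/
theorem IsSection.exists_degree (h : IsSection f F U s) {τ : Cochain (Y × (Fin D → ℝ)) ℤ D}
    (hτ : τ ∈ vanishing A.graphᶜ D) (hc : ∀ z, VanishesNear (cob τ) z) {x : X}
    (hN : A.Normalized x τ) (hx : f x ∈ U) :
    ∃ d : ℤ, (d = 1 ∨ d = -1) ∧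
      τ - d • omegaV (fun z => z.2 - s z.1) ∈ nullAt A.graph (f x, F x) D := by
  obtain ⟨d, hd⟩ := (h.flat hx).exists_sub_zsmul_mem_nullAt (suppAt_of_vanishing hτ _) (hc _)
  refine ⟨d, ?_, hd⟩
  have hPc : Continuous (A.P x) := (A.P x).continuous
  have hI : iterV (omegaV fun z => z.2 - s z.1) (fun z => A.P x (F x - z.2)) ∈
      suppAt {(f x, F x)} (f x, F x) (D + n) := by
    refine iterV_mem_suppAt (h.flat (A := A) hx).omega_mem_suppAt
      (Filter.Eventually.of_forall fun z => by fun_prop) ?_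
    have h1 := (continuous_snd.tendsto (f x, F x)).eventually
      (eventually_mem_of_isEmbedding A.isEmbedding ((A.isOpen_V x).mem_nhds (A.mem_V x)))
    filter_upwards [h1] with z hz hzg h0
    obtain ⟨x', rfl⟩ := hzg
    have hx' := hz x' rfl
    rw [map_sub, A.P_F x x' hx', A.P_F x x (A.mem_V x), sub_eq_zero] at h0
    rw [chartFun_injOn (A.V_subset x (A.mem_V x)) (A.V_subset x hx') h0]
    rfl
  obtain ⟨m, hm⟩ := (flat_base (F := F) (A.mem_c x)).exists_sub_zsmul_mem_nullAt hI
    (vanishesNear_cob_iterV (vanishesNear_cob_omegaV _ _) _)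
  rw [← base_eq A] at hm
  have h1 := A.iterV_mem_nullAt_point x hd
  rw [iterV_sub, iterV_zsmul] at h1
  have h2 := zsmul_mem hm d
  rw [zsmul_sub, smul_smul] at h2
  have h3 : 1 - d * m = 0 := A.eq_zero_of_zsmul_base (x := x) (by
    have := sub_mem (add_mem h1 h2) hN
    convert this using 1
    rw [sub_smul, one_smul]
    simp only [omegaV]; abel)
  exact Int.eq_one_or_neg_one_of_mul_eq_one (by linarith)

/-- `d` is the degree of the restriction of `τ` to the fibre over `y`. -/
def FibreDegree (τ : Cochain (Y × (Fin D → ℝ)) ℤ D) (y : Y) (d : ℤ) : Prop :=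
  pb (fun z : Unit × (Fin D → ℝ) => (y, z.2)) τ - d • omegaV (fun z => z.2) ∈
    exactOn (compactSupp (Unit × (Fin D → ℝ)) ℤ) Set.univ D

theorem FibreDegree.unique {τ : Cochain (Y × (Fin D → ℝ)) ℤ D} {y : Y} {d d' : ℤ}
    (h : FibreDegree τ y d) (h' : FibreDegree τ y d') : d = d' := by
  have h1 := sub_mem h' h
  rw [sub_sub_sub_cancel_left, ← sub_smul] at h1
  exact sub_eq_zero.1 (eq_zero_of_zsmul_omegaV_mem_exactOn h1)

/-- The fibre over a point of `U` meets the graph once, so the local coefficient there determines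
the whole compactly supported class; translating the point to the origin finishes. -/
theorem IsSection.fibreDegree (h : IsSection f F U s) {τ : Cochain (Y × (Fin D → ℝ)) ℤ D}
    (hτ : τ ∈ vanishing A.graphᶜ D) {x : X} (hx : f x ∈ U) {d : ℤ}
    (hd : τ - d • omegaV (fun z => z.2 - s z.1) ∈ nullAt A.graph (f x, F x) D) :
    FibreDegree τ (f x) d := by
  have hi : Continuous fun z : Unit × (Fin D → ℝ) => (f x, z.2) := by fun_prop
  set φ : Cochain (Unit × (Fin D → ℝ)) ℤ D :=
    pb (fun z : Unit × (Fin D → ℝ) => (f x, z.2)) τ - d • omegaV (fun z => z.2 - s (f x)) with hφ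
  have h0 : φ ∈ nullAt {((), F x)} ((), F x) D := by
    have h1 := nullAt_pb (f := fun z : Unit × (Fin D → ℝ) => (f x, z.2)) (p := ((), F x))
      (Γ := {((), F x)}) (Filter.Eventually.of_forall fun z => hi.continuousAt)
      (Filter.Eventually.of_forall fun z hz => by
        have := (h.mem_graph_iff (z := (f x, z.2)) hx).1 hz
        rw [← h.eq x hx, sub_eq_zero] at this
        exact Prod.ext rfl this) hd
    rw [pb_sub, pb_zsmul, pb_omegaV] at h1
    exact h1
  have hv : ∀ z ∉ ({((), F x)} : Set (Unit × (Fin D → ℝ))), VanishesNear φ z := by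
    intro z hz
    have hz' : z.2 - s (f x) ≠ 0 := fun h' => hz (Prod.ext rfl (by
      rw [← h.eq x hx, sub_eq_zero] at h'; exact h'))
    refine VanishesNear.sub (VanishesNear.pb (hτ _ fun hg => hz' ?_) hi.continuousAt) ?_
    · exact (h.mem_graph_iff (z := (f x, z.2)) hx).1 hg
    · refine VanishesNear.zsmul (vanishesNear_omega
        (fun l _ => coordL_continuousAt (by fun_prop) l) ?_) d
      by_contra! h1
      exact hz' (coordL_eq_zero_iff.1 h1)
  have hflat : Flat {((), F x)} ((), F x) D fun l (z : Unit × (Fin D → ℝ)) =>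
      coordL D l (z.2 - F x) :=
    flat_point (ContinuousLinearEquiv.refl ℝ (Fin D → ℝ)) (κ := fun z => z.2 - F x)
      (κ' := fun w => ((), w + F x)) (Filter.Eventually.of_forall fun z => by fun_prop)
      (Filter.Eventually.of_forall fun z => by fun_prop)
      (Filter.Eventually.of_forall fun z => by simp)
      (Filter.Eventually.of_forall fun z => by simp) (sub_self _)
  have h1 : φ ∈ exactOn (compactSupp (Unit × (Fin D → ℝ)) ℤ) Set.univ D := by
    refine mem_exactOn_compactSupp_of_vanishing isCompact_singleton ?_ hv
    refine mem_exactOn_of_nullAt (N := D) ?_ le_rfl isCompact_singleton subset_rfl ?_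
    · rintro p rfl i hi ψ hψ hc
      exact hflat.mem_nullAt hψ hc hi.ne
    · rintro p rfl
      exact h0
  have h2 := shear_sub_mem_exactOn (Y := Unit) (s := fun _ => s (f x)) continuous_const
    (φ := omegaV fun z : Unit × (Fin D → ℝ) => z.2) (fun z => vanishesNear_cob_omegaV _ z)
    (fun z hz => vanishesNear_omega (fun l _ => coordL_continuousAt (by fun_prop) l) (by
      by_contra! h1
      exact hz (coordL_eq_zero_iff.1 h1)))
  have h3 := add_mem h1 (zsmul_mem h2 d)
  rw [pb_omegaV, zsmul_sub, hφ, sub_add_sub_cancel] at h3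
  exact h3

variable [T2Space Y] [LocallyCompactSpace Y] [CompactSpace X]

/-- A path in `Y` is a homotopy between fibre inclusions, with compact supports because the graph is
compact. -/
theorem fibreDegree_of_joined {τ : Cochain (Y × (Fin D → ℝ)) ℤ D}
    (hτ : τ ∈ vanishing A.graphᶜ D) (hc : ∀ z, VanishesNear (cob τ) z) {y y' : Y}
    (hy : Joined y y') {d : ℤ} (h : FibreDegree τ y d) : FibreDegree τ y' d := by
  obtain ⟨τ', ⟨C, hC, hτC⟩, hv⟩ := exists_compactSupp_sub A.isCompact_graph
    (φ := τ) (fun z hz => hτ z hz)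
  obtain ⟨γ⟩ := hy
  have hi : ∀ y : Y, Continuous fun z : Unit × (Fin D → ℝ) => (y, z.2) := fun y => by fun_prop
  have key := homotopy_exactOn_compactSupp
    (h := fun t (z : Unit × (Fin D → ℝ)) => (γ.extend t, z.2)) (by fun_prop)
    (fun z => vanishesNear_cob_congr (hc z) (hv z)) hτC (fun t => ⟨Set.univ ×ˢ (Prod.snd '' C),
      isCompact_univ.prod (hC.image continuous_snd),
      Filter.Eventually.of_forall fun t' z hz => ⟨trivial, _, hz, rfl⟩⟩) 1 0
  simp only [Path.extend_one, Path.extend_zero] at key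
  have h1 := add_mem key h
  refine mem_exactOn_congr h1 fun z _ => ?_
  have e : pb (fun z : Unit × (Fin D → ℝ) => (y', z.2)) τ - d • omegaV (fun z => z.2) -
      (pb (fun z : Unit × (Fin D → ℝ) => (y', z.2)) τ' -
        pb (fun z : Unit × (Fin D → ℝ) => (y, z.2)) τ' +
        (pb (fun z : Unit × (Fin D → ℝ) => (y, z.2)) τ - d • omegaV (fun z => z.2))) =
      pb (fun z : Unit × (Fin D → ℝ) => (y, z.2)) (τ' - τ) -
        pb (fun z : Unit × (Fin D → ℝ) => (y', z.2)) (τ' - τ) := by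
    rw [pb_sub, pb_sub]; abel
  rw [e]
  exact ((hv _).pb (hi y).continuousAt).sub ((hv _).pb (hi y').continuousAt)

/-- The local coefficient along `U` equals a fibre degree, which is constant on path components of
all of `Y`. This extends the sign from `U` to a locally constant function. -/
theorem exists_sign [LocallyPathConnectedSpace Y] (h : IsSection f F U s)
    {τ : Cochain (Y × (Fin D → ℝ)) ℤ D} (hτ : τ ∈ vanishing A.graphᶜ D)
    (hc : ∀ z, VanishesNear (cob τ) z) (hN : ∀ x, A.Normalized x τ) :
    ∃ χ : Y → ℤ, IsLocallyConstant χ ∧ (∀ y, χ y = 1 ∨ χ y = -1) ∧ ∀ x, f x ∈ U →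
      τ - χ (f x) • omegaV (fun z => z.2 - s z.1) ∈ nullAt A.graph (f x, F x) D := by
  classical
  -- The default `-1` is also used on components where the degree is unrelated to the section; there
  -- the value is irrelevant.
  refine ⟨fun y => if FibreDegree τ y 1 then 1 else -1, ?_, fun y => ?_, fun x hx => ?_⟩
  · rw [IsLocallyConstant.iff_eventually_eq]
    intro y
    filter_upwards [(IsOpen.pathComponent y).mem_nhds (mem_pathComponent_self y)] with y' hy'
    have hj : Joined y y' := hy'
    have : FibreDegree τ y' 1 ↔ FibreDegree τ y 1 :=
      ⟨fibreDegree_of_joined (A := A) hτ hc hj.symm, fibreDegree_of_joined (A := A) hτ hc hj⟩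
    simp only [this]
  · by_cases h1 : FibreDegree τ y 1 <;> simp [h1]
  · obtain ⟨d, hd1, hd⟩ := h.exists_degree hτ hc (hN x) hx
    have hf := h.fibreDegree hτ hx hd
    rcases hd1 with rfl | rfl
    · simpa only [if_pos hf] using hd
    · have : ¬ FibreDegree τ (f x) 1 := fun h1 => by
        have := hf.unique h1; norm_num at this
      simpa only [if_neg this] using hd

end Adapted

/-! ### Tautness of the embedded space. -/

section Taut

variable {X Y G : Type*} [AddCommGroup G] [TopologicalSpace X] [TopologicalSpace Y] {k D : ℕ}

/-- A cocycle that becomes exact after pullback to `X` is exact near the graph of `X → Y`. -/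
theorem pb_fst_mem_exactOn_range [CompactSpace X] {f : X → Y} {F : X → Fin D → ℝ}
    (hf : Continuous f) (hF : IsEmbedding F) {b : Cochain Y G k}
    (hc : ∀ y, VanishesNear (cob b) y) (hb : pb f b ∈ exactOn (fun _ => ⊤) Set.univ k) :
    pb (Prod.fst : Y × (Fin D → ℝ) → Y) b ∈
      exactOn (fun _ => ⊤) (Set.range fun x => (f x, F x)) k := by
  rcases isEmpty_or_nonempty X with hX | hX
  · exact mem_exactOn_of_vanishing fun z ⟨x, _⟩ => isEmptyElim x
  -- A choice of nearest point replaces a neighbourhood retraction. It need not be continuous, but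
  -- it is so at points of the image of `F`, which suffices for germs along the graph.
  have hmin : ∀ v : Fin D → ℝ, ∃ x, ∀ x', ‖F x - v‖ ≤ ‖F x' - v‖ := fun v => by
    obtain ⟨x, -, hx⟩ := isCompact_univ.exists_isMinOn (Set.univ_nonempty (α := X))
      (f := fun x => ‖F x - v‖) ((hF.continuous.sub continuous_const).norm.continuousOn)
    exact ⟨x, fun x' => hx (Set.mem_univ x')⟩
  choose q hq using hmin
  have hqF : ∀ x, q (F x) = x := fun x => hF.injective (by
    have := hq (F x) x
    rw [sub_self, norm_zero] at this
    exact sub_eq_zero.1 (norm_le_zero_iff.1 this))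
  have hqc : ∀ x, ContinuousAt q (F x) := fun x => by
    rw [hF.toIsInducing.continuousAt_iff, Metric.continuousAt_iff]
    intro ε hε
    refine ⟨ε / 2, by positivity, fun v hv => ?_⟩
    simp only [Function.comp_apply, hqF]
    have h1 := hq v x
    rw [dist_eq_norm] at hv ⊢
    have h2 : ‖F (q v) - F x‖ ≤ ‖F (q v) - v‖ + ‖v - F x‖ := norm_sub_le_norm_sub_add_norm_sub _ _ _
    rw [norm_sub_rev (F x) v] at h1
    linarith
  have hqs : ∀ x, ContinuousAt (fun z : Y × (Fin D → ℝ) => q z.2) (f x, F x) := fun x =>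
    ContinuousAt.comp (f := Prod.snd) (hqc x) continuousAt_snd
  -- Near the graph the projection and `f ∘ q` are close, so a single prism compares them.
  have h1 : pb (Prod.fst : Y × (Fin D → ℝ) → Y) b - pb (fun z : Y × (Fin D → ℝ) => f (q z.2)) b ∈
      exactOn (fun _ => ⊤) (Set.range fun x => (f x, F x)) k := by
    refine pb_sub_pb_mem_exactOn ?_ fun _ _ => AddSubgroup.mem_top _
    rintro _ ⟨x, rfl⟩
    obtain ⟨V, hV, hVb⟩ := hc (f x)
    have h2 : ∀ᶠ z : Y × (Fin D → ℝ) in 𝓝 (f x, F x), z.1 ∈ V :=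
      (continuous_fst.tendsto (f x, F x)).eventually hV
    have h3 : ∀ᶠ z : Y × (Fin D → ℝ) in 𝓝 (f x, F x), f (q z.2) ∈ V := by
      have : ContinuousAt (fun z : Y × (Fin D → ℝ) => f (q z.2)) (f x, F x) :=
        hf.continuousAt.comp (hqs x)
      exact this.preimage_mem_nhds (by simpa only [hqF] using hV)
    exact vanishesNear_prism (h2.and h3) hVb (fun u hu => hu.2) (fun u hu => hu.1)
  have h2 : pb (fun z : Y × (Fin D → ℝ) => f (q z.2)) b ∈
      exactOn (fun _ => ⊤) (Set.range fun x => (f x, F x)) k :=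
    exactOn_pb (f := fun z : Y × (Fin D → ℝ) => q z.2) (L := Set.univ)
      (fun _ _ _ => AddSubgroup.mem_top _) (fun _ _ => trivial)
      (by rintro _ ⟨x, rfl⟩; exact hqs x) hb
  have := add_mem h1 h2
  rwa [sub_add_cancel] at this

end Taut

/-! ### The umkehr argument on cochains. -/

section Main

variable {X Y G : Type*} [AddCommGroup G] [TopologicalSpace X] [TopologicalSpace Y] {k n D : ℕ}

/-- If `b = δγ` near Γ, then `±(τ ∪ γ)` is a primitive of `τ ∪ b`, and τ confines its support to Γ.
-/
theorem cup_mem_exactOn_of_exactOn {M : Type*} [TopologicalSpace M] {Γ : Set M}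
    {τ : Cochain M ℤ n} (hτ : τ ∈ vanishing Γᶜ n) (hc : ∀ z, VanishesNear (cob τ) z)
    {b : Cochain M G k} (hb : b ∈ exactOn (fun _ => ⊤) Γ k) {N : ℕ} (h : k + n = N) :
    cup h τ b ∈ exactOn (fun j => vanishing Γᶜ j) Γ N := by
  cases k with
  | zero => exact mem_exactOn_of_vanishing fun x hx => (mem_exactOn_zero.1 hb x hx).cup_right h τ
  | succ k =>
    obtain ⟨γ, -, hγ⟩ := mem_exactOn_succ.1 hb
    obtain ⟨N, rfl⟩ : ∃ N', N = N' + 1 := ⟨k + n, by omega⟩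
    have h' : k + n = N := by omega
    refine mem_exactOn_succ.2 ⟨((-1 : ℤ) ^ n) • cup h' τ γ, zsmul_mem (K := vanishing Γᶜ N) (fun z hz =>
      (hτ z hz).cup_left h' γ) _, fun z hz => ?_⟩
    have e : cup h τ b - cob (((-1 : ℤ) ^ n) • cup h' τ γ) = cup h τ (b - cob γ) -
        ((-1 : ℤ) ^ n) • cup (by omega : k + (n + 1) = N + 1) (cob τ) γ := by
      rw [map_zsmul, cob_cup, smul_add, smul_smul, ← mul_pow, neg_one_mul, neg_neg, one_pow,
        one_smul, cup_sub_right]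
      abel
    rw [e]
    exact ((hγ z hz).cup_right h τ).sub (((hc z).cup_left _ γ).zsmul _)

theorem cup_mem_exactOn_of_exactOn_left {M : Type*} [TopologicalSpace M] {Γ L K : Set M}
    {τ : Cochain M ℤ n} (hτ : τ ∈ exactOn (fun j => vanishing Γᶜ j) L n) {b : Cochain M G k}
    (hc : ∀ z, VanishesNear (cob b) z) (hb : b ∈ vanishing Kᶜ k) (hL : Γ ∩ K ⊆ L) {N : ℕ}
    (h : k + n = N) : cup h τ b ∈ exactOn (fun j => vanishing Lᶜ j) L N := by
  cases n with
  | zero => exact mem_exactOn_of_vanishing fun x hx => (mem_exactOn_zero.1 hτ x hx).cup_left h b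
  | succ n =>
    subst h
    obtain ⟨ψ, hψ, hv⟩ := mem_exactOn_succ.1 hτ
    refine mem_exactOn_succ.2 ⟨cup rfl ψ b, fun z hz => ?_, fun z hz => ?_⟩
    · by_cases hzK : z ∈ K
      · exact (hψ z fun h' => hz (hL ⟨h', hzK⟩)).cup_left _ b
      · exact (hb z hzK).cup_right _ ψ
    · have e : cup rfl τ b - cob (cup rfl ψ b) = cup rfl (τ - cob ψ) b -
          ((-1 : ℤ) ^ n) • cup (by omega : k + 1 + n = k + n + 1) ψ (cob b) := by
        rw [cob_cup, cup_sub_left]; abel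
      rw [e]
      exact ((hv z hz).cup_left _ b).sub (((hc z).cup_right _ ψ).zsmul _)

/-- A bump function equal to 1 near `K` extends the section to all of `Y` without changing its germ
along `K`. -/
theorem exists_extension [T2Space Y] [CompactSpace Y] {U K : Set Y} (hU : IsOpen U)
    (hK : IsCompact K) (hKU : K ⊆ U) {s : Y → Fin D → ℝ} (hs : ContinuousOn s U) :
    ∃ s' : Y → Fin D → ℝ, Continuous s' ∧ ∀ y ∈ K, ∀ᶠ y' in 𝓝 y, s' y' = s y' := by
  obtain ⟨L, hL, hKL, hLU⟩ := exists_compact_between hK hU hKU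
  obtain ⟨ρ, h1, h2, -⟩ := exists_tsupport_one_of_isOpen_isClosed hU
    isClosed_closure.isCompact hL.isClosed hLU
  refine ⟨fun y => ρ y • s y, ?_, fun y hy => ?_⟩
  · exact (ρ.continuous.continuousOn.smul hs).continuous_of_tsupport_subset hU
      ((tsupport_smul_subset_left _ _).trans h1)
  · filter_upwards [isOpen_interior.mem_nhds (hKL hy)] with y' hy'
    have : ρ y' = 1 := h2 (interior_subset hy')
    rw [this, one_smul]

variable [CompactSpace X] [T2Space Y] [CompactSpace Y] [LocallyPathConnectedSpace Y]
  {f : X → Y} {F : X → Fin D → ℝ}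

/-- Injectivity of `f^*` on the classes of cocycles supported in `U`. -/
theorem Adapted.mem_exactOn_of_pb (A : Adapted n f F) {U K : Set Y} {s : Y → Fin D → ℝ}
    (h : Adapted.IsSection f F U s) (hK : IsCompact K) (hKU : K ⊆ U) {b : Cochain Y G k}
    (hc : ∀ y, VanishesNear (cob b) y) (hbK : b ∈ vanishing Kᶜ k)
    (hb : pb f b ∈ exactOn (fun _ => ⊤) Set.univ k) :
    b ∈ exactOn (compactSupp Y G) Set.univ k := by
  obtain ⟨τ, hτ, hτc, hN⟩ := A.exists_graph_class
  obtain ⟨χ, hχ, hχ1, hχd⟩ := Adapted.exists_sign h hτ hτc hN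
  obtain ⟨s', hs', hss⟩ := exists_extension h.isOpen hK hKU h.continuousOn
  set B : Cochain (Y × (Fin D → ℝ)) G k := pb Prod.fst b with hB
  have hBc : ∀ z, VanishesNear (cob B) z := fun z => (hc z.1).pb continuous_fst.continuousAt
  have hBK : B ∈ vanishing (Prod.fst ⁻¹' K)ᶜ k := fun z hz =>
    VanishesNear.pb (hbK z.1 hz) continuous_fst.continuousAt
  have hχ' : IsLocallyConstant fun z : Y × (Fin D → ℝ) => χ z.1 := hχ.comp_continuous continuous_fst
  set w : Cochain (Y × (Fin D → ℝ)) ℤ D := omegaV fun z => z.2 - s' z.1 with hw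
  -- This is the vanishing of `f_! f^* b`.
  have h1 : cup rfl τ B ∈ exactOn (compactSupp (Y × (Fin D → ℝ)) G) Set.univ (k + D) :=
    mem_exactOn_compactSupp_of_vanishing A.isCompact_graph
      (cup_mem_exactOn_of_exactOn hτ hτc
        (pb_fst_mem_exactOn_range A.continuous_map A.isEmbedding hc hb) rfl)
      (fun z hz => (hτ z hz).cup_left rfl B)
  set φ : Cochain (Y × (Fin D → ℝ)) ℤ D := τ - cut (fun z => χ z.1) w with hφ
  set L : Set (Y × (Fin D → ℝ)) := (fun y => (y, s y)) '' K with hL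
  set Γ : Set (Y × (Fin D → ℝ)) := A.graph ∩ Prod.fst ⁻¹' U with hΓ
  have hLc : IsCompact L :=
    hK.image_of_continuousOn (continuousOn_id.prodMk (h.continuousOn.mono hKU))
  have hpt : ∀ y ∈ U, ∃ x, (f x, F x) = (y, s y) ∧ f x ∈ U := fun y hy => by
    obtain ⟨x, rfl⟩ := h.exists_eq y hy
    exact ⟨x, by rw [h.eq x hy], hy⟩
  have hLΓ : L ⊆ Γ := by
    rintro _ ⟨y, hy, rfl⟩
    obtain ⟨x, hx, -⟩ := hpt y (hKU hy)
    exact ⟨⟨x, hx⟩, hKU hy⟩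
  -- Over the support of `b` the class τ is the signed class of the section, up to a locally null
  -- error.
  have hφL : ∀ p ∈ L, φ ∈ nullAt Γ p D := by
    rintro _ ⟨y, hy, rfl⟩
    obtain ⟨x, hx, hxU⟩ := hpt y (hKU hy)
    obtain ⟨rfl, hxs⟩ := Prod.mk.inj hx
    change φ ∈ nullAt Γ (f x, s (f x)) D
    rw [← hx]
    have h2 : φ ∈ nullAt A.graph (f x, F x) D := by
      refine mem_nullAt_congr (hχd x hxU) ?_
      have e : φ - (τ - χ (f x) • omegaV (fun z => z.2 - s z.1)) =
          -(cut (fun z => χ z.1) w - χ (f x) • w) -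
            χ (f x) • (w - omegaV (fun z => z.2 - s z.1)) := by
        rw [hφ, zsmul_sub]; abel
      rw [e]
      refine (vanishesNear_cut_sub_zsmul (χ := fun z : Y × (Fin D → ℝ) => χ z.1)
        (hχ'.eventually_eq _) w).neg.sub (VanishesNear.zsmul (vanishesNear_omega_sub ?_) _)
      filter_upwards [(continuous_fst.tendsto (f x, F x)).eventually (hss _ hy)] with z hz l _
      rw [hz]
    refine nullAt_mono ?_ h2
    filter_upwards [h.eventually_mem (p := (f x, F x)) hxU] with z hz hz' using ⟨hz', hz⟩
  have hφe : φ ∈ exactOn (fun j => vanishing Γᶜ j) L D := by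
    refine mem_exactOn_of_nullAt (N := D) ?_ le_rfl hLc hLΓ hφL
    rintro _ ⟨⟨x, rfl⟩, hx⟩ i hi ψ hψ hψc
    have := (A.flat_graph x).mem_nullAt (k := i) (φ := ψ)
      (suppAt_mono (Filter.Eventually.of_forall fun z hz => hz.1) hψ) hψc hi.ne
    refine nullAt_mono ?_ this
    filter_upwards [h.eventually_mem (p := (f x, F x)) hx] with z hz hz' using ⟨hz', hz⟩
  have hΓL : ∀ z, z.1 ∈ K → z.2 = s z.1 → z ∈ L := fun z hz hz' => ⟨z.1, hz, Prod.ext rfl hz'.symm⟩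
  -- The error is exact near `L`, and the support of `B` restricts its product to `L`, which is
  -- compact.
  have h2 : cup rfl φ B ∈ exactOn (compactSupp (Y × (Fin D → ℝ)) G) Set.univ (k + D) := by
    refine mem_exactOn_compactSupp_of_vanishing hLc
      (cup_mem_exactOn_of_exactOn_left hφe hBc hBK ?_ rfl) fun z hz => ?_
    · rintro z ⟨hz, hzK⟩
      exact hΓL z hzK (sub_eq_zero.1 ((h.mem_graph_iff hz.2).1 hz.1))
    · by_cases hzK : z.1 ∈ K
      · have hne : z.2 - s z.1 ≠ 0 := fun h' => hz (hΓL z hzK (sub_eq_zero.1 h'))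
        refine VanishesNear.cup_left rfl (VanishesNear.sub (hτ z fun h' =>
          hne ((h.mem_graph_iff (hKU hzK)).1 h')) (VanishesNear.cut ?_ _)) B
        refine vanishesNear_omega (fun l _ => coordL_continuousAt (by fun_prop) l) ?_
        by_contra! h'
        have := coordL_eq_zero_iff.1 h'
        rw [(hss _ hzK).self_of_nhds] at this
        exact hne this
      · exact (hBK z hzK).cup_right rfl φ
  have h3 : cut (fun z => χ z.1) (iterV B fun z => z.2 - s' z.1) ∈
      exactOn (compactSupp (Y × (Fin D → ℝ)) G) Set.univ (k + D) := by
    have h4 := sub_mem h1 h2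
    rw [← cup_sub_left, hφ, sub_sub_cancel] at h4
    rw [← cup_omegaV]
    convert h4 using 1
    funext t
    simp only [cut, cup, hw, smul_smul, smul_eq_mul]
    rfl
  -- Multiplying by χ once more removes the sign, since `χ² = 1`.
  have h4 : (iterV B fun z => z.2 - s' z.1) ∈
      exactOn (compactSupp (Y × (Fin D → ℝ)) G) Set.univ (k + D) := by
    convert cut_mem_exactOn_compactSupp hχ' h3 using 1
    funext t
    simp only [cut, smul_smul]
    rcases hχ1 (t 0).1 with h5 | h5 <;> simp [h5]
  -- Fibrewise translation turns the class of the section into that of the zero section, so the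
  -- suspension of `b` itself is exact.
  have h5 := shear_sub_mem_exactOn hs' (φ := iterV B fun z => z.2)
    (fun z => vanishesNear_cob_iterV (hBc z) _) (fun z hz => vanishesNear_iter
      (fun l _ => coordL_continuousAt (by fun_prop) l) (by
        by_contra! h'
        exact hz (coordL_eq_zero_iff.1 h')))
  have e : pb (fun z : Y × (Fin D → ℝ) => (z.1, z.2 - s' z.1)) (iterV B fun z => z.2) =
      iterV B fun z => z.2 - s' z.1 := by
    rw [pb_iterV]; rfl
  have h6 := sub_mem h4 h5
  rw [e, sub_sub_cancel] at h6
  exact mem_exactOn_of_iterV ⟨Set.univ, isCompact_univ, fun t ht => (ht 0 trivial).elim⟩ hc h6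

end Main

/-! ### Translation to cohomology modules, and invariance of dimension. -/

section Bridge

variable {R : Type*} [Ring R] {A : Type*} [AddCommGroup A] [Module R A] {X Y : Type*}
  [TopologicalSpace X] [TopologicalSpace Y] {k : ℕ}

theorem mem_coboundaries_iff {φ : Cochain X A k} :
    φ ∈ coboundaries R X A k ↔ φ ∈ exactOn (fun _ => ⊤) Set.univ k := by
  cases k with
  | zero => exact ⟨fun h x _ => h x, fun h x => h x trivial⟩
  | succ k =>
    rw [mem_exactOn_succ]
    constructor
    · intro h
      obtain ⟨_, ⟨ψ, rfl⟩, l, hl, rfl⟩ := Submodule.mem_sup.1 h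
      refine ⟨ψ, AddSubgroup.mem_top _, fun x _ => ?_⟩
      rw [coboundary_eq_cob, add_sub_cancel_left]
      exact hl x
    · rintro ⟨ψ, -, h⟩
      exact Submodule.mem_sup.2 ⟨_, ⟨ψ, rfl⟩, φ - cob ψ, fun x => h x trivial, by
        rw [coboundary_eq_cob]; abel⟩

theorem compactPullback_comp_of_leftInverse {g : X → Y} {g' : Y → X} (hg : IsProperMap g)
    (hg' : IsProperMap g') (h : Function.LeftInverse g' g) (a : CompactCohomology R X A k) :
    compactPullback R A g hg k (compactPullback R A g' hg' k a) = a := by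
  obtain ⟨φ, rfl⟩ := Submodule.Quotient.mk_surjective _ a
  refine congrArg (Submodule.Quotient.mk) (Subtype.ext ?_)
  funext s
  exact congrArg φ.1 (funext fun i => h (s i))

theorem compactPullback_bijective {g : X → Y} (hg : IsProperMap g) (h : IsHomeomorph g) :
    Function.Bijective (compactPullback R A g hg k) := by
  have hl := (h.homeomorph g).symm_apply_apply
  have hr := (h.homeomorph g).apply_symm_apply
  have hg' : IsProperMap (h.homeomorph g).symm := (h.homeomorph g).symm.isProperMap
  exact ⟨Function.LeftInverse.injective (g := compactPullback R A _ hg' k)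
      (compactPullback_comp_of_leftInverse hg' hg hr),
    Function.RightInverse.surjective (g := compactPullback R A _ hg' k)
      (compactPullback_comp_of_leftInverse hg hg' hl)⟩

/-- Invariance of dimension. -/
theorem dimension_eq {n₁ n₂ : ℕ} {e₁ : OpenPartialHomeomorph X (EuclideanSpace ℝ (Fin n₁))}
    {e₂ : OpenPartialHomeomorph X (EuclideanSpace ℝ (Fin n₂))} {x : X} (h₁ : x ∈ e₁.source)
    (h₂ : x ∈ e₂.source) : n₁ = n₂ := by
  by_contra hne
  -- The first chart makes local cohomology at `x` vanish outside degree `n₁`, while the second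
  -- gives a class of infinite order in degree `n₂`.
  have h := (flat_chart h₁).mem_nullAt (flat_chart h₂).omega_mem_suppAt
    (by rw [cob_omega]; exact VanishesNear.zero x) (Ne.symm hne)
  exact one_ne_zero ((flat_chart h₂).eq_zero_of_zsmul_mem_nullAt (m := 1) (by rwa [one_smul]))

end Bridge

/-! ### Application to oriented compact manifolds. -/

section Manifold

variable {n : ℕ} {X : Type*} [TopologicalSpace X] [T2Space X] [CompactSpace X]
  [ChartedSpace (EuclideanSpace ℝ (Fin n)) X]
  {Y : Type*} [TopologicalSpace Y] [T2Space Y] [CompactSpace Y]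
  [ChartedSpace (EuclideanSpace ℝ (Fin n)) Y]

theorem _root_.OrientedAtlas.det_fderiv_pos (o : OrientedAtlas n X)
    {e e' : OpenPartialHomeomorph X (EuclideanSpace ℝ (Fin n))} (he : e ∈ o.charts)
    (he' : e' ∈ o.charts) {x : X} (hx : x ∈ e.source) (hx' : x ∈ e'.source) :
    0 < (fderiv ℝ (e.symm.trans e') (e x)).det :=
  o.det_pos e he e' he' _ (by simp [hx, hx'])

theorem exists_adapted (o₁ : OrientedAtlas n X) (o₂ : OrientedAtlas n Y) (f : C(X, Y)) :
    ∃ (D : ℕ) (F : X → Fin D → ℝ), Nonempty (Adapted n f F) := by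
  obtain ⟨D, F, hF, hinj, h⟩ := exists_embedding o₁.exists_mem_source
  choose e he V hVo hxV hVs P I hPI hPF using h
  choose c hc hcs using fun x => o₂.exists_mem_source (f x)
  exact ⟨D, F, ⟨{
    e := e, c := c, V := V, P := P, I := I
    continuous_map := f.continuous
    isEmbedding := (hF.isClosedEmbedding hinj).isEmbedding
    isOpen_V := hVo
    mem_V := hxV
    V_subset := hVs
    P_I := hPI
    P_F := hPF
    mem_c := hcs
    det_e := fun x x' z h h' => o₁.det_fderiv_pos (he x) (he x') h h'
    det_c := fun x x' z h h' => o₂.det_fderiv_pos (hc x) (hc x') h h' }⟩⟩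

open Classical in
theorem exists_section {D : ℕ} (f : C(X, Y)) (F : X → Fin D → ℝ) (hF : Continuous F)
    (U : Opens Y) (hf : IsHomeomorph (restrictOpen f U)) :
    ∃ s : Y → Fin D → ℝ, Adapted.IsSection f F U s := by
  let g := hf.homeomorph
  refine ⟨fun y => if h : y ∈ U then F (g.symm ⟨y, h⟩).1 else 0, U.2, ?_, fun y hy => ?_,
    fun x hx => ?_⟩
  · rw [continuousOn_iff_continuous_domRestrict]
    have : Continuous fun y : (U : Set Y) => F (g.symm y).1 :=
      hF.comp (continuous_subtype_val.comp g.symm.continuous)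
    exact this.congr fun y =>
      (dif_pos (show y.1 ∈ U from y.2) :
        (if h : y.1 ∈ U then F (g.symm ⟨y.1, h⟩).1 else 0) = F (g.symm y).1).symm
  · exact ⟨(g.symm ⟨y, hy⟩).1, congrArg Subtype.val (g.apply_symm_apply ⟨y, hy⟩)⟩
  · have h1 : g.symm ⟨f x, hx⟩ = ⟨x, hx⟩ := g.symm_apply_apply ⟨x, hx⟩
    rw [dif_pos (show f x ∈ U from hx), h1]

/-- The content of surjectivity at the level of cochains: a cocycle with compact support in `U` is
exact on `Y` once its pullback to `X` is exact. -/
theorem cochainExtend_mem_coboundaries_of_pullback {R : Type*} [Ring R] {A : Type*}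
    [AddCommGroup A] [Module R A] {k : ℕ} (o₁ : OrientedAtlas n X) (o₂ : OrientedAtlas n Y)
    (f : C(X, Y)) (U : Opens Y) (hf : IsHomeomorph (restrictOpen f U)) {φ : Cochain U A k}
    (hφ : φ ∈ compactCocycles R U A k)
    (h : cochainPullback R A f k (cochainExtend R A U k φ) ∈ coboundaries R X A k) :
    cochainExtend R A U k φ ∈ coboundaries R Y A k := by
  obtain ⟨D, F, ⟨a⟩⟩ := exists_adapted o₁ o₂ f
  obtain ⟨s, hs⟩ := exists_section f F a.isEmbedding.continuous U hf
  have : LocallyPathConnectedSpace Y :=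
    ChartedSpace.locallyPathConnectedSpace (EuclideanSpace ℝ (Fin n)) Y
  obtain ⟨K, hK, hφK⟩ := hφ.1
  have hK' : IsCompact (Subtype.val '' K) := hK.image continuous_subtype_val
  refine mem_coboundaries_iff.2 (exactOn_mono (fun _ => le_top) subset_rfl
    (a.mem_exactOn_of_pb hs hK' ?_ (cochainExtend_mem_cocycles R A hφ) ?_
      (mem_coboundaries_iff.1 h)))
  · rintro _ ⟨y, -, rfl⟩
    exact y.2
  · exact fun y hy => vanishesNear_of_notMem hK'.isClosed
      (fun t ht => cochainExtend_eq_zero R A hφK ht) hy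

end Manifold
end AlexanderSpanier

open AlexanderSpanier in
theorem lemma1 {R : Type*} [Ring R] {A : Type*} [AddCommGroup A] [Module R A] {n₁ n₂ : ℕ}
    {X₁ : Type*} [TopologicalSpace X₁] [T2Space X₁] [CompactSpace X₁]
    [ChartedSpace (EuclideanSpace ℝ (Fin n₁)) X₁] [IsManifold (𝓡 n₁) ∞ X₁]
    (o₁ : OrientedAtlas n₁ X₁)
    {X₂ : Type*} [TopologicalSpace X₂] [T2Space X₂] [CompactSpace X₂]
    [ChartedSpace (EuclideanSpace ℝ (Fin n₂)) X₂] [IsManifold (𝓡 n₂) ∞ X₂]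
    (o₂ : OrientedAtlas n₂ X₂)
    (f : C(X₁, X₂)) (U₂ : Opens X₂)
    (hf : IsHomeomorph (AlexanderSpanier.restrictOpen f U₂)) (k : ℕ) :
    Function.Bijective (AlexanderSpanier.kerPullback R A f U₂ k) := by
  have hbij := compactPullback_bijective (R := R) (A := A) (k := k)
    (isProperMap_restrictOpen f U₂) hf
  refine ⟨fun a b hab => Subtype.ext (hbij.1 (congrArg Subtype.val hab)), fun a => ?_⟩
  obtain ⟨b, hb⟩ := hbij.2 a.1
  suffices hk : extendByZero R A U₂ k b = 0 from ⟨⟨b, hk⟩, Subtype.ext hb⟩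
  -- The naturality square turns membership of the preimage's pullback in the kernel into vanishing
  -- of `f^*` of the extension.
  have h0 : pullback R A f f.continuous k (extendByZero R A U₂ k b) = 0 := by
    rw [← extendByZero_compactPullback, hb]
    exact a.2
  obtain ⟨φ, rfl⟩ := Submodule.Quotient.mk_surjective _ b
  have h1 : (⟨cochainPullback R A f k (cochainExtend R A U₂ k φ.1),
      cochainPullback_mem_cocycles R A f.continuous (cochainExtend_mem_cocycles R A φ.2)⟩ :
        cocycles R X₁ A k) ∈ (coboundaries R X₁ A k).submoduleOf (cocycles R X₁ A k) :=
    (Submodule.Quotient.mk_eq_zero _).1 h0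
  refine (Submodule.Quotient.mk_eq_zero _).2 ?_
  change cochainExtend R A U₂ k φ.1 ∈ coboundaries R X₂ A k
  -- If `U₂` is empty there is nothing to extend, and the dimensions may differ. Otherwise charts at
  -- corresponding points of `f⁻¹(U₂)` and `U₂` force `n₁ = n₂`.
  rcases isEmpty_or_nonempty U₂ with hU | ⟨⟨y⟩⟩
  · have : cochainExtend R A U₂ k φ.1 = 0 := by
      funext s
      exact dif_neg fun h => hU.elim ⟨s 0, h 0⟩
    rw [this]
    exact zero_mem _
  · let g := hf.homeomorph
    obtain ⟨e₁, -, h₁⟩ := o₁.exists_mem_source (g.symm y).1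
    obtain ⟨e₂, -, h₂⟩ := o₂.exists_mem_source y.1
    obtain rfl : n₁ = n₂ := dimension_eq (x := g.symm y) (e₁ := e₁.subtypeRestr ⟨g.symm y⟩)
      (e₂ := g.toOpenPartialHomeomorph.trans (e₂.subtypeRestr ⟨y⟩))
      (by simpa using h₁) (by simpa using h₂)
    exact cochainExtend_mem_coboundaries_of_pullback o₁ o₂ f U₂ hf φ.2 h1
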